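/- Let $F:[0,\infty)\to[0,1)$ be the Minkowski question mark function, $$F([a_0,a_1,a_2,\dots])=1-2^{-a_0}+2^{-(a_0+a_1)}-2^{-(a_0+a_1+a_2)}+\cdots,$$ where $[a_0,a_1,a_2,\dots]$ is the regular continued fraction of $x$ (the series terminates for rational $x$), and for $L\ge 1$ let $m_L=2\int_0^1x^L\,dF(x)$. There is a unique sequence of polynomials $B_n\in\mathbb{Q}[z]$ $(n\ge 0)$ with $B_0=-1$ and $\deg B_n\le n-1$ for $n\ge1$, such that the rational functions $H_n(z)=\dfrac{B_n(z)}{(z-2)^{n+1}}$ satisfy, for every $n\ge 1$ and all complex $z\ne 0,1$, $$\sum_{j=1}^{n}\frac{2}{j!}H_{n-j}^{(j)}(2z)\,z^{j}+\sum_{j=0}^{n-1}\frac{1}{j!}H_{n-j-1}^{(j)}(2z)\,z^{j}-\sum_{j=1}^{n}\frac{2}{j!}H_{n-j}^{(j)}\Big(\frac2z\Big)\frac{1}{z^{j+2}}-\sum_{j=0}^{n-1}\frac{1}{j!}H_{n-j-1}^{(j)}\Big(\frac2z\Big)\frac{1}{z^{j+2}}$$ $$=2H_n(z+1)-2H_n(2z)+2H_n\Big(\frac2z\Big)\frac1{z^2}.$$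 For this sequence and every integer $L\ge1$, the numbers $H_n^{(L-1)}(0)$ are rational and $$m_L=\lim_{n\to\infty}2^{2-n}\sum_{a_1+\cdots+a_s=n}[0,a_1,\dots,a_s]^L=\frac{1}{(L-1)!}\sum_{n=0}^{\infty}(-1)^nH_n^{(L-1)}(0),$$ where the middle sum is over all $s\ge 1$ and all positive integers $a_1,\dots,a_s$ with sum $n$ and $a_s\ge2$, and the series on the right converges (absolutely). Moreover, for every $M\in\mathbb{N}$ there is a constant $C$ depending only on $L$ and $M$ such that $|H_n^{(L-1)}(0)|\le C\,n^{-M}$ for all $n\ge1$. -/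

import Mathlib

open Filter Topology MeasureTheory
open scoped Polynomial Nat

namespace MinkowskiMoments

noncomputable section

/-- The `n`-th partial quotient `a_n` of the regular continued fraction `x = [a_0, a_1, a_2, …]`,
where `a_0 = ⌊x⌋`; by convention it is `0` when the (finite) expansion has stopped before `n`. -/
def partialQuotient (x : ℝ) (n : ℕ) : ℤ :=
  match GenContFract.IntFractPair.stream x n with
  | none => 0
  | some p => p.b

/-- The term `(-1)^n 2^{-(a_0 + ⋯ + a_n)}`; it is `0` when the expansion of `x` has stopped
before `n`. -/
def questionMarkTerm (x : ℝ) (n : ℕ) : ℝ :=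
  match GenContFract.IntFractPair.stream x n with
  | none => 0
  | some _ => (-1) ^ n * (2 : ℝ) ^ (-∑ k ∈ Finset.range (n + 1), partialQuotient x k)

/-- The Minkowski question mark function `F` on `[0, ∞)`,
`F([a_0, a_1, a_2, …]) = 1 - 2^{-a_0} + 2^{-(a_0+a_1)} - 2^{-(a_0+a_1+a_2)} + ⋯`,
extended by `0` to the negative reals. -/
def questionMark (x : ℝ) : ℝ :=
  if x < 0 then 0 else 1 - ∑' n, questionMarkTerm x n

/-! ### `F` is monotone (needed to form the Stieltjes measure `dF`) -/

lemma partialQuotient_zero (x : ℝ) : partialQuotient x 0 = ⌊x⌋ := rfl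

lemma partialQuotient_succ {x : ℝ} (h : Int.fract x ≠ 0) (n : ℕ) :
    partialQuotient x (n + 1) = partialQuotient (Int.fract x)⁻¹ n := by
  simp only [partialQuotient, GenContFract.IntFractPair.stream_succ h]

lemma questionMarkTerm_zero (x : ℝ) : questionMarkTerm x 0 = (2 : ℝ) ^ (-⌊x⌋) := by
  have : GenContFract.IntFractPair.stream x 0 = some (GenContFract.IntFractPair.of x) := rfl
  simp [questionMarkTerm, this, partialQuotient_zero]

lemma questionMarkTerm_succ {x : ℝ} (h : Int.fract x ≠ 0) (n : ℕ) :
    questionMarkTerm x (n + 1) =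
      -((2 : ℝ) ^ (-⌊x⌋) * questionMarkTerm (Int.fract x)⁻¹ n) := by
  unfold questionMarkTerm
  rw [GenContFract.IntFractPair.stream_succ h]
  cases GenContFract.IntFractPair.stream (Int.fract x)⁻¹ n with
  | none => simp
  | some p =>
    simp only
    rw [Finset.sum_range_succ' _ (n + 1), partialQuotient_zero]
    simp only [partialQuotient_succ h]
    rw [neg_add, zpow_add₀ (by norm_num), pow_succ]
    ring

lemma questionMarkTerm_succ_of_fract_eq_zero {x : ℝ} (h : Int.fract x = 0) (n : ℕ) :
    questionMarkTerm x (n + 1) = 0 := by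
  have hx : x = ((⌊x⌋ : ℤ) : ℝ) := by
    have := Int.floor_add_fract x
    rw [h, add_zero] at this
    exact this.symm
  unfold questionMarkTerm
  rw [hx, GenContFract.IntFractPair.stream_succ_of_int]

lemma one_le_inv_fract {x : ℝ} (h : Int.fract x ≠ 0) : 1 ≤ (Int.fract x)⁻¹ :=
  (one_le_inv₀ (lt_of_le_of_ne (Int.fract_nonneg x) (Ne.symm h))).2 (Int.fract_lt_one x).le

lemma zpow_neg_floor_le_one {x : ℝ} (hx : 0 ≤ x) : (2 : ℝ) ^ (-⌊x⌋) ≤ 1 := by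
  apply zpow_le_one_of_nonpos₀ (by norm_num)
  have := Int.floor_nonneg.2 hx
  omega

lemma zpow_neg_floor_le_half {x : ℝ} (hx : 1 ≤ x) : (2 : ℝ) ^ (-⌊x⌋) ≤ 1 / 2 := by
  have h1 : (1 : ℤ) ≤ ⌊x⌋ := Int.le_floor.2 (by simpa using hx)
  calc (2 : ℝ) ^ (-⌊x⌋) ≤ (2 : ℝ) ^ (-1 : ℤ) :=
        zpow_le_zpow_right₀ (by norm_num) (by omega)
    _ = 1 / 2 := by norm_num

lemma abs_questionMarkTerm_le (n : ℕ) :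
    ∀ x : ℝ, 1 ≤ x → |questionMarkTerm x n| ≤ (1 / 2 : ℝ) * (1 / 2) ^ n := by
  induction n with
  | zero =>
    intro x hx
    rw [questionMarkTerm_zero, abs_of_pos (by positivity)]
    simpa using zpow_neg_floor_le_half hx
  | succ n ih =>
    intro x hx
    by_cases h : Int.fract x = 0
    · rw [questionMarkTerm_succ_of_fract_eq_zero h, abs_zero]
      positivity
    · rw [questionMarkTerm_succ h, abs_neg, abs_mul, abs_of_pos (by positivity), pow_succ']
      exact mul_le_mul (zpow_neg_floor_le_half hx)
        ((ih _ (one_le_inv_fract h)).trans_eq (by ring)) (abs_nonneg _) (by norm_num)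

lemma summable_bound : Summable fun n : ℕ => (1 / 2 : ℝ) * (1 / 2) ^ n :=
  (summable_geometric_of_lt_one (by norm_num) (by norm_num)).mul_left _

lemma summable_questionMarkTerm_of_one_le {x : ℝ} (hx : 1 ≤ x) :
    Summable (questionMarkTerm x) :=
  Summable.of_norm_bounded summable_bound fun n => abs_questionMarkTerm_le n x hx

lemma abs_tsum_questionMarkTerm_le {x : ℝ} (hx : 1 ≤ x) : |∑' n, questionMarkTerm x n| ≤ 1 := by
  have h := tsum_of_norm_bounded (f := questionMarkTerm x) summable_bound.hasSum
    fun n => abs_questionMarkTerm_le n x hx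
  rw [tsum_mul_left, tsum_geometric_of_lt_one (by norm_num) (by norm_num)] at h
  norm_num at h
  exact h

/-- The tail `1 - F(x')` of the expansion of `x`, where `x' = 1 / {x}`; it is `0` when `x` is an
integer. -/
def questionMarkTail (x : ℝ) : ℝ :=
  if Int.fract x = 0 then 0 else ∑' n, questionMarkTerm (Int.fract x)⁻¹ n

lemma tsum_questionMarkTerm (x : ℝ) :
    ∑' n, questionMarkTerm x n = (2 : ℝ) ^ (-⌊x⌋) * (1 - questionMarkTail x) := by
  have hs : Summable (questionMarkTerm x) := by
    rw [← summable_nat_add_iff 1]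
    by_cases h : Int.fract x = 0
    · simp only [questionMarkTerm_succ_of_fract_eq_zero h]
      exact summable_zero
    · simp only [questionMarkTerm_succ h]
      exact ((summable_questionMarkTerm_of_one_le (one_le_inv_fract h)).mul_left _).neg
  rw [hs.tsum_eq_zero_add, questionMarkTerm_zero, questionMarkTail]
  split_ifs with h
  · simp [questionMarkTerm_succ_of_fract_eq_zero h]
  · simp only [questionMarkTerm_succ h]
    rw [tsum_neg, tsum_mul_left]
    ring

lemma tsum_questionMarkTerm_nonneg (x : ℝ) : 0 ≤ ∑' n, questionMarkTerm x n := by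
  rw [tsum_questionMarkTerm]
  refine mul_nonneg (by positivity) ?_
  rw [questionMarkTail]
  split_ifs with h
  · norm_num
  · have := (abs_le.1 (abs_tsum_questionMarkTerm_le (one_le_inv_fract h))).2
    linarith

lemma questionMarkTail_nonneg (x : ℝ) : 0 ≤ questionMarkTail x := by
  rw [questionMarkTail]
  split_ifs with h
  · exact le_rfl
  · exact tsum_questionMarkTerm_nonneg _

lemma questionMarkTail_le_half (x : ℝ) : questionMarkTail x ≤ 1 / 2 := by
  rw [questionMarkTail]
  split_ifs with h
  · norm_num
  · rw [tsum_questionMarkTerm]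
    have h1 := zpow_neg_floor_le_half (one_le_inv_fract h)
    have h2 := questionMarkTail_nonneg (Int.fract x)⁻¹
    have h3 : (0 : ℝ) < (2 : ℝ) ^ (-⌊(Int.fract x)⁻¹⌋) := by positivity
    nlinarith

lemma tsum_questionMarkTerm_sub_le_of {ε : ℝ} (hε : 0 ≤ ε)
    (hind : ∀ x y : ℝ, 1 ≤ x → x ≤ y →
      ∑' n, questionMarkTerm y n - ∑' n, questionMarkTerm x n ≤ ε) {x y : ℝ} (hxy : x ≤ y) :
    ∑' n, questionMarkTerm y n - ∑' n, questionMarkTerm x n ≤ (2 : ℝ) ^ (-⌊x⌋) * ε := by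
  rw [tsum_questionMarkTerm x, tsum_questionMarkTerm y]
  have hpos : (0 : ℝ) < (2 : ℝ) ^ (-⌊x⌋) := by positivity
  rcases (Int.floor_mono hxy).eq_or_lt with hfl | hfl
  · rw [← hfl]
    have hfr : Int.fract x ≤ Int.fract y := by
      rw [← Int.self_sub_floor, ← Int.self_sub_floor, ← hfl]
      linarith
    have key : questionMarkTail x - questionMarkTail y ≤ ε := by
      by_cases hx : Int.fract x = 0
      · have := questionMarkTail_nonneg y
        have h0 : questionMarkTail x = 0 := by simp [questionMarkTail, hx]
        linarith
      · have hx0 : 0 < Int.fract x := lt_of_le_of_ne (Int.fract_nonneg x) (Ne.symm hx)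
        have hy : Int.fract y ≠ 0 := (hx0.trans_le hfr).ne'
        simp only [questionMarkTail, hx, hy, if_false]
        exact hind _ _ (one_le_inv_fract hy) (inv_anti₀ hx0 hfr)
    nlinarith
  · have h1 : (2 : ℝ) ^ (-⌊y⌋) ≤ (2 : ℝ) ^ (-⌊x⌋) * (1 / 2) := by
      calc (2 : ℝ) ^ (-⌊y⌋) ≤ (2 : ℝ) ^ (-⌊x⌋ + -1) :=
            zpow_le_zpow_right₀ (by norm_num) (by omega)
        _ = (2 : ℝ) ^ (-⌊x⌋) * (1 / 2) := by
            rw [zpow_add₀ (by norm_num)]; norm_num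
    have hpos' : (0 : ℝ) < (2 : ℝ) ^ (-⌊y⌋) := by positivity
    have h2 := questionMarkTail_le_half x
    have h3 := questionMarkTail_nonneg y
    nlinarith

lemma tsum_questionMarkTerm_sub_le (N : ℕ) :
    ∀ x y : ℝ, 1 ≤ x → x ≤ y →
      ∑' n, questionMarkTerm y n - ∑' n, questionMarkTerm x n ≤ (1 / 2 : ℝ) ^ N := by
  induction N with
  | zero =>
    intro x y hx hxy
    have h1 := (abs_le.1 (abs_tsum_questionMarkTerm_le (hx.trans hxy))).2
    have h2 := tsum_questionMarkTerm_nonneg x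
    simp only [pow_zero]
    linarith
  | succ N ih =>
    intro x y hx hxy
    refine (tsum_questionMarkTerm_sub_le_of (by positivity) ih hxy).trans ?_
    rw [pow_succ']
    exact mul_le_mul_of_nonneg_right (zpow_neg_floor_le_half hx) (by positivity)

lemma tsum_questionMarkTerm_antitone {x y : ℝ} (hxy : x ≤ y) :
    ∑' n, questionMarkTerm y n ≤ ∑' n, questionMarkTerm x n := by
  have h1 : ∀ x y : ℝ, 1 ≤ x → x ≤ y →
      ∑' n, questionMarkTerm y n - ∑' n, questionMarkTerm x n ≤ 0 := by
    intro x y hx hxy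
    exact ge_of_tendsto' (tendsto_pow_atTop_nhds_zero_of_lt_one (by norm_num) (by norm_num))
      fun N => tsum_questionMarkTerm_sub_le N x y hx hxy
  have := tsum_questionMarkTerm_sub_le_of le_rfl h1 hxy
  linarith

lemma questionMark_nonneg (x : ℝ) : 0 ≤ questionMark x := by
  rw [questionMark]
  split_ifs with h
  · exact le_rfl
  · rw [tsum_questionMarkTerm]
    have h1 := zpow_neg_floor_le_one (not_lt.1 h)
    have h2 := questionMarkTail_nonneg x
    have h3 : (0 : ℝ) < (2 : ℝ) ^ (-⌊x⌋) := by positivity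
    nlinarith

lemma questionMark_monotone : Monotone questionMark := by
  intro x y hxy
  by_cases hx : x < 0
  · have : questionMark x = 0 := by simp [questionMark, hx]
    rw [this]
    exact questionMark_nonneg y
  · have hy : ¬ y < 0 := fun h => hx (hxy.trans_lt h)
    simp only [questionMark, hx, hy, if_false]
    have := tsum_questionMarkTerm_antitone hxy
    linarith

/-! ### Moments -/

/-- The Stieltjes measure `dF` of the monotone function `F`. -/
def questionMarkMeasure : Measure ℝ :=
  questionMark_monotone.stieltjesFunction.measure

/-- The moment `m_L = 2 ∫_0^1 x^L dF(x)`. -/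
def moment (L : ℕ) : ℝ :=
  2 * ∫ x in Set.Icc (0 : ℝ) 1, x ^ L ∂questionMarkMeasure

/-- The value of the finite continued fraction `[0, a_1, …, a_s]`. -/
def cfValue : List ℕ → ℝ
  | [] => 0
  | a :: l => 1 / (a + cfValue l)

/-- The sum of `[0, a_1, …, a_s]^L` over all `(a_1, …, a_s)` with `a_i ≥ 1`, `a_s ≥ 2` and
`a_1 + ⋯ + a_s = n`. -/
def generationSum (L n : ℕ) : ℝ :=
  ∑ c : Composition n with 2 ≤ c.blocks.getLastD 0, cfValue c.blocks ^ L

/-! ### The rational functions `H_n` -/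

/-- The rational function `H_n(z) = B_n(z) / (z - 2)^{n+1}` with numerator `B_n ∈ ℚ[z]`. -/
def ratFun (B : ℕ → ℚ[X]) (n : ℕ) (z : ℂ) : ℂ :=
  Polynomial.aeval z (B n) / (z - 2) ^ (n + 1)

/-- `B` is the sequence of numerators of the rational functions `H_n`: `H_0(z) = 1 / (2 - z)`,
and for `n ≥ 1` the polynomial `B_n` has degree at most `n - 1` and `H_n` solves the recurrence
which determines it from `H_0, …, H_{n-1}`, as an identity at all `z` at which no pole occurs. -/
structure IsNumeratorSeq (B : ℕ → ℚ[X]) : Prop where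
  zero : B 0 = -1
  degree_lt : ∀ n, 1 ≤ n → (B n).degree < n
  recurrence : ∀ n, 1 ≤ n → ∀ z : ℂ, z ≠ 0 → z ≠ 1 →
    (∑ j ∈ Finset.Icc 1 n, 2 / (j ! : ℂ) * iteratedDeriv j (ratFun B (n - j)) (2 * z) * z ^ j)
      + (∑ j ∈ Finset.range n,
          1 / (j ! : ℂ) * iteratedDeriv j (ratFun B (n - j - 1)) (2 * z) * z ^ j)
      - (∑ j ∈ Finset.Icc 1 n,
          2 / (j ! : ℂ) * iteratedDeriv j (ratFun B (n - j)) (2 / z) * (1 / z ^ (j + 2)))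
      - (∑ j ∈ Finset.range n,
          1 / (j ! : ℂ) * iteratedDeriv j (ratFun B (n - j - 1)) (2 / z) * (1 / z ^ (j + 2)))
      = 2 * ratFun B n (z + 1) - 2 * ratFun B n (2 * z) + 2 * ratFun B n (2 / z) * (1 / z ^ 2)

end

end MinkowskiMoments

open MinkowskiMoments

namespace MinkowskiMoments

/-! Deform the problem by a complex parameter p. Iterate the average of a function over the two maps
x ↦ (x+1)/p and x ↦ (1/x+1)/p (`iterAvg`). At p = 1, in the variable x = 1/[0,a_1,…,a_s], the first
map raises a_1 by one and the second prepends a quotient 1. Hence k averages of x^{-L}, taken at x =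
2, give 2^{-k} `generationSum L (k+2)`. At p = 2 both maps fix 1 and everything is trivial.

For p = 2+w with w small, both maps contract a small disc about 1, and the iterated averages
converge to a linear functional E_w (`limAvg`) that is invariant under the two maps. H_n(ζ) is the
coefficient of w^n in E_w[1/(pX-ζ)]. The invariance becomes a functional equation
(`avgJets_functional`) whose w^n-coefficient is the recurrence. Rationality of the coefficients
comes from the same invariance applied to powers of Y = pX-2 (`coeff_powJets_mem`). Uniqueness comes
from the leading pole coefficient at z = 1 (`eq_zero_of_homogeneous`). Differentiating at ζ = 0, the
numbers H_n^{(L-1)}(0)/(L-1)! are the Taylor coefficients of E_w[(pX)^{-L}], and the series in the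
theorem is its value at w = -1, that is p = 1.

The point w = -1 lies on the unit circle, so the convergence there needs an argument. The k-th and
(k+1)-st averages differ by a function of w that is holomorphic on |w| < 1 + c/(k+2)² and O(t^k)
there with t < 1. Cauchy's estimates, summed over k, give coefficients decaying faster than any
power of n (`exists_rapidly_decreasing_coeff`). The bound O(t^k) comes from a contraction: n shifts
followed by an inversion form v ↦ p^n/(1+…+p^{n-1}+v), which contracts the disc |v-2| < √5 by a
fixed factor as soon as `DiscGood n p` holds. By the maximum principle this condition need only be
checked on a circle through p = 1, where it is the real inequality `boundary_ge`.

Finally, 2 dF on [0,1] is invariant under the two Farey branches (`unitMeasure_eq`). The contraction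
at p = 1 makes the oscillation of the iterated averages on [0,1] tend to 0, so they tend to m_L
(`tendsto_momentAvg_moment`). -/

/-! ### Real inequalities on the boundary circle Re (p-1)⁻¹ = 49/100 -/

lemma taylor_le_cosh (y : ℝ) : 1 + y ^ 2 / 2 + y ^ 4 / 24 ≤ Real.cosh y := by
  have h := Real.hasSum_cosh y
  have h2 := h.summable.sum_le_tsum (Finset.range 3) fun i _ => by
    rw [pow_mul]; positivity
  rw [h.tsum_eq] at h2
  simp only [Finset.sum_range_succ, Finset.sum_range_zero, Nat.factorial] at h2
  norm_num at h2
  linarith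

lemma taylor_le_sinh {y : ℝ} (hy : 0 ≤ y) : y + y ^ 3 / 6 + y ^ 5 / 120 ≤ Real.sinh y := by
  have h := Real.hasSum_sinh y
  have h2 := h.summable.sum_le_tsum (Finset.range 3) fun i _ => by positivity
  rw [h.tsum_eq] at h2
  simp only [Finset.sum_range_succ, Finset.sum_range_zero, Nat.factorial] at h2
  norm_num at h2
  linarith

/-- The bound t - t³/3 is false for arctan, so 1/3 is lowered to 6/25. The derivative of the
difference is then nonnegative exactly while t² ≤ 7/18, a range that contains all angles of the
boundary circle. -/
lemma arctan_le_of_sq_le {t : ℝ} (ht : 0 ≤ t) (ht2 : t ^ 2 ≤ 7 / 18) :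
    Real.arctan t ≤ t * (1 - 6 / 25 * t ^ 2) := by
  have hmono : MonotoneOn (fun t : ℝ => t * (1 - 6 / 25 * t ^ 2) - Real.arctan t)
      (Set.Icc 0 (Real.sqrt (7 / 18))) := by
    have hd : ∀ x : ℝ, HasDerivAt (fun t : ℝ => t * (1 - 6 / 25 * t ^ 2) - Real.arctan t)
        (1 - 18 / 25 * x ^ 2 - 1 / (1 + x ^ 2)) x := by
      intro x
      have h1 := ((hasDerivAt_id x).mul (((hasDerivAt_pow 2 x).const_mul (6 / 25 : ℝ)).const_sub 1)).sub
        (Real.hasDerivAt_arctan x)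
      exact h1.congr_deriv (by simp; ring)
    refine monotoneOn_of_deriv_nonneg (convex_Icc _ _) ?_ ?_ ?_
    · exact fun x _ => (hd x).continuousAt.continuousWithinAt
    · exact fun x _ => (hd x).differentiableAt.differentiableWithinAt
    · intro x hx
      rw [interior_Icc] at hx
      rw [(hd x).deriv]
      have hx2 : x ^ 2 ≤ 7 / 18 := by
        have := Real.sq_sqrt (show (0 : ℝ) ≤ 7 / 18 by norm_num)
        nlinarith [hx.1, hx.2]
      have : (1 - 18 / 25 * x ^ 2 - 1 / (1 + x ^ 2)) =
          x ^ 2 * (7 / 25 - 18 / 25 * x ^ 2) / (1 + x ^ 2) := by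
        field_simp; ring
      rw [this]
      apply div_nonneg (mul_nonneg (sq_nonneg x) (by linarith)) (by positivity)
  have h0 := hmono (Set.left_mem_Icc.2 (Real.sqrt_nonneg _)) ⟨ht, Real.le_sqrt_of_sq_le ht2⟩ ht
  simp at h0
  linarith

/-- The left side is the [2/2] Padé approximant of log(1+e) at 0. The derivative of the error is a
perfect fourth power over a positive quantity. -/
lemma pade_le_log_one_add {e : ℝ} (he : 0 ≤ e) :
    3 * e * (2 + e) / (6 + 6 * e + e ^ 2) ≤ Real.log (1 + e) := by
  have hmono : MonotoneOn (fun e : ℝ => Real.log (1 + e) - 3 * e * (2 + e) / (6 + 6 * e + e ^ 2))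
      (Set.Ici 0) := by
    have hd : ∀ x : ℝ, 0 ≤ x → HasDerivAt
        (fun e : ℝ => Real.log (1 + e) - 3 * e * (2 + e) / (6 + 6 * e + e ^ 2))
        (x ^ 4 / ((1 + x) * (6 + 6 * x + x ^ 2) ^ 2)) x := by
      intro x hx
      have hn : HasDerivAt (fun e : ℝ => 3 * e * (2 + e)) (6 + 6 * x) x := by
        have := ((hasDerivAt_id x).const_mul 3).mul ((hasDerivAt_id x).const_add 2)
        exact this.congr_deriv (by simp; ring)
      have hde : HasDerivAt (fun e : ℝ => 6 + 6 * e + e ^ 2) (6 + 2 * x) x := by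
        have := (((hasDerivAt_id x).const_mul 6).const_add 6).add (hasDerivAt_pow 2 x)
        exact this.congr_deriv (by simp)
      have hl : HasDerivAt (fun e : ℝ => Real.log (1 + e)) (1 / (1 + x)) x :=
        ((hasDerivAt_id x).const_add 1).log (by simp; linarith)
      have := hl.sub (hn.div hde (by positivity))
      refine this.congr_deriv ?_
      have : 1 + x ≠ 0 := by positivity
      have : 6 + 6 * x + x ^ 2 ≠ 0 := by positivity
      field_simp
      ring
    refine monotoneOn_of_deriv_nonneg (convex_Ici _) ?_ ?_ ?_
    · exact fun x hx => (hd x hx).continuousAt.continuousWithinAt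
    · intro x hx
      rw [interior_Ici] at hx
      exact (hd x (le_of_lt hx)).differentiableAt.differentiableWithinAt
    · intro x hx
      rw [interior_Ici] at hx
      have hx' : (0 : ℝ) < x := hx
      rw [(hd x hx'.le).deriv]
      positivity
  have h0 := hmono (Set.mem_Ici.2 le_rfl) (Set.mem_Ici.2 he) he
  simp at h0
  linarith

/-- The hyperbolic part of the boundary function. -/
noncomputable def hypPart (Q y : ℝ) : ℝ := (Q - 101 / 100) * (Real.cosh y - 1) + 49 / 25 * Real.sinh y

lemma one_sub_exp_neg (y : ℝ) : Real.sinh y - (Real.cosh y - 1) = 1 - Real.exp (-y) := by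
  rw [← Real.cosh_sub_sinh]; ring

/-- For Q ≥ 101/100 both summands increase. For smaller Q, rewrite the sum as (101/100 - Q)(1 -
e^{-y}) + (Q + 95/100) sinh y, which again has increasing summands. -/
lemma hypPart_mono {Q : ℝ} (hQ : 6 / 25 ≤ Q) {x y : ℝ} (hx : 0 ≤ x) (hxy : x ≤ y) :
    hypPart Q x ≤ hypPart Q y := by
  have hs : Real.sinh x ≤ Real.sinh y := Real.sinh_le_sinh.2 hxy
  have hc : Real.cosh x ≤ Real.cosh y :=
    Real.cosh_le_cosh.2 (by rwa [abs_of_nonneg hx, abs_of_nonneg (hx.trans hxy)])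
  have he : Real.exp (-y) ≤ Real.exp (-x) := Real.exp_le_exp.2 (by linarith)
  have h1 := one_sub_exp_neg x
  have h2 := one_sub_exp_neg y
  unfold hypPart
  rcases le_total (101 / 100) Q with h | h <;> nlinarith

/-- Evaluate at the smallest admissible y = c/T, truncate the Taylor series, and clear T^5. The
polynomial hypothesis in T alone is what remains; K stands for a lower bound of the trigonometric
part. -/
lemma le_hypPart_of_one_le {T Q y c K : ℝ} (hT : 0 < T) (hQ : Q = T ^ 2 + 2401 / 10000)
    (hQ1 : 101 / 100 ≤ Q) (hc : 0 ≤ c) (hy : c ≤ T * y)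
    (hW : 0 ≤ (K - 101 / 50) * T ^ 5 + (T ^ 2 - 7699 / 10000) * (c ^ 2 / 2 * T ^ 3 + c ^ 4 / 24 * T)
      + 49 / 25 * (c * T ^ 4 + c ^ 3 / 6 * T ^ 2 + c ^ 5 / 120)) :
    101 / 50 ≤ K + hypPart Q y := by
  have hy' : c / T ≤ y := by rw [div_le_iff₀ hT]; linarith
  have hy0 : 0 ≤ c / T := by positivity
  refine le_trans ?_ (add_le_add_right (hypPart_mono (by linarith) hy0 hy') K)
  have h1 := taylor_le_cosh (c / T)
  have h2 := taylor_le_sinh hy0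
  have h3 : K - 101 / 50 + ((Q - 101 / 100) * ((c / T) ^ 2 / 2 + (c / T) ^ 4 / 24)
      + 49 / 25 * (c / T + (c / T) ^ 3 / 6 + (c / T) ^ 5 / 120)) =
      ((K - 101 / 50) * T ^ 5 + (T ^ 2 - 7699 / 10000) * (c ^ 2 / 2 * T ^ 3 + c ^ 4 / 24 * T)
      + 49 / 25 * (c * T ^ 4 + c ^ 3 / 6 * T ^ 2 + c ^ 5 / 120)) / T ^ 5 := by
    rw [hQ]; field_simp; ring
  have h4 := div_nonneg hW (pow_pos hT 5).le
  rw [← h3] at h4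
  have h5 : (Q - 101 / 100) * ((c / T) ^ 2 / 2 + (c / T) ^ 4 / 24) ≤
      (Q - 101 / 100) * (Real.cosh (c / T) - 1) :=
    mul_le_mul_of_nonneg_left (by linarith) (by linarith)
  unfold hypPart
  linarith

/-- Here the coefficient of cosh y - 1 is negative, so the decomposition with 1 - e^{-y} is used and
only sinh is truncated. -/
lemma le_hypPart_of_le_one {T Q y c K : ℝ} (hT : 0 < T) (hQ : Q = T ^ 2 + 2401 / 10000)
    (hQ1 : Q ≤ 101 / 100) (hc : 0 ≤ c) (hy : c ≤ T * y)
    (hW : 0 ≤ (K - 101 / 50) * T ^ 5 + (T ^ 2 + 11901 / 10000) *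
      (c * T ^ 4 + c ^ 3 / 6 * T ^ 2 + c ^ 5 / 120)) :
    101 / 50 ≤ K + hypPart Q y := by
  have hy' : c / T ≤ y := by rw [div_le_iff₀ hT]; linarith
  have hy0 : 0 ≤ c / T := by positivity
  refine le_trans ?_ (add_le_add_right (hypPart_mono (by rw [hQ]; nlinarith) hy0 hy') K)
  have h1 := one_sub_exp_neg (c / T)
  have h2 := taylor_le_sinh hy0
  have h3 : K - 101 / 50 + (Q + 95 / 100) * (c / T + (c / T) ^ 3 / 6 + (c / T) ^ 5 / 120) =
      ((K - 101 / 50) * T ^ 5 + (T ^ 2 + 11901 / 10000) *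
      (c * T ^ 4 + c ^ 3 / 6 * T ^ 2 + c ^ 5 / 120)) / T ^ 5 := by
    rw [hQ]; field_simp; ring
  have h4 := div_nonneg hW (pow_pos hT 5).le
  rw [← h3] at h4
  have h5 : (Q + 95 / 100) * (c / T + (c / T) ^ 3 / 6 + (c / T) ^ 5 / 120) ≤
      (Q + 95 / 100) * Real.sinh (c / T) :=
    mul_le_mul_of_nonneg_left (by linarith) (by rw [hQ]; nlinarith)
  have h6 : Real.exp (-(c / T)) ≤ 1 := Real.exp_le_one_iff.2 (by linarith)
  unfold hypPart
  nlinarith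

/-- On the circle p = e^{r-iθ}, with r the halved logarithm and θ the arctangent. This compares
growth with rotation: by the time the angle nθ = α is reached, the exponent y = nr satisfies Ty ≥
kα. -/
lemma log_mul_ge_arctan_mul {T Q k : ℝ} (hT : 0 ≤ T) (hQ : Q = T ^ 2 + 2401 / 10000) (hk : 0 ≤ k)
    (h : k * (6 * Q ^ 2 + 297 / 25 * Q + 9801 / 2500) *
      ((Q + 49 / 100) ^ 2 - 6 / 25 * (Q - 2401 / 10000)) ≤
      297 / 100 * (2 * Q + 99 / 50) * (Q + 49 / 100) ^ 3) :
    k * Real.arctan (T / (Q + 49 / 100)) ≤ T * (Real.log (1 + 99 / 50 / Q) / 2) := by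
  have hQ0 : 0 < Q := by rw [hQ]; positivity
  have h1 := pade_le_log_one_add (e := 99 / 50 / Q) (by positivity)
  have ht2 : (T / (Q + 49 / 100)) ^ 2 ≤ 7 / 18 := by
    rw [div_pow, div_le_iff₀ (by positivity)]
    have : T ^ 2 = Q - 2401 / 10000 := by rw [hQ]; ring
    rw [this]; nlinarith [sq_nonneg (Q - 4 / 5)]
  have h2 := arctan_le_of_sq_le (t := T / (Q + 49 / 100)) (by positivity) ht2
  have h3 : T * (3 * (99 / 50 / Q) * (2 + 99 / 50 / Q) /
      (6 + 6 * (99 / 50 / Q) + (99 / 50 / Q) ^ 2) / 2) -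
      k * (T / (Q + 49 / 100) * (1 - 6 / 25 * (T / (Q + 49 / 100)) ^ 2)) =
      T * (297 / 100 * (2 * Q + 99 / 50) * (Q + 49 / 100) ^ 3 -
        k * (6 * Q ^ 2 + 297 / 25 * Q + 9801 / 2500) *
      ((Q + 49 / 100) ^ 2 - 6 / 25 * (Q - 2401 / 10000))) /
      ((6 * Q ^ 2 + 297 / 25 * Q + 9801 / 2500) * (Q + 49 / 100) ^ 3) := by
    have e1 : 6 + 6 * (99 / 50 / Q) + (99 / 50 / Q) ^ 2 =
      (6 * Q ^ 2 + 297 / 25 * Q + 9801 / 2500) / Q ^ 2 := by field_simp; ring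
    have e2 : (T / (Q + 49 / 100)) ^ 2 = (Q - 2401 / 10000) / (Q + 49 / 100) ^ 2 := by
      rw [div_pow, hQ]; ring
    rw [e1, e2]
    have : 6 * Q ^ 2 + 297 / 25 * Q + 9801 / 2500 ≠ 0 := by positivity
    have : Q + 49 / 100 ≠ 0 := by positivity
    field_simp
    ring
  have h4 : 0 ≤ T * (297 / 100 * (2 * Q + 99 / 50) * (Q + 49 / 100) ^ 3 -
        k * (6 * Q ^ 2 + 297 / 25 * Q + 9801 / 2500) *
      ((Q + 49 / 100) ^ 2 - 6 / 25 * (Q - 2401 / 10000))) /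
      ((6 * Q ^ 2 + 297 / 25 * Q + 9801 / 2500) * (Q + 49 / 100) ^ 3) :=
    div_nonneg (mul_nonneg hT (by linarith)) (by positivity)
  rw [← h3] at h4
  have h5 := mul_le_mul_of_nonneg_left h2 hk
  have h6 := mul_le_mul_of_nonneg_left h1 hT
  linarith

/-- T²(1 - cos α) + 4T sin α + 4(1 + cos α) is a square divided by 1 - cos α. -/
lemma neg_eight_le_trigPart {T Q : ℝ} (hQ : Q = T ^ 2 + 2401 / 10000) (α : ℝ) :
    -8 ≤ (Q - 4) * (1 - Real.cos α) + 4 * T * Real.sin α := by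
  have h1 := Real.sin_sq_add_cos_sq α
  have h2 := Real.cos_le_one α
  have h3 := Real.neg_one_le_cos α
  rw [hQ]
  rcases h2.eq_or_lt with h | h
  · have : Real.sin α = 0 := by
      have : Real.sin α ^ 2 = 0 := by rw [h] at h1; linarith
      exact pow_eq_zero_iff (two_ne_zero) |>.1 this
    rw [h, this]; norm_num
  · have h4 : 0 < 1 - Real.cos α := by linarith
    have h5 : 0 ≤ (T * (1 - Real.cos α) + 2 * Real.sin α) ^ 2 / (1 - Real.cos α) := by positivity
    have h6 : (T * (1 - Real.cos α) + 2 * Real.sin α) ^ 2 / (1 - Real.cos α) =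
        T ^ 2 * (1 - Real.cos α) + 4 * T * Real.sin α + 4 * (1 + Real.cos α) := by
      have : Real.sin α ^ 2 = (1 - Real.cos α) * (1 + Real.cos α) := by linarith
      rw [div_eq_iff h4.ne']
      linear_combination 4 * this
    rw [h6] at h5
    nlinarith

/-- Each alternative pairs a bound for the trigonometric part with a lower bound for α. A larger
angle permits a worse bound, since the hyperbolic part has grown meanwhile; past 7π/6 the uniform
bound -8 is enough. -/
lemma trigPart_cases_of_nonpos {A B α : ℝ} (hA : A ≤ 0) (hB : 0 ≤ B) (hα : Real.pi / 2 ≤ α) :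
    (3 / 2 * A + 433 / 500 * B ≤ A * (1 - Real.cos α) + B * Real.sin α) ∨
    (2 * Real.pi / 3 ≤ α ∧
      18661 / 10000 * A + 1 / 2 * B ≤ A * (1 - Real.cos α) + B * Real.sin α) ∨
    (5 * Real.pi / 6 ≤ α ∧ 2 * A ≤ A * (1 - Real.cos α) + B * Real.sin α) ∨
    (Real.pi ≤ α ∧ 2 * A - 1 / 2 * B ≤ A * (1 - Real.cos α) + B * Real.sin α) ∨
    7 * Real.pi / 6 ≤ α := by
  have hpi := Real.pi_pos
  have key : ∀ c s : ℝ, -c ≤ Real.cos α → s ≤ Real.sin α →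
      (1 + c) * A + s * B ≤ A * (1 - Real.cos α) + B * Real.sin α := by
    intro c s hc hs
    nlinarith
  have hs3 : 866 / 1000 ≤ √3 / 2 ∧ √3 / 2 ≤ 8661 / 10000 := by
    have h3 := Real.sq_sqrt (show (0 : ℝ) ≤ 3 by norm_num)
    have h0 := Real.sqrt_nonneg 3
    constructor <;> nlinarith
  have cos23 : Real.cos (2 * Real.pi / 3) = -(1 / 2) := by
    rw [show 2 * Real.pi / 3 = Real.pi - Real.pi / 3 by ring, Real.cos_pi_sub, Real.cos_pi_div_three]
  have sin23 : Real.sin (2 * Real.pi / 3) = √3 / 2 := by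
    rw [show 2 * Real.pi / 3 = Real.pi - Real.pi / 3 by ring, Real.sin_pi_sub, Real.sin_pi_div_three]
  have cos56 : Real.cos (5 * Real.pi / 6) = -(√3 / 2) := by
    rw [show 5 * Real.pi / 6 = Real.pi - Real.pi / 6 by ring, Real.cos_pi_sub, Real.cos_pi_div_six]
  have sin56 : Real.sin (5 * Real.pi / 6) = 1 / 2 := by
    rw [show 5 * Real.pi / 6 = Real.pi - Real.pi / 6 by ring, Real.sin_pi_sub, Real.sin_pi_div_six]
  have anti : ∀ x, Real.pi / 2 ≤ α → α ≤ x → x ≤ Real.pi →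
      Real.cos x ≤ Real.cos α ∧ Real.sin x ≤ Real.sin α := by
    intro x h1 h2 h3
    refine ⟨Real.cos_le_cos_of_nonneg_of_le_pi (by linarith) h3 h2, ?_⟩
    rw [← Real.sin_pi_sub x, ← Real.sin_pi_sub α]
    exact Real.sin_le_sin_of_le_of_le_pi_div_two (by linarith) (by linarith) (by linarith)
  rcases le_total α (2 * Real.pi / 3) with h1 | h1
  · obtain ⟨hc, hs⟩ := anti _ hα h1 (by linarith)
    rw [cos23] at hc; rw [sin23] at hs
    left
    have := key (1 / 2) (433 / 500) hc (by linarith)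
    linarith
  rcases le_total α (5 * Real.pi / 6) with h2 | h2
  · obtain ⟨hc, hs⟩ := anti _ hα h2 (by linarith)
    rw [cos56] at hc; rw [sin56] at hs
    right; left
    have := key (8661 / 10000) (1 / 2) (by linarith) hs
    exact ⟨h1, by linarith⟩
  rcases le_total α Real.pi with h3 | h3
  · right; right; left
    have := key 1 0 (Real.neg_one_le_cos α) (Real.sin_nonneg_of_nonneg_of_le_pi (by linarith) h3)
    exact ⟨h2, by linarith⟩
  rcases le_total α (7 * Real.pi / 6) with h4 | h4
  · right; right; right; left
    have hs : -(1 / 2) ≤ Real.sin α := by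
      have : Real.sin (α - Real.pi) ≤ Real.sin (Real.pi / 6) :=
        Real.sin_le_sin_of_le_of_le_pi_div_two (by linarith) (by linarith) (by linarith)
      rw [Real.sin_sub_pi, Real.sin_pi_div_six] at this
      linarith
    have := key 1 (-(1 / 2)) (Real.neg_one_le_cos α) hs
    exact ⟨h3, by linarith⟩
  · right; right; right; right
    exact h4

lemma trigPart_cases_of_nonneg {A B α : ℝ} (hA : 0 ≤ A) (hB : 0 ≤ B) (hα : Real.pi / 2 ≤ α) :
    (A ≤ A * (1 - Real.cos α) + B * Real.sin α) ∨
    (Real.pi ≤ α ∧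
      17071 / 10000 * A - 7072 / 10000 * B ≤ A * (1 - Real.cos α) + B * Real.sin α) ∨
    (5 * Real.pi / 4 ≤ α ∧ A - B ≤ A * (1 - Real.cos α) + B * Real.sin α) ∨
    3 * Real.pi / 2 ≤ α := by
  have hpi := Real.pi_pos
  have key : ∀ c s : ℝ, Real.cos α ≤ -c → s ≤ Real.sin α →
      (1 + c) * A + s * B ≤ A * (1 - Real.cos α) + B * Real.sin α := by
    intro c s hc hs
    nlinarith
  have hs2 : 7071 / 10000 ≤ √2 / 2 ∧ √2 / 2 ≤ 7072 / 10000 := by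
    have h3 := Real.sq_sqrt (show (0 : ℝ) ≤ 2 by norm_num)
    have h0 := Real.sqrt_nonneg 2
    constructor <;> nlinarith
  rcases le_total α Real.pi with h1 | h1
  · left
    have := key 0 0 (by
      rw [neg_zero]; exact Real.cos_nonpos_of_pi_div_two_le_of_le hα (by linarith))
      (Real.sin_nonneg_of_nonneg_of_le_pi (by linarith) h1)
    linarith
  rcases le_total α (5 * Real.pi / 4) with h2 | h2
  · right; left
    have hc : Real.cos (Real.pi / 4) ≤ Real.cos (α - Real.pi) :=
      Real.cos_le_cos_of_nonneg_of_le_pi (by linarith) (by linarith) (by linarith)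
    have hs : Real.sin (α - Real.pi) ≤ Real.sin (Real.pi / 4) :=
      Real.sin_le_sin_of_le_of_le_pi_div_two (by linarith) (by linarith) (by linarith)
    rw [Real.cos_sub_pi, Real.cos_pi_div_four] at hc
    rw [Real.sin_sub_pi, Real.sin_pi_div_four] at hs
    have := key (7071 / 10000) (-(7072 / 10000)) (by linarith) (by linarith)
    exact ⟨h1, by linarith⟩
  rcases le_total α (3 * Real.pi / 2) with h3 | h3
  · right; right; left
    have := key 0 (-1) (by
      rw [neg_zero]; exact Real.cos_nonpos_of_pi_div_two_le_of_le hα (by linarith))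
      (Real.neg_one_le_sin α)
    exact ⟨h2, by linarith⟩
  · right; right; right
    exact h3

/-- These products are the Bernstein basis on [a,b] up to scaling. The polynomial inequalities below
are certified by `linarith` as nonnegative combinations of them. -/
lemma bernstein_nonneg {a b T : ℝ} (h1 : a ≤ T) (h2 : T ≤ b) (i j : ℕ) :
    0 ≤ (T - a) ^ i * (b - T) ^ j :=
  mul_nonneg (pow_nonneg (by linarith) i) (pow_nonneg (by linarith) j)

lemma boundary_ge_of_le_half {T Q α y : ℝ} (hT0 : 0 < T) (hQ : Q = T ^ 2 + 2401 / 10000) (hTa : 0 ≤ T)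
    (hTb : T ≤ 1 / 2) (hα : Real.pi / 2 ≤ α) (hy : 149 / 200 * α ≤ T * y) :
    101 / 50 ≤ (Q - 4) * (1 - Real.cos α) + 4 * T * Real.sin α + hypPart Q y := by
  have hpi := Real.pi_gt_d4
  have h8 := neg_eight_le_trigPart hQ α
  have H := bernstein_nonneg hTa hTb
  have hA : Q - 4 ≤ 0 := by rw [hQ]; nlinarith
  rcases trigPart_cases_of_nonpos hA (by linarith : 0 ≤ 4 * T) hα with h | ⟨h', h⟩ | ⟨h', h⟩ | ⟨h', h⟩ | h'
  -- c = 117/100 is 149/200 · π/2 rounded down. In every case, here and in the later ranges of T, c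
  -- is at most the slope times the smallest angle of the case, and K is the bound on the
  -- trigonometric part.
  · refine (le_hypPart_of_le_one (c := 117 / 100) (y := y) (K := (3 / 2 * (Q - 4) + 433 / 500 * (4 * T))) hT0 hQ (by rw [hQ]; nlinarith) (by norm_num) (by linarith) ?_).trans (by linarith)
    subst hQ
    linarith [H 0 7, H 1 6, H 2 5, H 3 4, H 4 3, H 5 2, H 6 1, H 7 0]
  · refine (le_hypPart_of_le_one (c := 39 / 25) (y := y) (K := (18661 / 10000 * (Q - 4) + 1 / 2 * (4 * T))) hT0 hQ (by rw [hQ]; nlinarith) (by norm_num) (by linarith) ?_).trans (by linarith)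
    subst hQ
    linarith [H 0 7, H 1 6, H 2 5, H 3 4, H 4 3, H 5 2, H 6 1, H 7 0]
  · refine (le_hypPart_of_le_one (c := 39 / 20) (y := y) (K := (-8)) hT0 hQ (by rw [hQ]; nlinarith) (by norm_num) (by linarith) ?_).trans (by linarith)
    subst hQ
    linarith [H 0 6, H 1 5, H 2 4, H 3 3, H 4 2, H 5 1, H 6 0]
  · refine (le_hypPart_of_le_one (c := 39 / 20) (y := y) (K := (-8)) hT0 hQ (by rw [hQ]; nlinarith) (by norm_num) (by linarith) ?_).trans (by linarith)
    subst hQ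
    linarith [H 0 6, H 1 5, H 2 4, H 3 3, H 4 2, H 5 1, H 6 0]
  · refine (le_hypPart_of_le_one (c := 39 / 20) (y := y) (K := (-8)) hT0 hQ (by rw [hQ]; nlinarith) (by norm_num) (by linarith) ?_).trans (by linarith)
    subst hQ
    linarith [H 0 6, H 1 5, H 2 4, H 3 3, H 4 2, H 5 1, H 6 0]

lemma boundary_ge_of_half_le {T Q α y : ℝ} (hT0 : 0 < T) (hQ : Q = T ^ 2 + 2401 / 10000) (hTa : 1 / 2 ≤ T)
    (hTb : T ≤ 351 / 400) (hQ1 : Q ≤ 101 / 100) (hα : Real.pi / 2 ≤ α) (hy : 41 / 50 * α ≤ T * y) :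
    101 / 50 ≤ (Q - 4) * (1 - Real.cos α) + 4 * T * Real.sin α + hypPart Q y := by
  have hpi := Real.pi_gt_d4
  have h8 := neg_eight_le_trigPart hQ α
  have H := bernstein_nonneg hTa hTb
  have hA : Q - 4 ≤ 0 := by rw [hQ]; nlinarith
  rcases trigPart_cases_of_nonpos hA (by linarith : 0 ≤ 4 * T) hα with h | ⟨h', h⟩ | ⟨h', h⟩ | ⟨h', h⟩ | h'
  · refine (le_hypPart_of_le_one (c := 32 / 25) (y := y) (K := (3 / 2 * (Q - 4) + 433 / 500 * (4 * T))) hT0 hQ hQ1 (by norm_num) (by linarith) ?_).trans (by linarith)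
    subst hQ
    linarith [H 0 7, H 1 6, H 2 5, H 3 4, H 4 3, H 5 2, H 6 1, H 7 0]
  · refine (le_hypPart_of_le_one (c := 171 / 100) (y := y) (K := (18661 / 10000 * (Q - 4) + 1 / 2 * (4 * T))) hT0 hQ hQ1 (by norm_num) (by linarith) ?_).trans (by linarith)
    subst hQ
    linarith [H 0 7, H 1 6, H 2 5, H 3 4, H 4 3, H 5 2, H 6 1, H 7 0]
  · refine (le_hypPart_of_le_one (c := 107 / 50) (y := y) (K := (-8)) hT0 hQ hQ1 (by norm_num) (by linarith) ?_).trans (by linarith)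
    subst hQ
    linarith [H 0 6, H 1 5, H 2 4, H 3 3, H 4 2, H 5 1, H 6 0]
  · refine (le_hypPart_of_le_one (c := 107 / 50) (y := y) (K := (-8)) hT0 hQ hQ1 (by norm_num) (by linarith) ?_).trans (by linarith)
    subst hQ
    linarith [H 0 6, H 1 5, H 2 4, H 3 3, H 4 2, H 5 1, H 6 0]
  · refine (le_hypPart_of_le_one (c := 107 / 50) (y := y) (K := (-8)) hT0 hQ hQ1 (by norm_num) (by linarith) ?_).trans (by linarith)
    subst hQ
    linarith [H 0 6, H 1 5, H 2 4, H 3 3, H 4 2, H 5 1, H 6 0]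

lemma boundary_ge_of_mid_low {T Q α y : ℝ} (hT0 : 0 < T) (hQ : Q = T ^ 2 + 2401 / 10000) (hTa : 4387 / 5000 ≤ T)
    (hTb : T ≤ 13 / 10) (hQ1 : 101 / 100 ≤ Q) (hα : Real.pi / 2 ≤ α) (hy : 22 / 25 * α ≤ T * y) :
    101 / 50 ≤ (Q - 4) * (1 - Real.cos α) + 4 * T * Real.sin α + hypPart Q y := by
  have hpi := Real.pi_gt_d4
  have h8 := neg_eight_le_trigPart hQ α
  have H := bernstein_nonneg hTa hTb
  have hA : Q - 4 ≤ 0 := by rw [hQ]; nlinarith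
  rcases trigPart_cases_of_nonpos hA (by linarith : 0 ≤ 4 * T) hα with h | ⟨h', h⟩ | ⟨h', h⟩ | ⟨h', h⟩ | h'
  · refine (le_hypPart_of_one_le (c := 69 / 50) (y := y) (K := (3 / 2 * (Q - 4) + 433 / 500 * (4 * T))) hT0 hQ hQ1 (by norm_num) (by linarith) ?_).trans (by linarith)
    subst hQ
    linarith [H 0 7, H 1 6, H 2 5, H 3 4, H 4 3, H 5 2, H 6 1, H 7 0]
  · refine (le_hypPart_of_one_le (c := 46 / 25) (y := y) (K := (18661 / 10000 * (Q - 4) + 1 / 2 * (4 * T))) hT0 hQ hQ1 (by norm_num) (by linarith) ?_).trans (by linarith)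
    subst hQ
    linarith [H 0 7, H 1 6, H 2 5, H 3 4, H 4 3, H 5 2, H 6 1, H 7 0]
  · refine (le_hypPart_of_one_le (c := 23 / 10) (y := y) (K := (2 * (Q - 4))) hT0 hQ hQ1 (by norm_num) (by linarith) ?_).trans (by linarith)
    subst hQ
    linarith [H 0 7, H 1 6, H 2 5, H 3 4, H 4 3, H 5 2, H 6 1, H 7 0]
  · refine (le_hypPart_of_one_le (c := 69 / 25) (y := y) (K := (-8)) hT0 hQ hQ1 (by norm_num) (by linarith) ?_).trans (by linarith)
    subst hQ
    linarith [H 0 5, H 1 4, H 2 3, H 3 2, H 4 1, H 5 0]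
  · refine (le_hypPart_of_one_le (c := 69 / 25) (y := y) (K := (-8)) hT0 hQ hQ1 (by norm_num) (by linarith) ?_).trans (by linarith)
    subst hQ
    linarith [H 0 5, H 1 4, H 2 3, H 3 2, H 4 1, H 5 0]

lemma boundary_ge_of_mid_high {T Q α y : ℝ} (hT0 : 0 < T) (hQ : Q = T ^ 2 + 2401 / 10000) (hTa : 13 / 10 ≤ T)
    (hTb : T ≤ 97 / 50) (hA : Q - 4 ≤ 0) (hα : Real.pi / 2 ≤ α) (hy : 183 / 200 * α ≤ T * y) :
    101 / 50 ≤ (Q - 4) * (1 - Real.cos α) + 4 * T * Real.sin α + hypPart Q y := by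
  have hpi := Real.pi_gt_d4
  have h8 := neg_eight_le_trigPart hQ α
  have H := bernstein_nonneg hTa hTb
  rcases trigPart_cases_of_nonpos hA (by linarith : 0 ≤ 4 * T) hα with h | ⟨h', h⟩ | ⟨h', h⟩ | ⟨h', h⟩ | h'
  · refine (le_hypPart_of_one_le (c := 143 / 100) (y := y) (K := (3 / 2 * (Q - 4) + 433 / 500 * (4 * T))) hT0 hQ (by rw [hQ]; nlinarith) (by norm_num) (by linarith) ?_).trans (by linarith)
    subst hQ
    linarith [H 0 7, H 1 6, H 2 5, H 3 4, H 4 3, H 5 2, H 6 1, H 7 0]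
  · refine (le_hypPart_of_one_le (c := 191 / 100) (y := y) (K := (18661 / 10000 * (Q - 4) + 1 / 2 * (4 * T))) hT0 hQ (by rw [hQ]; nlinarith) (by norm_num) (by linarith) ?_).trans (by linarith)
    subst hQ
    linarith [H 0 7, H 1 6, H 2 5, H 3 4, H 4 3, H 5 2, H 6 1, H 7 0]
  · refine (le_hypPart_of_one_le (c := 239 / 100) (y := y) (K := (2 * (Q - 4))) hT0 hQ (by rw [hQ]; nlinarith) (by norm_num) (by linarith) ?_).trans (by linarith)
    subst hQ
    linarith [H 0 7, H 1 6, H 2 5, H 3 4, H 4 3, H 5 2, H 6 1, H 7 0]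
  · refine (le_hypPart_of_one_le (c := 287 / 100) (y := y) (K := (2 * (Q - 4) - 1 / 2 * (4 * T))) hT0 hQ (by rw [hQ]; nlinarith) (by norm_num) (by linarith) ?_).trans (by linarith)
    subst hQ
    linarith [H 0 7, H 1 6, H 2 5, H 3 4, H 4 3, H 5 2, H 6 1, H 7 0]
  · refine (le_hypPart_of_one_le (c := 67 / 20) (y := y) (K := (-8)) hT0 hQ (by rw [hQ]; nlinarith) (by norm_num) (by linarith) ?_).trans (by linarith)
    subst hQ
    linarith [H 0 5, H 1 4, H 2 3, H 3 2, H 4 1, H 5 0]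

lemma boundary_ge_of_two_le {T Q α y : ℝ} (hT0 : 0 < T) (hQ : Q = T ^ 2 + 2401 / 10000) (hTa : 1939 / 1000 ≤ T)
    (hTb : T ≤ 3)
    (hA : 0 ≤ Q - 4) (hα : Real.pi / 2 ≤ α) (hy : 47 / 50 * α ≤ T * y) :
    101 / 50 ≤ (Q - 4) * (1 - Real.cos α) + 4 * T * Real.sin α + hypPart Q y := by
  have hpi := Real.pi_gt_d4
  have h8 := neg_eight_le_trigPart hQ α
  have H := bernstein_nonneg hTa hTb
  rcases trigPart_cases_of_nonneg hA (by linarith : 0 ≤ 4 * T) hα with h | ⟨h', h⟩ | ⟨h', h⟩ | h'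
  · refine (le_hypPart_of_one_le (c := 147 / 100) (y := y) (K := (Q - 4)) hT0 hQ (by linarith) (by norm_num) (by linarith) ?_).trans (by linarith)
    subst hQ
    linarith [H 0 7, H 1 6, H 2 5, H 3 4, H 4 3, H 5 2, H 6 1, H 7 0]
  · refine (le_hypPart_of_one_le (c := 59 / 20) (y := y) (K := (17071 / 10000 * (Q - 4) - 7072 / 10000 * (4 * T))) hT0 hQ (by linarith) (by norm_num) (by linarith) ?_).trans (by linarith)
    subst hQ
    linarith [H 0 7, H 1 6, H 2 5, H 3 4, H 4 3, H 5 2, H 6 1, H 7 0]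
  · refine (le_hypPart_of_one_le (c := 369 / 100) (y := y) (K := (Q - 4 - 4 * T)) hT0 hQ (by linarith) (by norm_num) (by linarith) ?_).trans (by linarith)
    subst hQ
    linarith [H 0 7, H 1 6, H 2 5, H 3 4, H 4 3, H 5 2, H 6 1, H 7 0]
  · refine (le_hypPart_of_one_le (c := 221 / 50) (y := y) (K := (-8)) hT0 hQ (by linarith) (by norm_num) (by linarith) ?_).trans (by linarith)
    subst hQ
    linarith [H 0 5, H 1 4, H 2 3, H 3 2, H 4 1, H 5 0]

lemma boundary_ge_of_three_le {T Q α y : ℝ} (hT0 : 0 < T) (hQ : Q = T ^ 2 + 2401 / 10000) (hTa : 3 ≤ T)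
    (hTb : T ≤ 5)
    (hα : Real.pi / 2 ≤ α) (hy : 24 / 25 * α ≤ T * y) :
    101 / 50 ≤ (Q - 4) * (1 - Real.cos α) + 4 * T * Real.sin α + hypPart Q y := by
  have hpi := Real.pi_gt_d4
  have h8 := neg_eight_le_trigPart hQ α
  have H := bernstein_nonneg hTa hTb
  have hA : 0 ≤ Q - 4 := by rw [hQ]; nlinarith
  rcases trigPart_cases_of_nonneg hA (by linarith : 0 ≤ 4 * T) hα with h | ⟨h', h⟩ | ⟨h', h⟩ | h'
  · refine (le_hypPart_of_one_le (c := 3 / 2) (y := y) (K := (Q - 4)) hT0 hQ (by rw [hQ]; nlinarith) (by norm_num) (by linarith) ?_).trans (by linarith)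
    subst hQ
    linarith [H 0 7, H 1 6, H 2 5, H 3 4, H 4 3, H 5 2, H 6 1, H 7 0]
  · refine (le_hypPart_of_one_le (c := 301 / 100) (y := y) (K := (17071 / 10000 * (Q - 4) - 7072 / 10000 * (4 * T))) hT0 hQ (by rw [hQ]; nlinarith) (by norm_num) (by linarith) ?_).trans (by linarith)
    subst hQ
    linarith [H 0 7, H 1 6, H 2 5, H 3 4, H 4 3, H 5 2, H 6 1, H 7 0]
  · refine (le_hypPart_of_one_le (c := 94 / 25) (y := y) (K := (Q - 4 - 4 * T)) hT0 hQ (by rw [hQ]; nlinarith) (by norm_num) (by linarith) ?_).trans (by linarith)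
    subst hQ
    linarith [H 0 7, H 1 6, H 2 5, H 3 4, H 4 3, H 5 2, H 6 1, H 7 0]
  · refine (le_hypPart_of_one_le (c := 113 / 25) (y := y) (K := (-8)) hT0 hQ (by rw [hQ]; nlinarith) (by norm_num) (by linarith) ?_).trans (by linarith)
    subst hQ
    linarith [H 0 5, H 1 4, H 2 3, H 3 2, H 4 1, H 5 0]

lemma boundary_ge_of_five_le {T Q α y : ℝ} (hT0 : 0 < T) (hQ : Q = T ^ 2 + 2401 / 10000) (hTa : 5 ≤ T)
    (hα : Real.pi / 2 ≤ α) (hy : 39 / 40 * α ≤ T * y) :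
    101 / 50 ≤ (Q - 4) * (1 - Real.cos α) + 4 * T * Real.sin α + hypPart Q y := by
  have hpi := Real.pi_gt_d4
  have h8 := neg_eight_le_trigPart hQ α
  have H := fun i : ℕ => pow_nonneg (sub_nonneg.2 hTa) i
  have hA : 0 ≤ Q - 4 := by rw [hQ]; nlinarith
  rcases trigPart_cases_of_nonneg hA (by linarith : 0 ≤ 4 * T) hα with h | ⟨h', h⟩ | ⟨h', h⟩ | h'
  · refine (le_hypPart_of_one_le (c := 153 / 100) (y := y) (K := (Q - 4)) hT0 hQ (by rw [hQ]; nlinarith) (by norm_num) (by linarith) ?_).trans (by linarith)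
    subst hQ
    linarith [H 1, H 2, H 3, H 4, H 5, H 6, H 7]
  · refine (le_hypPart_of_one_le (c := 153 / 50) (y := y) (K := (17071 / 10000 * (Q - 4) - 7072 / 10000 * (4 * T))) hT0 hQ (by rw [hQ]; nlinarith) (by norm_num) (by linarith) ?_).trans (by linarith)
    subst hQ
    linarith [H 1, H 2, H 3, H 4, H 5, H 6, H 7]
  · refine (le_hypPart_of_one_le (c := 191 / 50) (y := y) (K := (Q - 4 - 4 * T)) hT0 hQ (by rw [hQ]; nlinarith) (by norm_num) (by linarith) ?_).trans (by linarith)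
    subst hQ
    linarith [H 1, H 2, H 3, H 4, H 5, H 6, H 7]
  · refine (le_hypPart_of_one_le (c := 459 / 100) (y := y) (K := (-8)) hT0 hQ (by rw [hQ]; nlinarith) (by norm_num) (by linarith) ?_).trans (by linarith)
    subst hQ
    linarith [H 1, H 2, H 3, H 4, H 5, H 6, H 7]

/-- For A ≤ 0 ≤ B the expression is concave in α on [0, π/2], so its minimum over [θ, π/2] sits at
an endpoint; A + B is the value at π/2. -/
lemma trigPart_ge_min {A B θ α : ℝ} (hA : A ≤ 0) (hB : 0 ≤ B) (hθ : 0 ≤ θ) (hθα : θ ≤ α)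
    (hα : α ≤ Real.pi / 2) :
    min (A * (1 - Real.cos θ) + B * Real.sin θ) (A + B) ≤
      A * (1 - Real.cos α) + B * Real.sin α := by
  have hpi := Real.pi_pos
  have hsin : ConcaveOn ℝ (Set.Icc 0 (Real.pi / 2)) Real.sin :=
    strictConcaveOn_sin_Icc.concaveOn.subset (Set.Icc_subset_Icc le_rfl (by linarith))
      (convex_Icc _ _)
  have hcos : ConcaveOn ℝ (Set.Icc 0 (Real.pi / 2)) Real.cos :=
    strictConcaveOn_cos_Icc.concaveOn.subset (Set.Icc_subset_Icc (by linarith) le_rfl)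
      (convex_Icc _ _)
  have hg : ConcaveOn ℝ (Set.Icc 0 (Real.pi / 2))
      (fun x => (B • Real.sin + (-A) • Real.cos) x + A) :=
    ((hsin.smul hB).add (hcos.smul (neg_nonneg.2 hA))).add_const A
  have := hg.min_le_of_mem_Icc (x := θ) (y := Real.pi / 2) (z := α)
    ⟨hθ, by linarith⟩ ⟨by linarith, le_rfl⟩ ⟨hθα, hα⟩
  simp only [Pi.add_apply, Pi.smul_apply, smul_eq_mul, Real.sin_pi_div_two,
    Real.cos_pi_div_two] at this
  have e1 : A * (1 - Real.cos θ) + B * Real.sin θ =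
      B * Real.sin θ + -A * Real.cos θ + A := by ring
  have e2 : A + B = B * 1 + -A * 0 + A := by ring
  have e3 : A * (1 - Real.cos α) + B * Real.sin α =
      B * Real.sin α + -A * Real.cos α + A := by ring
  rw [e1, e2, e3]
  exact this

/-- The case n = 1. Here X/Q is |p|, so every term is rational in T, Q and X, and the inequality
reduces to 5.01 X ≤ 7.49 Q + 1.9401. -/
lemma boundary_ge_one {T Q : ℝ} (hQ : Q = T ^ 2 + 2401 / 10000) :
    101 / 50 ≤ (Q - 4) * (1 - Real.cos (Real.arctan (T / (Q + 49 / 100)))) +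
      4 * T * Real.sin (Real.arctan (T / (Q + 49 / 100))) +
      hypPart Q (Real.log (1 + 99 / 50 / Q) / 2) := by
  have hQ0 : 0 < Q := by rw [hQ]; positivity
  have hT2 : T ^ 2 = Q - 2401 / 10000 := by rw [hQ]; ring
  set X := √(Q * (Q + 99 / 50)) with hX
  have hX0 : 0 < X := Real.sqrt_pos.2 (by positivity)
  have hX2 : X ^ 2 = Q * (Q + 99 / 50) := Real.sq_sqrt (by positivity)
  have hroot : √(1 + (T / (Q + 49 / 100)) ^ 2) = X / (Q + 49 / 100) := by
    rw [Real.sqrt_eq_iff_mul_self_eq (by positivity) (by positivity)]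
    rw [div_mul_div_comm, ← pow_two, ← pow_two, hX2, div_pow, hT2]
    field_simp
    ring
  have hexp : Real.exp (Real.log (1 + 99 / 50 / Q) / 2) = X / Q := by
    rw [← Real.log_sqrt (by positivity), Real.exp_log (Real.sqrt_pos.2 (by positivity)),
      Real.sqrt_eq_iff_mul_self_eq (by positivity) (by positivity)]
    rw [div_mul_div_comm, ← pow_two, hX2]
    field_simp
  have hXle : 501 / 100 * X ≤ 749 / 100 * Q + 19401 / 10000 := by
    refine abs_le_of_sq_le_sq' ?_ (by positivity) |>.2
    rw [mul_pow, hX2]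
    nlinarith [sq_nonneg (Q - 1 / 3)]
  rw [Real.cos_arctan, Real.sin_arctan, hroot, hypPart, Real.cosh_eq, Real.sinh_eq, Real.exp_neg,
    hexp]
  have key : (Q - 4) * (1 - 1 / (X / (Q + 49 / 100))) + 4 * T * (T / (Q + 49 / 100) /
      (X / (Q + 49 / 100))) + ((Q - 101 / 100) * ((X / Q + (X / Q)⁻¹) / 2 - 1) +
      49 / 25 * ((X / Q - (X / Q)⁻¹) / 2)) - 101 / 50 =
      (749 / 100 * Q + 19401 / 10000 - 501 / 100 * X) / X := by
    have hne : Q + 49 / 100 ≠ 0 := by positivity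
    field_simp
    ring_nf
    have e1 : T ^ 2 = Q - 2401 / 10000 := hT2
    have e2 : X ^ 2 = Q ^ 2 + Q * (99 / 50) := by rw [hX2]; ring
    simp only [e1, e2]
    ring
  have := div_nonneg (sub_nonneg.2 hXle) hX0.le
  linarith

/-- The angle π/2 combined with the exponent 2r of n = 2. Since e^{2r} = 1 + 1.98/Q, the inequality
is polynomial in T. -/
lemma add_hypPart_two_ge {T Q : ℝ} (hT : 0 ≤ T) (hT2 : T ≤ 97 / 50)
    (hQ : Q = T ^ 2 + 2401 / 10000) :
    101 / 50 ≤ Q - 4 + 4 * T + hypPart Q (Real.log (1 + 99 / 50 / Q)) := by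
  have hQ0 : 0 < Q := by rw [hQ]; positivity
  rw [hypPart, Real.cosh_eq, Real.sinh_eq, Real.exp_neg, Real.exp_log (by positivity)]
  have key : Q - 4 + 4 * T + ((Q - 101 / 100) * ((1 + 99 / 50 / Q + (1 + 99 / 50 / Q)⁻¹) / 2 - 1) +
      49 / 25 * ((1 + 99 / 50 / Q - (1 + 99 / 50 / Q)⁻¹) / 2)) - 101 / 50 =
      (2 * (Q - 4 + 4 * T - 101 / 50) * Q * (Q + 99 / 50) + (Q - 101 / 100) * (9801 / 2500) +
        4851 / 1250 * (2 * Q + 99 / 50)) / (2 * Q * (Q + 99 / 50)) := by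
    have : Q + 99 / 50 ≠ 0 := by positivity
    have e : 1 + 99 / 50 / Q = (Q + 99 / 50) / Q := by field_simp
    rw [e]
    field_simp
    ring
  have : 0 ≤ 2 * (Q - 4 + 4 * T - 101 / 50) * Q * (Q + 99 / 50) +
      (Q - 101 / 100) * (9801 / 2500) + 4851 / 1250 * (2 * Q + 99 / 50) := by
    subst hQ
    rcases le_total T 1 with h | h
    · have H := bernstein_nonneg hT h
      linarith [H 0 6, H 1 5, H 2 4, H 3 3, H 4 2, H 5 1, H 6 0]
    · have H := bernstein_nonneg h hT2
      linarith [H 0 6, H 1 5, H 2 4, H 3 3, H 4 2, H 5 1, H 6 0]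
  have h2 := div_nonneg this (show 0 ≤ 2 * Q * (Q + 99 / 50) by positivity)
  linarith

/-- The pairs (k, a) are the slopes used in the seven ranges of T in `boundary_ge`, each with a
lower bound a for Q in that range. -/
lemma slope_le {Q k : ℝ} (a : ℝ) (ha : a ≤ Q)
    (hk : (k = 745 / 1000 ∧ a = 2401 / 10000) ∨ (k = 82 / 100 ∧ a = 49 / 100) ∨
      (k = 88 / 100 ∧ a = 101 / 100) ∨ (k = 915 / 1000 ∧ a = 193 / 100) ∨
      (k = 94 / 100 ∧ a = 4) ∨ (k = 96 / 100 ∧ a = 9) ∨ (k = 975 / 1000 ∧ a = 25)) :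
    k * (6 * Q ^ 2 + 297 / 25 * Q + 9801 / 2500) *
      ((Q + 49 / 100) ^ 2 - 6 / 25 * (Q - 2401 / 10000)) ≤
      297 / 100 * (2 * Q + 99 / 50) * (Q + 49 / 100) ^ 3 := by
  obtain ⟨s, rfl⟩ : ∃ s, Q = a + s := ⟨Q - a, by ring⟩
  have hs : 0 ≤ s := by linarith
  have h2 := pow_nonneg hs 2
  have h3 := pow_nonneg hs 3
  have h4 := pow_nonneg hs 4
  rcases hk with ⟨rfl, rfl⟩ | ⟨rfl, rfl⟩ | ⟨rfl, rfl⟩ | ⟨rfl, rfl⟩ | ⟨rfl, rfl⟩ | ⟨rfl, rfl⟩ |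
    ⟨rfl, rfl⟩ <;> linarith

/-- Up to angle π/2, compare with n = 1, or at the endpoint π/2 with the exponent of n = 2. Beyond
π/2, the growth forced by the rotation dominates, with a slope adapted to the range of T. -/
lemma boundary_ge {T Q : ℝ} (hT : 0 ≤ T) (hQ : Q = T ^ 2 + 2401 / 10000) {n : ℕ} (hn : 1 ≤ n) :
    101 / 50 ≤ (Q - 4) * (1 - Real.cos (n * Real.arctan (T / (Q + 49 / 100)))) +
      4 * T * Real.sin (n * Real.arctan (T / (Q + 49 / 100))) +
      hypPart Q (n * (Real.log (1 + 99 / 50 / Q) / 2)) := by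
  have hQ0 : 6 / 25 ≤ Q := by rw [hQ]; nlinarith
  have h1 := boundary_ge_one hQ
  set θ := Real.arctan (T / (Q + 49 / 100)) with hθ
  set r := Real.log (1 + 99 / 50 / Q) / 2 with hr
  have hθ0 : 0 ≤ θ := Real.arctan_nonneg.2 (by positivity)
  have hr0 : 0 ≤ r := by
    have := Real.log_nonneg (show (1 : ℝ) ≤ 1 + 99 / 50 / Q by
      have : 0 ≤ 99 / 50 / Q := by positivity
      linarith)
    positivity
  rcases hn.eq_or_lt with rfl | hn2
  · simpa using h1
  have hn2' : (2 : ℝ) ≤ n := by exact_mod_cast hn2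
  have hθn : θ ≤ n * θ := by nlinarith
  have hrn : r ≤ n * r := by nlinarith
  have hpi := Real.pi_pos
  rcases le_total (n * θ) (Real.pi / 2) with h | h
  · have hh1 := hypPart_mono hQ0 hr0 hrn
    rcases le_total (Q - 4) 0 with hA | hA
    · have hh2 := hypPart_mono hQ0 (by linarith : 0 ≤ 2 * r) (by nlinarith : 2 * r ≤ n * r)
      have hh3 := add_hypPart_two_ge hT (by nlinarith) hQ
      rw [show Real.log (1 + 99 / 50 / Q) = 2 * r by rw [hr]; ring] at hh3
      have hg := trigPart_ge_min hA (by linarith : 0 ≤ 4 * T) hθ0 hθn h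
      rcases min_le_iff.1 hg with hg | hg <;> linarith
    · have hc : Real.cos (n * θ) ≤ Real.cos θ :=
        Real.cos_le_cos_of_nonneg_of_le_pi hθ0 (by linarith) hθn
      have hs : Real.sin θ ≤ Real.sin (n * θ) :=
        Real.sin_le_sin_of_le_of_le_pi_div_two (by linarith) h hθn
      nlinarith
  · have hT0 : 0 < T := by
      rcases hT.eq_or_lt with rfl | hT
      · rw [hθ] at h
        simp at h
        linarith
      · exact hT
    have hk : ∀ k : ℝ, 0 ≤ k → k * (6 * Q ^ 2 + 297 / 25 * Q + 9801 / 2500) *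
      ((Q + 49 / 100) ^ 2 - 6 / 25 * (Q - 2401 / 10000)) ≤
      297 / 100 * (2 * Q + 99 / 50) * (Q + 49 / 100) ^ 3 → k * (n * θ) ≤ T * (n * r) := by
      intro k hk0 hk
      have := log_mul_ge_arctan_mul hT hQ hk0 hk
      rw [← hθ, ← hr] at this
      nlinarith
    rcases le_total T (1 / 2) with c1 | c1
    · exact boundary_ge_of_le_half hT0 hQ hT c1 h (hk _ (by norm_num)
        (slope_le (2401 / 10000) (by rw [hQ]; nlinarith) (by norm_num)))
    rcases le_total Q (101 / 100) with c2 | c2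
    · exact boundary_ge_of_half_le hT0 hQ c1 (by nlinarith) c2 h (hk _ (by norm_num)
        (slope_le (49 / 100) (by rw [hQ]; nlinarith) (by norm_num)))
    rcases le_total T (13 / 10) with c3 | c3
    · exact boundary_ge_of_mid_low hT0 hQ (by nlinarith) c3 c2 h (hk _ (by norm_num)
        (slope_le (101 / 100) c2 (by norm_num)))
    rcases le_total (Q - 4) 0 with c4 | c4
    · exact boundary_ge_of_mid_high hT0 hQ c3 (by nlinarith) c4 h (hk _ (by norm_num)
        (slope_le (193 / 100) (by rw [hQ]; nlinarith) (by norm_num)))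
    rcases le_total T 3 with c5 | c5
    · exact boundary_ge_of_two_le hT0 hQ (by nlinarith) c5 c4 h (hk _ (by norm_num)
        (slope_le 4 (by linarith) (by norm_num)))
    rcases le_total T 5 with c6 | c6
    · exact boundary_ge_of_three_le hT0 hQ c5 c6 h (hk _ (by norm_num)
        (slope_le 9 (by rw [hQ]; nlinarith) (by norm_num)))
    · exact boundary_ge_of_five_le hT0 hQ c6 h (hk _ (by norm_num)
        (slope_le 25 (by rw [hQ]; nlinarith) (by norm_num)))

/-! ### The disc criterion for complex parameters p -/

/-- The quantity `E_n(p) = 1 + p + ⋯ + p^{n-1} + 2 (p^n + 1)`, whose size relative to `|p|^n + 1`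
decides whether the `n`-th iterate of `v ↦ p v / (1 + v)` preserves the disc `|v - 2| ≤ √5`. -/
noncomputable def discSum (n : ℕ) (p : ℂ) : ℂ := ∑ i ∈ Finset.range n, p ^ i + 2 * (p ^ n + 1)

/-- The quantitative condition under which `v ↦ p^n / (1 + ⋯ + p^{n-1} + v)` contracts the disc
`|v - 2| ≤ √5`. -/
def DiscGood (n : ℕ) (p : ℂ) : Prop := 501 / 100 * (‖p‖ ^ n + 1) ^ 2 ≤ ‖discSum n p‖ ^ 2

lemma discSum_conj (n : ℕ) (p : ℂ) :
    discSum n ((starRingEnd ℂ) p) = (starRingEnd ℂ) (discSum n p) := by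
  simp only [discSum, map_add, map_sum, map_pow, map_mul, map_one, map_ofNat]

lemma DiscGood.of_conj {n : ℕ} {p : ℂ} (h : DiscGood n ((starRingEnd ℂ) p)) : DiscGood n p := by
  rw [DiscGood, discSum_conj, Complex.norm_conj, Complex.norm_conj] at h
  exact h

lemma discSum_eq {n : ℕ} {p : ℂ} (hp : p ≠ 1) :
    discSum n p = (p - 1)⁻¹ * (p ^ n - 1) + 2 * (p ^ n + 1) := by
  rw [discSum, geom_sum_eq hp]
  ring

lemma discSum_one (n : ℕ) : discSum n 1 = n + 4 := by
  simp [discSum]; norm_num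

lemma discGood_one {n : ℕ} (hn : 1 ≤ n) : DiscGood n 1 := by
  rw [DiscGood, discSum_one]
  have : ‖((n : ℂ) + 4)‖ = n + 4 := by
    rw [show ((n : ℂ) + 4) = ((n + 4 : ℝ) : ℂ) by push_cast; ring, Complex.norm_real]
    exact abs_of_nonneg (by positivity)
  rw [this, norm_one, one_pow]
  have : (1 : ℝ) ≤ n := by exact_mod_cast hn
  nlinarith

/-- With q = (p-1)⁻¹ one has E_n = q(p^n-1) + 2(p^n+1) and Q = |q|². Expanding |E_n|², whose cross
term brings in 4 Re q = 49/25, and dividing the criterion by 2e^y turns it into `h`. -/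
lemma discGood_of_polar {n : ℕ} {p : ℂ} {T Q : ℝ} (hQ : Q = T ^ 2 + 2401 / 10000) (hp : p ≠ 1)
    (hq : (p - 1)⁻¹ = 49 / 100 + T * Complex.I) {y α : ℝ}
    (hz : p ^ n = Complex.exp (y - α * Complex.I))
    (h : 101 / 50 ≤ (Q - 4) * (1 - Real.cos α) + 4 * T * Real.sin α + hypPart Q y) :
    DiscGood n p := by
  have hre : (p ^ n).re = Real.exp y * Real.cos α := by
    rw [hz, Complex.exp_re]; simp
  have him : (p ^ n).im = -(Real.exp y * Real.sin α) := by
    rw [hz, Complex.exp_im]; simp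
  have hn : ‖p‖ ^ n = Real.exp y := by
    rw [← norm_pow, hz, Complex.norm_exp]; simp
  have hE : ‖discSum n p‖ ^ 2 = Q * ((Real.exp y * Real.cos α - 1) ^ 2 +
      (Real.exp y * Real.sin α) ^ 2) + 4 * ((Real.exp y * Real.cos α + 1) ^ 2 +
      (Real.exp y * Real.sin α) ^ 2) + 49 / 25 * ((Real.exp y * Real.cos α) ^ 2 +
      (Real.exp y * Real.sin α) ^ 2 - 1) + 8 * T * (Real.exp y * Real.sin α) := by
    rw [discSum_eq hp, hq, ← Complex.normSq_eq_norm_sq, Complex.normSq_apply]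
    simp only [Complex.add_re, Complex.mul_re, Complex.add_im, Complex.mul_im, Complex.sub_re,
      Complex.sub_im, hre, him, Complex.ofReal_re, Complex.ofReal_im, Complex.I_re, Complex.I_im,
      Complex.one_re, Complex.one_im, Complex.re_ofNat, Complex.im_ofNat]
    have e1 : (49 / 100 : ℂ).re = 49 / 100 := by norm_num
    have e2 : (49 / 100 : ℂ).im = 0 := by norm_num
    rw [e1, e2, hQ]
    ring
  rw [DiscGood, hE, hn]
  have hexp := Real.exp_pos y
  have hch : 2 * Real.exp y * Real.cosh y = Real.exp y ^ 2 + 1 := by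
    rw [Real.cosh_eq, Real.exp_neg]; field_simp
  have hsh : 2 * Real.exp y * Real.sinh y = Real.exp y ^ 2 - 1 := by
    rw [Real.sinh_eq, Real.exp_neg]; field_simp
  have hsc := Real.sin_sq_add_cos_sq α
  rw [hypPart] at h
  have := mul_le_mul_of_nonneg_left h (by positivity : 0 ≤ 2 * Real.exp y)
  have e : (Real.exp y * Real.cos α) ^ 2 + (Real.exp y * Real.sin α) ^ 2 = Real.exp y ^ 2 := by
    rw [mul_pow, mul_pow, ← mul_add, add_comm, hsc, mul_one]
  have k : 2 * Real.exp y * ((Q - 4) * (1 - Real.cos α) + 4 * T * Real.sin α +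
      ((Q - 101 / 100) * (Real.cosh y - 1) + 49 / 25 * Real.sinh y)) =
      (Q - 101 / 100) * (2 * Real.exp y * Real.cosh y) + 49 / 25 * (2 * Real.exp y * Real.sinh y) +
      2 * Real.exp y * ((Q - 4) * (1 - Real.cos α) + 4 * T * Real.sin α - (Q - 101 / 100)) := by
    ring
  rw [k, hch, hsh] at this
  have g : Q * ((Real.exp y * Real.cos α - 1) ^ 2 + (Real.exp y * Real.sin α) ^ 2) +
      4 * ((Real.exp y * Real.cos α + 1) ^ 2 + (Real.exp y * Real.sin α) ^ 2) +
      49 / 25 * ((Real.exp y * Real.cos α) ^ 2 + (Real.exp y * Real.sin α) ^ 2 - 1) +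
      8 * T * (Real.exp y * Real.sin α) =
      (Q + 4 + 49 / 25) * ((Real.exp y * Real.cos α) ^ 2 + (Real.exp y * Real.sin α) ^ 2) +
      Q + 4 - 49 / 25 +
      Real.exp y * ((8 - 2 * Q) * Real.cos α + 8 * T * Real.sin α) := by ring
  rw [g, e]
  linarith

lemma discGood_of_inv_re_eq_of_nonneg {n : ℕ} (hn : 1 ≤ n) {p : ℂ} (hp : p ≠ 1) {T : ℝ}
    (hT : 0 ≤ T) (hq : (p - 1)⁻¹ = 49 / 100 + T * Complex.I) : DiscGood n p := by
  obtain ⟨Q, hQ⟩ : ∃ Q, Q = T ^ 2 + 2401 / 10000 := ⟨_, rfl⟩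
  have hQ0 : 0 < Q := by rw [hQ]; positivity
  refine discGood_of_polar hQ hp hq (y := n * (Real.log (1 + 99 / 50 / Q) / 2))
    (α := n * Real.arctan (T / (Q + 49 / 100))) ?_ (boundary_ge hT hQ hn)
  have hp' : p = ((Q + 49 / 100) - T * Complex.I) / Q := by
    have h1 : p - 1 = (49 / 100 + T * Complex.I)⁻¹ := by rw [← hq, inv_inv]
    have hne : (49 / 100 + T * Complex.I : ℂ) ≠ 0 := by
      rw [← hq]; exact inv_ne_zero (sub_ne_zero.2 hp)
    have hQc : (Q : ℂ) = (49 / 100 + T * Complex.I) * (49 / 100 - T * Complex.I) := by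
      rw [hQ]; push_cast; ring_nf; rw [Complex.I_sq]; ring
    have hQne : (Q : ℂ) ≠ 0 := by exact_mod_cast hQ0.ne'
    have : (49 / 100 + T * Complex.I : ℂ)⁻¹ = (49 / 100 - T * Complex.I) / Q := by
      rw [eq_div_iff hQne, hQc, inv_mul_cancel_left₀ hne]
    rw [this] at h1
    rw [eq_div_iff hQne]
    have h2 : p = 1 + (49 / 100 - T * Complex.I) / Q := by rw [← h1]; ring
    rw [h2]; field_simp; ring
  have hexp : p = Complex.exp (((Real.log (1 + 99 / 50 / Q) / 2 : ℝ) : ℂ) -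
      (Real.arctan (T / (Q + 49 / 100)) : ℝ) * Complex.I) := by
    have hT2 : T ^ 2 = Q - 2401 / 10000 := by rw [hQ]; ring
    set X := √(Q * (Q + 99 / 50)) with hX
    have hX0 : 0 < X := Real.sqrt_pos.2 (by positivity)
    have hX2 : X ^ 2 = Q * (Q + 99 / 50) := Real.sq_sqrt (by positivity)
    have hroot : √(1 + (T / (Q + 49 / 100)) ^ 2) = X / (Q + 49 / 100) := by
      rw [Real.sqrt_eq_iff_mul_self_eq (by positivity) (by positivity)]
      rw [div_mul_div_comm, ← pow_two, ← pow_two, hX2, div_pow, hT2]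
      field_simp
      ring
    have hexp : Real.exp (Real.log (1 + 99 / 50 / Q) / 2) = X / Q := by
      rw [← Real.log_sqrt (by positivity), Real.exp_log (Real.sqrt_pos.2 (by positivity)),
        Real.sqrt_eq_iff_mul_self_eq (by positivity) (by positivity)]
      rw [div_mul_div_comm, ← pow_two, hX2]
      field_simp
    have hne : Q + 49 / 100 ≠ 0 := by positivity
    rw [hp']
    apply Complex.ext
    · rw [Complex.exp_re]
      simp only [Complex.sub_re, Complex.sub_im, Complex.mul_re, Complex.mul_im, Complex.ofReal_re,
        Complex.ofReal_im, Complex.I_re, Complex.I_im, mul_zero, mul_one, sub_zero, zero_sub,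
        add_zero]
      rw [hexp, Real.cos_neg, Real.cos_arctan, hroot, Complex.div_ofReal_re]
      have : ((Q : ℂ) + 49 / 100 - T * Complex.I).re = Q + 49 / 100 := by simp
      rw [this]
      field_simp
    · rw [Complex.exp_im]
      simp only [Complex.sub_re, Complex.sub_im, Complex.mul_re, Complex.mul_im, Complex.ofReal_re,
        Complex.ofReal_im, Complex.I_re, Complex.I_im, mul_zero, mul_one, sub_zero, zero_sub,
        add_zero]
      rw [hexp, Real.sin_neg, Real.sin_arctan, hroot, Complex.div_ofReal_im]
      have : ((Q : ℂ) + 49 / 100 - T * Complex.I).im = -T := by simp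
      rw [this]
      field_simp
  rw [hexp, ← Complex.exp_nat_mul]
  congr 1
  push_cast
  ring

lemma discGood_of_inv_re_eq {n : ℕ} (hn : 1 ≤ n) {p : ℂ} (hp : p ≠ 1)
    (hq : ((p - 1)⁻¹).re = 49 / 100) : DiscGood n p := by
  have hdec : (p - 1)⁻¹ = 49 / 100 + (((p - 1)⁻¹).im : ℂ) * Complex.I := by
    conv_lhs => rw [← Complex.re_add_im (p - 1)⁻¹, hq]
    norm_num
  rcases le_total 0 ((p - 1)⁻¹).im with h | h
  · exact discGood_of_inv_re_eq_of_nonneg hn hp h hdec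
  · refine .of_conj (discGood_of_inv_re_eq_of_nonneg hn (T := -((p - 1)⁻¹).im) ?_ (by linarith) ?_)
    · intro h
      apply hp
      simpa using congrArg (starRingEnd ℂ) h
    · have := congrArg (starRingEnd ℂ) hdec
      simp only [map_inv₀, map_sub, map_one, map_add, map_mul, Complex.conj_ofReal,
        Complex.conj_I] at this
      rw [this]
      have e : (starRingEnd ℂ) (49 / 100 : ℂ) = 49 / 100 := by
        rw [map_div₀, map_ofNat, map_ofNat]
      rw [e]
      push_cast
      ring

/-- For p ≠ 1 the right side says Re (p-1)⁻¹ ≥ 49/100. The disc |p-2| ≤ 1 is the same with 1/2, so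
it lies inside this one and touches its boundary only at p = 1. -/
lemma mem_closedBall_iff_re {p : ℂ} :
    p ∈ Metric.closedBall (1 + 50 / 49 : ℂ) (50 / 49) ↔
      49 / 100 * ‖p - 1‖ ^ 2 ≤ (p - 1).re := by
  rw [mem_closedBall_iff_norm, show p - (1 + 50 / 49) = (p - 1) - 50 / 49 by ring]
  rw [← sq_le_sq₀ (norm_nonneg _) (by norm_num), ← Complex.normSq_eq_norm_sq,
    ← Complex.normSq_eq_norm_sq, Complex.normSq_apply, Complex.normSq_apply]
  have e1 : (50 / 49 : ℂ).re = 50 / 49 := by norm_num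
  have e2 : (50 / 49 : ℂ).im = 0 := by norm_num
  simp only [Complex.sub_re, Complex.sub_im, e1, e2]
  constructor <;> intro h <;> nlinarith

lemma inv_re_of_mem_sphere {p : ℂ} (h : p ∈ Metric.sphere (1 + 50 / 49 : ℂ) (50 / 49))
    (hp : p ≠ 1) : ((p - 1)⁻¹).re = 49 / 100 := by
  rw [mem_sphere_iff_norm, show p - (1 + 50 / 49) = (p - 1) - 50 / 49 by ring] at h
  have h2 := congrArg (· ^ 2) h
  simp only [← Complex.normSq_eq_norm_sq] at h2
  have e1 : (50 / 49 : ℂ).re = 50 / 49 := by norm_num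
  have e2 : (50 / 49 : ℂ).im = 0 := by norm_num
  have h0 : 0 < Complex.normSq (p - 1) := Complex.normSq_pos.2 (sub_ne_zero.2 hp)
  rw [Complex.inv_re, div_eq_iff h0.ne']
  rw [Complex.normSq_apply] at h2 ⊢
  simp only [Complex.sub_re (p - 1), Complex.sub_im (p - 1), e1, e2] at h2
  nlinarith

lemma one_le_norm_of_mem_closedBall {p : ℂ}
    (h : p ∈ Metric.closedBall (1 + 50 / 49 : ℂ) (50 / 49)) : 1 ≤ ‖p‖ := by
  rw [mem_closedBall_iff_re] at h
  have h1 : 0 ≤ (p - 1).re := le_trans (by positivity) h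
  have := Complex.re_le_norm p
  simp at h1
  linarith

/-- With q = (p-1)⁻¹, a zero would give (q+2)p^n = q-2. This is impossible since |p| ≥ 1 and Re q >
0 make the left side strictly larger in modulus. -/
lemma discSum_ne_zero {n : ℕ} {p : ℂ}
    (h : p ∈ Metric.closedBall (1 + 50 / 49 : ℂ) (50 / 49)) : discSum n p ≠ 0 := by
  by_cases hp : p = 1
  · rw [hp, discSum_one]
    exact_mod_cast (by positivity : ((n : ℝ) + 4) ≠ 0)
  · rw [discSum_eq hp]
    have h1 := one_le_norm_of_mem_closedBall h
    rw [mem_closedBall_iff_re] at h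
    have h0 : 0 < ‖p - 1‖ := norm_pos_iff.2 (sub_ne_zero.2 hp)
    have hre : 0 < ((p - 1)⁻¹).re := by
      rw [Complex.inv_re]
      refine div_pos (lt_of_lt_of_le (by positivity) h) (Complex.normSq_pos.2 (sub_ne_zero.2 hp))
    intro h2
    have h3 : ((p - 1)⁻¹ + 2) * p ^ n = (p - 1)⁻¹ - 2 := by linear_combination h2
    have h4 := congrArg (fun z => ‖z‖) h3
    simp only [norm_mul, norm_pow] at h4
    have h5 : ‖(p - 1)⁻¹ + 2‖ ≤ ‖(p - 1)⁻¹ - 2‖ := by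
      rw [← h4]
      exact le_mul_of_one_le_right (norm_nonneg _) (one_le_pow₀ h1)
    rw [← sq_le_sq₀ (norm_nonneg _) (norm_nonneg _), ← Complex.normSq_eq_norm_sq,
      ← Complex.normSq_eq_norm_sq, Complex.normSq_apply, Complex.normSq_apply] at h5
    simp at h5
    simp at hre
    nlinarith

/-- Maximum principle. As |p|^n + 1 is not the modulus of a holomorphic function, a unimodular ζ is
chosen with |p^n + ζ| = |p|^n + 1 at the given p. On the boundary |z^n + ζ| ≤ |z|^n + 1, so (z^n +
ζ)/E_n(z) is bounded there. -/
lemma discGood_of_mem_closedBall {n : ℕ} (hn : 1 ≤ n) {p : ℂ}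
    (h : p ∈ Metric.closedBall (1 + 50 / 49 : ℂ) (50 / 49)) : DiscGood n p := by
  have h1 := one_le_norm_of_mem_closedBall h
  have hp0 : p ≠ 0 := by
    rintro rfl
    simp at h1
    linarith
  have hpn : 0 < ‖p‖ ^ n := by positivity
  obtain ⟨ζ, hζ⟩ : ∃ ζ : ℂ, ζ = p ^ n / (‖p‖ ^ n : ℝ) := ⟨_, rfl⟩
  have hζ1 : ‖ζ‖ = 1 := by
    rw [hζ, norm_div, norm_pow, Complex.norm_real, Real.norm_of_nonneg hpn.le, div_self hpn.ne']
  have hsum : ‖p ^ n + ζ‖ = ‖p‖ ^ n + 1 := by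
    have hne : ((‖p‖ ^ n : ℝ) : ℂ) ≠ 0 := by exact_mod_cast hpn.ne'
    have : p ^ n + ζ = ((‖p‖ ^ n + 1 : ℝ) : ℂ) * ζ := by
      rw [hζ]; field_simp; push_cast; ring
    rw [this, norm_mul, hζ1, mul_one, Complex.norm_real, Real.norm_of_nonneg (by positivity)]
  have hmax : ‖(p ^ n + ζ) / discSum n p‖ ≤ (√(501 / 100))⁻¹ := by
    refine Complex.norm_le_of_forall_mem_frontier_norm_le
      (f := fun p => (p ^ n + ζ) / discSum n p)
      (U := Metric.ball (1 + 50 / 49 : ℂ) (50 / 49)) Metric.isBounded_ball ?_ ?_ ?_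
    · apply DifferentiableOn.diffContOnCl
      rw [closure_ball _ (by norm_num)]
      refine DifferentiableOn.div (by fun_prop) ?_ (fun x hx => discSum_ne_zero hx)
      unfold discSum
      fun_prop
    · intro z hz
      rw [frontier_ball _ (by norm_num)] at hz
      have hgood : DiscGood n z := by
        by_cases h : z = 1
        · exact h ▸ discGood_one hn
        · exact discGood_of_inv_re_eq hn h (inv_re_of_mem_sphere hz h)
      have hne := norm_pos_iff.2 (discSum_ne_zero (n := n) (Metric.sphere_subset_closedBall hz))
      rw [norm_div, div_le_iff₀ hne, inv_mul_eq_div, le_div_iff₀ (by positivity)]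
      have h3 : ‖z ^ n + ζ‖ ≤ ‖z‖ ^ n + 1 := by
        rw [← norm_pow, ← hζ1]; exact norm_add_le _ _
      refine (mul_le_mul_of_nonneg_right h3 (by positivity)).trans ?_
      refine abs_le_of_sq_le_sq' ?_ hne.le |>.2
      rw [mul_pow, Real.sq_sqrt (by norm_num)]
      rw [DiscGood] at hgood
      linarith
    · rw [closure_ball _ (by norm_num)]; exact h
  have hne := norm_pos_iff.2 (discSum_ne_zero (n := n) h)
  rw [norm_div, div_le_iff₀ hne, inv_mul_eq_div, le_div_iff₀ (by positivity), hsum] at hmax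
  have := pow_le_pow_left₀ (by positivity) hmax 2
  rw [mul_pow, Real.sq_sqrt (by norm_num)] at this
  rw [DiscGood]
  linarith

lemma norm_pow_sub_one_le {p : ℂ} {K : ℝ} (hK : 0 < K) (hp : ‖p - 1‖ ≤ 1 / (20 * K)) {i : ℕ}
    (hi : (i : ℝ) ≤ K) : ‖p ^ i - 1‖ ≤ 6 / 100 := by
  have h1 : ‖p ^ i - 1‖ ≤ (1 + ‖p - 1‖) ^ i - 1 := by
    induction i with
    | zero => simp
    | succ i ih =>
      have := ih (by push_cast at hi; linarith)
      have e : p ^ (i + 1) - 1 = (p ^ i - 1) * (1 + (p - 1)) + (p - 1) := by ring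
      rw [e]
      refine (norm_add_le _ _).trans ?_
      rw [norm_mul]
      have h3 : ‖1 + (p - 1)‖ ≤ 1 + ‖p - 1‖ := (norm_add_le _ _).trans (by simp)
      have := mul_le_mul this h3 (norm_nonneg _) ((norm_nonneg _).trans this)
      rw [pow_succ]
      linarith
  have h2 : (1 + ‖p - 1‖) ^ i ≤ Real.exp (1 / 20) := by
    calc (1 + ‖p - 1‖) ^ i ≤ (Real.exp ‖p - 1‖) ^ i :=
          pow_le_pow_left₀ (by positivity) (by linarith [Real.add_one_le_exp ‖p - 1‖]) i
      _ = Real.exp (i * ‖p - 1‖) := by rw [← Real.exp_nat_mul]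
      _ ≤ Real.exp (1 / 20) := by
          apply Real.exp_le_exp.2
          calc i * ‖p - 1‖ ≤ K * (1 / (20 * K)) := by gcongr
            _ = 1 / 20 := by field_simp
  have h3 : Real.exp (1 / 20) ≤ 106 / 100 := by
    have := Real.exp_bound' (x := 1 / 20) (by norm_num) (by norm_num) (n := 2) (by norm_num)
    refine this.trans ?_
    norm_num [Finset.sum_range_succ, Nat.factorial]
  linarith

/-- All powers p^i with i ≤ n lie within 0.06 of 1, so Re E_n ≥ 4.82, against √5.01 · 2.06. -/
lemma discGood_of_near_one {n : ℕ} (hn : 1 ≤ n) {p : ℂ} {K : ℝ} (hnK : (n : ℝ) ≤ K)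
    (hp : ‖p - 1‖ ≤ 1 / (20 * K)) : DiscGood n p := by
  have hn' : (1 : ℝ) ≤ n := by exact_mod_cast hn
  have hK : 0 < K := by linarith
  have hpow : ∀ i ≤ n, ‖p ^ i - 1‖ ≤ 6 / 100 := fun i hi =>
    norm_pow_sub_one_le hK hp (le_trans (by exact_mod_cast hi) hnK)
  have hre : ∀ i ≤ n, 94 / 100 ≤ (p ^ i).re := fun i hi => by
    have := (Complex.abs_re_le_norm (p ^ i - 1)).trans (hpow i hi)
    have := (abs_le.1 this).1
    simp at this
    linarith
  have h1 : ‖p‖ ^ n ≤ 106 / 100 := by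
    rw [← norm_pow]
    have := norm_add_le (p ^ n - 1) 1
    rw [sub_add_cancel, norm_one] at this
    linarith [hpow n le_rfl]
  have h2 : 482 / 100 ≤ ‖discSum n p‖ := by
    refine le_trans ?_ (Complex.re_le_norm _)
    rw [discSum, Complex.add_re, Complex.re_sum]
    have h3 : ∑ i ∈ Finset.range n, (94 / 100 : ℝ) ≤ ∑ i ∈ Finset.range n, (p ^ i).re :=
      Finset.sum_le_sum fun i hi => hre i (Finset.mem_range.1 hi).le
    have h4 := hre n le_rfl
    simp only [Finset.sum_const, Finset.card_range, nsmul_eq_mul] at h3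
    simp
    linarith
  rw [DiscGood]
  have h0 : 0 ≤ ‖p‖ ^ n := by positivity
  nlinarith

/-- The enlarged disc leaves the tangent disc only near p = 1, where the previous lemma applies.
With d = 1/(60000K²), the enlargement costs at most 3d in 2 Re(p-1) ≥ |p-1|², and |p-1| ≥ 1/(20K)
means |p-1|² ≥ 150d, so the loss is at most 0.02|p-1|². -/
lemma discGood_of_norm_sub_two_le {n : ℕ} (hn : 1 ≤ n) {p : ℂ} {K : ℝ} (hnK : (n : ℝ) ≤ K)
    (hp : ‖p - 2‖ ≤ 1 + 1 / (60000 * K ^ 2)) : DiscGood n p := by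
  have hn' : (1 : ℝ) ≤ n := by exact_mod_cast hn
  have hK : 1 ≤ K := by linarith
  rcases le_total ‖p - 1‖ (1 / (20 * K)) with h | h
  · exact discGood_of_near_one hn hnK h
  · refine discGood_of_mem_closedBall hn (mem_closedBall_iff_re.2 ?_)
    have h2 := pow_le_pow_left₀ (norm_nonneg _) hp 2
    have h3 := pow_le_pow_left₀ (by positivity) h 2
    obtain ⟨d, hd⟩ : ∃ d, d = 1 / (60000 * K ^ 2) := ⟨_, rfl⟩
    have hd0 : 0 < d := by rw [hd]; positivity
    have hd1 : d ≤ 1 := by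
      rw [hd, div_le_one (by positivity)]
      nlinarith
    have e : (1 / (20 * K)) ^ 2 = 150 * d := by rw [hd]; field_simp; norm_num
    rw [e] at h3
    rw [← hd] at h2
    have e2 : ‖p - 2‖ ^ 2 = ‖p - 1‖ ^ 2 - 2 * (p - 1).re + 1 := by
      rw [← Complex.normSq_eq_norm_sq, ← Complex.normSq_eq_norm_sq, Complex.normSq_apply,
        Complex.normSq_apply]
      simp
      ring
    rw [e2] at h2
    nlinarith

/-! ### Contraction of the iterated averages -/

/-- The `k`-th iterate of the operator `f ↦ (f ∘ B + f ∘ B ∘ S) / 2`, where `B x = (x + 1) / p` and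
`S x = 1 / x`. -/
noncomputable def iterAvg (p : ℂ) (f : ℂ → ℂ) : ℕ → ℂ → ℂ
  | 0, x => f x
  | k + 1, x => (iterAvg p f k ((x + 1) / p) + iterAvg p f k ((x⁻¹ + 1) / p)) / 2

/-- The `j`-th iterate of `a ↦ (a + 1) / p`. -/
noncomputable def shiftIter (p : ℂ) (j : ℕ) (a : ℂ) : ℂ :=
  (∑ i ∈ Finset.range j, p ^ i + a) / p ^ j

/-- `5 - |v - 2|²`, positive exactly on the open disc of radius `√5` about `2`. -/
noncomputable def discGap (v : ℂ) : ℝ := 5 - ‖v - 2‖ ^ 2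

/-- A pseudo-hyperbolic distance on the disc `|v - 2| < √5`. -/
noncomputable def discDist (a b : ℂ) : ℝ := ‖a - b‖ / √(discGap a * discGap b)

lemma iterAvg_zero (p : ℂ) (f : ℂ → ℂ) (x : ℂ) : iterAvg p f 0 x = f x := rfl

lemma iterAvg_succ (p : ℂ) (f : ℂ → ℂ) (k : ℕ) (x : ℂ) :
    iterAvg p f (k + 1) x =
      (iterAvg p f k ((x + 1) / p) + iterAvg p f k ((x⁻¹ + 1) / p)) / 2 := rfl

lemma shiftIter_succ {p : ℂ} (hp : p ≠ 0) (j : ℕ) (a : ℂ) :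
    (shiftIter p j a + 1) / p = shiftIter p (j + 1) a := by
  rw [shiftIter, shiftIter, Finset.sum_range_succ, pow_succ]
  field_simp
  ring

lemma shiftIter_one (p a : ℂ) : shiftIter p 1 a = (a + 1) / p := by
  simp [shiftIter, add_comm]

lemma discGap_le (v : ℂ) : discGap v ≤ 5 := by
  rw [discGap]
  linarith [sq_nonneg ‖v - 2‖]

lemma discGap_inv {X : ℂ} (hX : X ≠ 0) : discGap X⁻¹ = (‖X + 2‖ ^ 2 - 5) / ‖X‖ ^ 2 := by
  have h0 : ‖X‖ ≠ 0 := norm_ne_zero_iff.2 hX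
  have e : X⁻¹ - 2 = (1 - 2 * X) / X := by field_simp
  rw [discGap, e, norm_div, eq_div_iff (by positivity), div_pow, sub_mul,
    div_mul_cancel₀ _ (by positivity)]
  simp only [← Complex.normSq_eq_norm_sq, Complex.normSq_apply]
  simp
  ring

/-- The coefficient of `discGap v` on the left is the modulus of the derivative of v ↦ 1/X.
Inversion carries |v-2| < √5 to |X+2| > √5 (`discGap_inv`). As p^n(X+2) = E_n(p) + (v-2), the bound
on |E_n| keeps X there, and the surplus of 5.01 over 5 yields the factor 0.9995. -/
lemma shiftIter_gap {p v : ℂ} (hp : p ≠ 0) {n : ℕ} (hn : DiscGood n p) (hv : 0 < discGap v) :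
    shiftIter p n v ≠ 0 ∧ (‖p‖ ^ n)⁻¹ / ‖shiftIter p n v‖ ^ 2 * discGap v ≤
      9995 / 10000 * discGap (shiftIter p n v)⁻¹ := by
  obtain ⟨X, hX⟩ : ∃ X, X = shiftIter p n v := ⟨_, rfl⟩
  obtain ⟨y, hy⟩ : ∃ y, y = ‖p‖ ^ n := ⟨_, rfl⟩
  obtain ⟨r, hr⟩ : ∃ r, r = ‖v - 2‖ := ⟨_, rfl⟩
  obtain ⟨c, hc⟩ : ∃ c, c = √(5 : ℝ) := ⟨_, rfl⟩
  have hc0 : 0 < c := by rw [hc]; positivity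
  have hc2 : c ^ 2 = 5 := by rw [hc]; exact Real.sq_sqrt (by norm_num)
  have hr0 : 0 ≤ r := by rw [hr]; positivity
  have hy0 : 0 < y := by rw [hy]; positivity
  have hrc : r < c := by
    rw [discGap, ← hr] at hv
    nlinarith
  have hE : 10009 / 10000 * c * (y + 1) ≤ ‖discSum n p‖ := by
    refine abs_le_of_sq_le_sq' ?_ (norm_nonneg _) |>.2
    rw [DiscGood, ← hy] at hn
    rw [mul_pow, mul_pow, hc2]
    nlinarith [sq_nonneg (y + 1)]
  have hW : c * y + (c - r) + 9 / 10000 * c ≤ y * ‖X + 2‖ := by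
    have e : p ^ n * (X + 2) = discSum n p + (v - 2) := by
      rw [hX, shiftIter, discSum, mul_add, mul_div_cancel₀ _ (pow_ne_zero _ hp)]
      ring
    have h1 : y * ‖X + 2‖ = ‖discSum n p + (v - 2)‖ := by
      rw [← e, norm_mul, norm_pow, hy]
    have h2 := norm_sub_le (discSum n p + (v - 2)) (v - 2)
    rw [add_sub_cancel_right] at h2
    rw [h1]
    nlinarith
  have hmain : y * discGap v ≤ 9995 / 10000 * ((y * ‖X + 2‖) ^ 2 - 5 * y ^ 2) := by
    rw [discGap, ← hr]
    obtain ⟨s, rfl⟩ : ∃ s, r = c - s := ⟨c - r, by ring⟩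
    have hs0 : 0 < s := by linarith
    have hsc : s ≤ c := by linarith
    have hW' : c * y + (s + 9 / 10000 * c) ≤ y * ‖X + 2‖ := by linarith
    have h1 := pow_le_pow_left₀ (by positivity) hW' 2
    have h3 : 0 ≤ y * c * (c - s) := by
      have := sub_nonneg.2 hsc
      positivity
    have h4 : 0 ≤ y * s ^ 2 := by positivity
    nlinarith [sq_nonneg (s + 9 / 10000 * c)]
  have hX0 : X ≠ 0 := by
    rintro h
    rw [h, zero_add] at hmain
    have : 0 < y * discGap v := by positivity
    have h2 : ‖(2 : ℂ)‖ = 2 := by norm_num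
    rw [h2] at hmain
    nlinarith
  rw [← hX, ← hy]
  refine ⟨hX0, ?_⟩
  have hXn : 0 < ‖X‖ := norm_pos_iff.2 hX0
  rw [discGap_inv hX0]
  rw [show y⁻¹ / ‖X‖ ^ 2 * discGap v = (y * discGap v) / (y ^ 2 * ‖X‖ ^ 2) by field_simp,
    show 9995 / 10000 * ((‖X + 2‖ ^ 2 - 5) / ‖X‖ ^ 2) =
      (9995 / 10000 * ((y * ‖X + 2‖) ^ 2 - 5 * y ^ 2)) / (y ^ 2 * ‖X‖ ^ 2) by field_simp]
  gcongr

lemma discGap_inv_shiftIter_pos {p v : ℂ} (hp : p ≠ 0) {n : ℕ} (hn : DiscGood n p)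
    (hv : 0 < discGap v) : 0 < discGap (shiftIter p n v)⁻¹ := by
  obtain ⟨h0, h⟩ := shiftIter_gap hp hn hv
  have h1 : 0 < ‖p‖ := norm_pos_iff.2 hp
  have h2 : 0 < ‖shiftIter p n v‖ := norm_pos_iff.2 h0
  have : 0 < (‖p‖ ^ n)⁻¹ / ‖shiftIter p n v‖ ^ 2 * discGap v := by positivity
  linarith

lemma discDist_nonneg (a b : ℂ) : 0 ≤ discDist a b := by
  rw [discDist]; positivity

/-- For a Möbius map, the distance of two images is the original distance times the geometric mean
of the two derivative moduli, so the pointwise bounds of `shiftIter_gap` at a and b multiply. -/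
lemma discDist_inv_shiftIter_le {p a b : ℂ} (hp : p ≠ 0) {n : ℕ} (hn : DiscGood n p)
    (ha : 0 < discGap a) (hb : 0 < discGap b) :
    discDist (shiftIter p n a)⁻¹ (shiftIter p n b)⁻¹ ≤ 9995 / 10000 * discDist a b := by
  obtain ⟨ha0, ha'⟩ := shiftIter_gap hp hn ha
  obtain ⟨hb0, hb'⟩ := shiftIter_gap hp hn hb
  have hga := discGap_inv_shiftIter_pos hp hn ha
  have hgb := discGap_inv_shiftIter_pos hp hn hb
  have hsub : ‖(shiftIter p n a)⁻¹ - (shiftIter p n b)⁻¹‖ =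
      ‖a - b‖ * (‖p‖ ^ n)⁻¹ / (‖shiftIter p n a‖ * ‖shiftIter p n b‖) := by
    rw [inv_sub_inv ha0 hb0, norm_div, norm_mul]
    congr 1
    rw [shiftIter, shiftIter, ← sub_div, norm_div, norm_pow, div_eq_mul_inv, ← norm_neg (a - b)]
    congr 2
    ring
  have hP : 0 < (‖p‖ ^ n)⁻¹ := by
    have : 0 < ‖p‖ := norm_pos_iff.2 hp
    positivity
  rw [discDist, discDist, hsub]
  set A := shiftIter p n a
  set B := shiftIter p n b
  set P := (‖p‖ ^ n)⁻¹
  have hA : 0 < ‖A‖ := norm_pos_iff.2 ha0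
  have hB : 0 < ‖B‖ := norm_pos_iff.2 hb0
  have h1 := mul_le_mul ha' hb' (by positivity) (by positivity)
  rw [← mul_div_assoc, div_le_div_iff₀ (by positivity) (by positivity)]
  have h2 : P / (‖A‖ * ‖B‖) * √(discGap a * discGap b) ≤
      9995 / 10000 * √(discGap A⁻¹ * discGap B⁻¹) := by
    refine abs_le_of_sq_le_sq' ?_ (by positivity) |>.2
    rw [mul_pow, mul_pow, Real.sq_sqrt (by positivity), Real.sq_sqrt (by positivity)]
    calc (P / (‖A‖ * ‖B‖)) ^ 2 * (discGap a * discGap b)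
        = P / ‖A‖ ^ 2 * discGap a * (P / ‖B‖ ^ 2 * discGap b) := by field_simp
      _ ≤ _ := h1.trans_eq (by ring)
  calc ‖a - b‖ * P / (‖A‖ * ‖B‖) * √(discGap a * discGap b)
      = ‖a - b‖ * (P / (‖A‖ * ‖B‖) * √(discGap a * discGap b)) := by ring
    _ ≤ ‖a - b‖ * (9995 / 10000 * √(discGap A⁻¹ * discGap B⁻¹)) := by gcongr
    _ = _ := by ring

/-- A point is recorded as j shifts of a base point. The shift branch only raises j and keeps the
distance; the inverting branch resets j to 1 and contracts by 0.9995. The mean factor is (1 +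
0.9995)/2 = 19995/20000, and j + k bounds the run lengths that can occur. -/
lemma norm_iterAvg_sub_le {p : ℂ} (hp : p ≠ 0) {f : ℂ → ℂ} {C : ℝ} (hC : 0 ≤ C)
    (hf : ∀ u v, 0 < discGap u → 0 < discGap v → ‖f u⁻¹ - f v⁻¹‖ ≤ C * discDist u v) (k : ℕ) :
    ∀ (j : ℕ) (a b : ℂ), 1 ≤ j → (∀ i, 1 ≤ i → i ≤ j + k → DiscGood i p) → 0 < discGap a →
      0 < discGap b → ‖iterAvg p f k (shiftIter p j a) - iterAvg p f k (shiftIter p j b)‖ ≤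
        C * (19995 / 20000) ^ k * discDist a b := by
  induction k with
  | zero =>
    intro j a b hj hgood ha hb
    have hg := hgood j hj (by omega)
    have h := hf _ _ (discGap_inv_shiftIter_pos hp hg ha) (discGap_inv_shiftIter_pos hp hg hb)
    rw [inv_inv, inv_inv] at h
    rw [iterAvg_zero, iterAvg_zero, pow_zero, mul_one]
    refine h.trans (mul_le_mul_of_nonneg_left ?_ hC)
    refine (discDist_inv_shiftIter_le hp hg ha hb).trans ?_
    linarith [discDist_nonneg a b]
  | succ k ih =>
    intro j a b hj hgood ha hb
    have hg := hgood j hj (by omega)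
    simp only [iterAvg_succ, shiftIter_succ hp, ← shiftIter_one]
    have h1 := ih (j + 1) a b (by omega) (fun i hi hi' => hgood i hi (by omega)) ha hb
    have h2 := ih 1 (shiftIter p j a)⁻¹ (shiftIter p j b)⁻¹ le_rfl
      (fun i hi hi' => hgood i hi (by omega)) (discGap_inv_shiftIter_pos hp hg ha)
      (discGap_inv_shiftIter_pos hp hg hb)
    have h3 : C * (19995 / 20000) ^ k *
        discDist (shiftIter p j a)⁻¹ (shiftIter p j b)⁻¹ ≤ C * (19995 / 20000) ^ k *
        (9995 / 10000 * discDist a b) :=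
      mul_le_mul_of_nonneg_left (discDist_inv_shiftIter_le hp hg ha hb) (by positivity)
    rw [← sub_div, norm_div, Complex.norm_ofNat, add_sub_add_comm]
    have h4 := norm_add_le
      (iterAvg p f k (shiftIter p (j + 1) a) - iterAvg p f k (shiftIter p (j + 1) b))
      (iterAvg p f k (shiftIter p 1 (shiftIter p j a)⁻¹) -
        iterAvg p f k (shiftIter p 1 (shiftIter p j b)⁻¹))
    rw [div_le_iff₀ (by norm_num), pow_succ]
    linarith

lemma differentiableAt_iterAvg {f : ℂ → ℂ → ℂ} {p : ℂ} (hp : p ≠ 0)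
    (hf : ∀ x : ℂ → ℂ, DifferentiableAt ℂ x p → x p ≠ 0 →
      DifferentiableAt ℂ (fun s => f s (x s)) p) (k : ℕ) :
    ∀ (j : ℕ) (a : ℂ → ℂ), 1 ≤ j → (∀ i, 1 ≤ i → i ≤ j + k → DiscGood i p) →
      DifferentiableAt ℂ a p → 0 < discGap (a p) →
      DifferentiableAt ℂ (fun s => iterAvg s (f s) k (shiftIter s j (a s))) p := by
  have hshift : ∀ (j : ℕ) (a : ℂ → ℂ), DifferentiableAt ℂ a p →
      DifferentiableAt ℂ (fun s => shiftIter s j (a s)) p := by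
    intro j a ha
    unfold shiftIter
    exact DifferentiableAt.div (by fun_prop) (by fun_prop) (pow_ne_zero _ hp)
  induction k with
  | zero =>
    intro j a hj hgood ha hap
    exact hf _ (hshift j a ha) (shiftIter_gap hp (hgood j hj (by omega)) hap).1
  | succ k ih =>
    intro j a hj hgood ha hap
    have hg := hgood j hj (by omega)
    have h1 := ih (j + 1) a (by omega) (fun i hi hi' => hgood i hi (by omega)) ha hap
    have h2 := ih 1 (fun s => (shiftIter s j (a s))⁻¹) le_rfl
      (fun i hi hi' => hgood i hi (by omega))
      ((hshift j a ha).inv (shiftIter_gap hp hg hap).1) (discGap_inv_shiftIter_pos hp hg hap)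
    refine ((h1.add h2).div_const 2).congr_of_eventuallyEq ?_
    filter_upwards [isOpen_ne.mem_nhds hp] with s hs
    simp only [iterAvg_succ, shiftIter_succ hs, ← shiftIter_one, Pi.add_apply]

/-! ### Rapid decay of Taylor coefficients -/

/-- From e^{x/2} ≤ 1 + x and a single term of the exponential series. The loss is only x^{-M}: for x
of order k^{-2} it is polynomial in k and is absorbed by t^k. -/
lemma inv_one_add_pow_le {x : ℝ} (hx0 : 0 < x) (hx1 : x ≤ 1) (n M : ℕ) :
    1 / (1 + x) ^ n ≤ 2 * 2 ^ M * M ! / x ^ M / ((n : ℝ) + 1) ^ M := by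
  have h1 : Real.exp (x / 2) ≤ 1 + x := by
    have h := Real.exp_bound' (x := x / 2) (by positivity) (by linarith) (n := 2) (by norm_num)
    refine h.trans ?_
    norm_num [Finset.sum_range_succ, Nat.factorial]
    nlinarith
  have h2 : (x * (n + 1) / 2) ^ M / M ! ≤ 2 * (1 + x) ^ n := by
    calc (x * (n + 1) / 2) ^ M / M ! ≤ Real.exp (x * (n + 1) / 2) :=
          Real.pow_div_factorial_le_exp _ (by positivity) _
      _ = Real.exp (x / 2) ^ (n + 1) := by
          rw [← Real.exp_nat_mul]; congr 1; push_cast; ring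
      _ ≤ (1 + x) ^ (n + 1) := by gcongr
      _ ≤ 2 * (1 + x) ^ n := by
          rw [pow_succ, mul_comm]
          gcongr
          linarith
  rw [div_div, div_le_div_iff₀ (by positivity) (by positivity)]
  rw [div_le_iff₀ (by positivity), div_pow, mul_pow, div_le_iff₀ (by positivity)] at h2
  linarith

lemma summable_geometric_mul_pow {t : ℝ} (ht0 : 0 < t) (ht1 : t < 1) (m : ℕ) :
    Summable fun k : ℕ => t ^ k * ((k : ℝ) + 3) ^ m := by
  have h := summable_pow_mul_geometric_of_norm_lt_one m
    (show ‖t‖ < 1 by rwa [Real.norm_of_nonneg ht0.le])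
  have h2 := ((summable_nat_add_iff 3).2 h).mul_left (t ^ 3)⁻¹
  refine h2.congr fun k => ?_
  push_cast
  rw [pow_add]
  field_simp

/-- Cauchy's estimate bounds the n-th coefficient of g_k by a constant times t^k (k+3)^{2M}
(n+1)^{-M}, which is summable in k for every M. The closed unit disc lies in all the domains, so the
double series may be rearranged there. -/
lemma exists_rapidly_decreasing_coeff {g : ℕ → ℂ → ℂ} {C c t : ℝ} (hC : 0 ≤ C) (hc : 0 < c)
    (hc1 : c ≤ 1) (ht0 : 0 < t) (ht1 : t < 1)
    (hd : ∀ k : ℕ, DifferentiableOn ℂ (g k) (Metric.ball 0 (1 + c / ((k : ℝ) + 2) ^ 2)))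
    (hb : ∀ k : ℕ, ∀ w ∈ Metric.ball (0 : ℂ) (1 + c / ((k : ℝ) + 2) ^ 2), ‖g k w‖ ≤ C * t ^ k) :
    ∃ h : ℕ → ℂ, (∀ M : ℕ, ∃ A : ℝ, ∀ n : ℕ, ‖h n‖ ≤ A / ((n : ℝ) + 1) ^ M) ∧
      ∀ w : ℂ, ‖w‖ ≤ 1 → HasSum (fun n => h n * w ^ n) (∑' k, g k w) := by
  obtain ⟨d, hdd⟩ : ∃ d : ℕ → ℕ → ℂ, d = fun k n => (n ! : ℂ)⁻¹ * iteratedDeriv n (g k) 0 :=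
    ⟨_, rfl⟩
  -- Replacing k+2 by k+3 gives closed discs inside the open discs of holomorphy, as Cauchy's
  -- estimate requires.
  have hx : ∀ k : ℕ, 0 < c / ((k : ℝ) + 3) ^ 2 := fun k => by positivity
  have hlt : ∀ k : ℕ, 1 + c / ((k : ℝ) + 3) ^ 2 < 1 + c / ((k : ℝ) + 2) ^ 2 := fun k => by
    have hk : (0 : ℝ) ≤ k := by positivity
    have : c / ((k : ℝ) + 3) ^ 2 < c / ((k : ℝ) + 2) ^ 2 := by
      apply div_lt_div_of_pos_left hc (by positivity)
      nlinarith
    linarith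
  have hdb : ∀ k n, ‖d k n‖ ≤ C * t ^ k * (1 / (1 + c / ((k : ℝ) + 3) ^ 2) ^ n) := by
    intro k n
    have hsub : Metric.closedBall (0 : ℂ) (1 + c / ((k : ℝ) + 3) ^ 2) ⊆
        Metric.ball 0 (1 + c / ((k : ℝ) + 2) ^ 2) :=
      Metric.closedBall_subset_ball (hlt k)
    have h1 := Complex.norm_iteratedDeriv_le_of_forall_mem_sphere_norm_le (f := g k) (c := 0)
      (R := 1 + c / ((k : ℝ) + 3) ^ 2) (C := C * t ^ k) n (by positivity)
      (DifferentiableOn.diffContOnCl (by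
        rw [closure_ball _ (by positivity)]; exact (hd k).mono hsub)) (fun z hz => hb k z (hsub
          (Metric.sphere_subset_closedBall hz)))
    have hf : (0 : ℝ) < n ! := by positivity
    rw [hdd]
    simp only [norm_mul, norm_inv, Complex.norm_natCast]
    rw [inv_mul_le_iff₀ hf]
    refine h1.trans_eq ?_
    ring
  have hv : ∀ M : ℕ, ∃ v : ℕ → ℝ, Summable v ∧ (∀ k, 0 ≤ v k) ∧
      ∀ k n, ‖d k n‖ ≤ v k * (1 / ((n : ℝ) + 1) ^ M) := by
    intro M
    refine ⟨fun k => C * (2 * 2 ^ M * M ! / c ^ M) * (t ^ k * ((k : ℝ) + 3) ^ (2 * M)),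
      (summable_geometric_mul_pow ht0 ht1 (2 * M)).mul_left _, fun k => by positivity, ?_⟩
    intro k n
    refine (hdb k n).trans ?_
    have hx1 : c / ((k : ℝ) + 3) ^ 2 ≤ 1 := by
      rw [div_le_one (by positivity)]
      have hk : (0 : ℝ) ≤ k := by positivity
      nlinarith
    have := mul_le_mul_of_nonneg_left (inv_one_add_pow_le (hx k) hx1 n M)
      (by positivity : 0 ≤ C * t ^ k)
    refine this.trans_eq ?_
    rw [div_pow, ← pow_mul]
    field_simp
  refine ⟨fun n => ∑' k, d k n, ?_, ?_⟩
  · intro M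
    obtain ⟨v, hv1, hv0, hv2⟩ := hv M
    refine ⟨∑' k, v k, fun n => ?_⟩
    refine (tsum_of_norm_bounded (hv1.mul_right _).hasSum fun k => hv2 k n).trans_eq ?_
    rw [tsum_mul_right]
    ring
  · intro w hw
    obtain ⟨v, hv1, hv0, hv2⟩ := hv 2
    have hs2 : Summable fun n : ℕ => 1 / ((n : ℝ) + 1) ^ 2 := by
      have := (summable_nat_add_iff 1).2 (Real.summable_one_div_nat_pow.2 (by norm_num : 1 < 2))
      simpa using this
    have hbd : ∀ k n, ‖d k n * w ^ n‖ ≤ v k * (1 / ((n : ℝ) + 1) ^ 2) := by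
      intro k n
      rw [norm_mul, norm_pow]
      exact (mul_le_of_le_one_right (norm_nonneg _) (pow_le_one₀ (norm_nonneg _) hw)).trans
        (hv2 k n)
    have hS : Summable fun x : ℕ × ℕ => d x.1 x.2 * w ^ x.2 :=
      Summable.of_norm_bounded (hv1.mul_of_nonneg hs2 (fun k => hv0 k) fun n => by positivity)
        fun x => hbd x.1 x.2
    have hg : ∀ k, HasSum (fun n => d k n * w ^ n) (g k w) := by
      intro k
      have hwb : w ∈ Metric.ball (0 : ℂ) (1 + c / ((k : ℝ) + 2) ^ 2) := by
        rw [mem_ball_zero_iff]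
        have : 0 < c / ((k : ℝ) + 2) ^ 2 := by positivity
        linarith
      have h := Complex.hasSum_taylorSeries_on_ball (r := (1 + c / ((k : ℝ) + 2) ^ 2))
        (hd k) hwb
      refine h.congr_fun ?_
      intro n
      rw [hdd]
      simp only [sub_zero, smul_eq_mul]
      ring
    have h1 : HasSum (fun k => g k w) (∑' x : ℕ × ℕ, d x.1 x.2 * w ^ x.2) :=
      hS.hasSum.prod_fiberwise hg
    have h2 : HasSum (fun x : ℕ × ℕ => d x.2 x.1 * w ^ x.1)
        (∑' x : ℕ × ℕ, d x.1 x.2 * w ^ x.2) :=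
      ((Equiv.prodComm ℕ ℕ).hasSum_iff (f := fun x : ℕ × ℕ => d x.1 x.2 * w ^ x.2)).2 hS.hasSum
    rw [h1.tsum_eq]
    have h3 : ∀ n, HasSum (fun k => d k n * w ^ n) ((∑' k, d k n) * w ^ n) := fun n => by
      have : Summable fun k => d k n :=
        Summable.of_norm_bounded (hv1.mul_right _) fun k => hv2 k n
      exact this.hasSum.mul_right _
    exact h2.prod_fiberwise h3

/-! ### The moment averages as functions of p -/

/-- The function `X ↦ (p X)^{-L}` with `L`-th moments as averages. -/
noncomputable def invPow (p : ℂ) (L : ℕ) (x : ℂ) : ℂ := ((p * x)⁻¹) ^ L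

/-- The iterated averages of `X ↦ (p X)^{-L}`, started at the fixed level `X = B 1 = 2 / p`. -/
noncomputable def momentAvg (L k : ℕ) (p : ℂ) : ℂ := iterAvg p (invPow p L) k (2 / p)

lemma norm_pow_sub_pow_le_ten {x y : ℂ} (hx : ‖x‖ ≤ 10) (hy : ‖y‖ ≤ 10) (L : ℕ) :
    ‖x ^ L - y ^ L‖ ≤ L * 10 ^ L * ‖x - y‖ := by
  induction L with
  | zero => simp
  | succ L ih =>
    have e : x ^ (L + 1) - y ^ (L + 1) = (x ^ L - y ^ L) * x + y ^ L * (x - y) := by ring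
    rw [e]
    refine (norm_add_le _ _).trans ?_
    rw [norm_mul, norm_mul, norm_pow]
    have h1 : ‖x ^ L - y ^ L‖ * ‖x‖ ≤ L * 10 ^ L * ‖x - y‖ * 10 :=
      mul_le_mul ih hx (norm_nonneg _) (by positivity)
    have h2 : ‖y‖ ^ L * ‖x - y‖ ≤ 10 ^ L * ‖x - y‖ := by gcongr
    push_cast
    rw [pow_succ]
    have : 0 ≤ (10 : ℝ) ^ L * ‖x - y‖ := by positivity
    nlinarith

lemma norm_le_of_discGap_pos {u : ℂ} (hu : 0 < discGap u) : ‖u‖ ≤ 5 := by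
  rw [discGap] at hu
  have h1 : ‖u - 2‖ ≤ 3 := by nlinarith [norm_nonneg (u - 2)]
  have h2 := norm_add_le (u - 2) 2
  rw [sub_add_cancel, Complex.norm_ofNat] at h2
  linarith

lemma norm_sub_le_discDist {u v : ℂ} (hu : 0 < discGap u) (hv : 0 < discGap v) :
    ‖u - v‖ ≤ 5 * discDist u v := by
  have h : √(discGap u * discGap v) ≤ 5 := by
    rw [Real.sqrt_le_left (by norm_num)]
    nlinarith [discGap_le u, discGap_le v]
  rw [discDist, ← mul_div_assoc, le_div_iff₀ (Real.sqrt_pos.2 (by positivity)), mul_comm]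
  gcongr

lemma norm_invPow_sub_le {p : ℂ} (hp : 1 / 2 ≤ ‖p‖) (L : ℕ) {u v : ℂ} (hu : 0 < discGap u)
    (hv : 0 < discGap v) :
    ‖invPow p L u⁻¹ - invPow p L v⁻¹‖ ≤ L * 10 ^ L * 10 * discDist u v := by
  have hp0 : 0 < ‖p‖ := by linarith
  have hpi : ‖p‖⁻¹ ≤ 2 := by
    rw [inv_le_comm₀ hp0 (by norm_num)]; linarith
  have e : ∀ z, invPow p L z⁻¹ = (p⁻¹ * z) ^ L := fun z => by rw [invPow, mul_inv, inv_inv]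
  have hb : ∀ z, 0 < discGap z → ‖p⁻¹ * z‖ ≤ 10 := fun z hz => by
    rw [norm_mul, norm_inv]
    have := norm_le_of_discGap_pos hz
    calc ‖p‖⁻¹ * ‖z‖ ≤ 2 * 5 := by gcongr
      _ = 10 := by norm_num
  rw [e, e]
  refine (norm_pow_sub_pow_le_ten (hb u hu) (hb v hv) L).trans ?_
  rw [mul_assoc _ (10 : ℝ)]
  gcongr
  rw [← mul_sub, norm_mul, norm_inv]
  have := norm_sub_le_discDist hu hv
  have h0 := discDist_nonneg u v
  calc ‖p‖⁻¹ * ‖u - v‖ ≤ 2 * (5 * discDist u v) := by gcongr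
    _ = 10 * discDist u v := by ring

/-- The starting point 2/p is one shift of 1, the form to which the contraction estimate applies. -/
lemma momentAvg_eq (L k : ℕ) (p : ℂ) :
    momentAvg L k p = iterAvg p (invPow p L) k (shiftIter p 1 1) := by
  rw [shiftIter_one, momentAvg]; norm_num

lemma discDist_one_le {a : ℂ} (h : 1 ≤ discGap a) : discDist a 1 ≤ 2 := by
  have h1 : discGap 1 = 4 := by rw [discGap]; norm_num
  rw [discDist, h1, div_le_iff₀ (Real.sqrt_pos.2 (by linarith))]
  have h2 : 2 ≤ √(discGap a * 4) := by
    rw [Real.le_sqrt' (by norm_num)]; linarith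
  have h3 := norm_add_le (a - 2) 1
  have h4 : ‖a - 2‖ ≤ 2 := by rw [discGap] at h; nlinarith [norm_nonneg (a - 2)]
  rw [show a - 2 + 1 = a - 1 by ring, norm_one] at h3
  linarith

lemma bounds_of_norm_sub_two_le {p : ℂ} (hp : ‖p - 2‖ ≤ 1 + 1 / 60000) :
    1 / 2 ≤ ‖p‖ ∧ 1 ≤ discGap (2 / p) ∧ 1 ≤ discGap (p / 2) := by
  have hre := (abs_le.1 ((Complex.abs_re_le_norm (p - 2)).trans hp)).1
  simp at hre
  have h1 : 1 / 2 ≤ ‖p‖ := by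
    have := Complex.re_le_norm p
    linarith
  have hp0 : p ≠ 0 := by
    rintro rfl
    simp at h1
    linarith
  refine ⟨h1, ?_, ?_⟩
  · have h0 : 0 < ‖p‖ := by linarith
    rw [discGap, show 2 / p - 2 = (2 * (1 - p)) / p by field_simp, norm_div, norm_mul,
      Complex.norm_ofNat, div_pow, le_sub_comm, div_le_iff₀ (by positivity), mul_pow]
    simp only [← Complex.normSq_eq_norm_sq, Complex.normSq_apply]
    simp
    nlinarith
  · have h3 := norm_sub_le (p - 2) 2
    rw [discGap, show p / 2 - 2 = ((p - 2) - 2) / 2 by ring, norm_div, div_pow]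
    rw [Complex.norm_ofNat] at h3 ⊢
    nlinarith [norm_nonneg (p - 2 - 2)]

lemma norm_sub_two_le_of_ball {k : ℕ} {p : ℂ}
    (hp : ‖p - 2‖ ≤ 1 + 1 / 60000 / ((k : ℝ) + 2) ^ 2) :
    ‖p - 2‖ ≤ 1 + 1 / 60000 ∧ ∀ i, 1 ≤ i → i ≤ k + 2 → DiscGood i p := by
  have hk : (0 : ℝ) ≤ k := by positivity
  refine ⟨hp.trans ?_, fun i hi hi' => ?_⟩
  · have : 1 / 60000 / ((k : ℝ) + 2) ^ 2 ≤ 1 / 60000 := by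
      apply div_le_self (by norm_num)
      nlinarith
    linarith
  · refine discGood_of_norm_sub_two_le hi (K := (k : ℝ) + 2) (by exact_mod_cast hi') ?_
    rwa [← div_div]

lemma norm_momentAvg_succ_sub_le (L k : ℕ) {p : ℂ}
    (hp : ‖p - 2‖ ≤ 1 + 1 / 60000 / ((k : ℝ) + 2) ^ 2) :
    ‖momentAvg L (k + 1) p - momentAvg L k p‖ ≤
      L * 10 ^ L * 10 * 2 * (19995 / 20000) ^ k := by
  obtain ⟨hp', hgood⟩ := norm_sub_two_le_of_ball hp
  obtain ⟨h1, h2, h3⟩ := bounds_of_norm_sub_two_le hp'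
  have hp0 : p ≠ 0 := norm_pos_iff.1 (by linarith)
  have h4 : discGap 1 = 4 := by rw [discGap]; norm_num
  have key : ∀ a, 1 ≤ discGap a → ‖iterAvg p (invPow p L) k (shiftIter p 1 a) -
      iterAvg p (invPow p L) k (shiftIter p 1 1)‖ ≤ L * 10 ^ L * 10 * (19995 / 20000) ^ k * 2 := by
    intro a ha
    refine (norm_iterAvg_sub_le hp0 (C := L * 10 ^ L * 10) (by positivity)
      (fun u v => norm_invPow_sub_le h1 L) k 1 a 1 le_rfl
      (fun i hi hi' => hgood i hi (by omega)) (by linarith) (by rw [h4]; norm_num)).trans ?_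
    gcongr
    exact discDist_one_le ha
  have k1 := key _ h2
  have k2 := key _ h3
  -- One more average from 2/p is the mean of k averages started at the shifts of 2/p and of p/2;
  -- both are compared with the shift of 1.
  rw [momentAvg_eq L k, momentAvg, iterAvg_succ, inv_div, ← shiftIter_one, ← shiftIter_one]
  have e : ∀ x y z : ℂ, (x + y) / 2 - z = ((x - z) + (y - z)) / 2 := fun x y z => by ring
  rw [e, norm_div, Complex.norm_ofNat, div_le_iff₀ (by norm_num)]
  refine (norm_add_le _ _).trans ?_
  linarith

lemma differentiableAt_momentAvg (L k : ℕ) {p : ℂ}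
    (hgood : ∀ i, 1 ≤ i → i ≤ k + 1 → DiscGood i p) (hp : p ≠ 0) :
    DifferentiableAt ℂ (momentAvg L k) p := by
  have h := differentiableAt_iterAvg hp (f := fun s => invPow s L) (fun x hx hx0 => by
    unfold invPow
    exact ((differentiableAt_id.mul hx).inv (mul_ne_zero hp hx0)).pow L) k 1 (fun _ => 1) le_rfl
    (fun i hi hi' => hgood i hi (by omega)) (differentiableAt_const _)
    (by rw [discGap]; norm_num)
  have e : momentAvg L k = fun s => iterAvg s (invPow s L) k (shiftIter s 1 1) :=
    funext fun s => momentAvg_eq L k s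
  rw [e]
  exact h

/-- The limits of the averages have a power series in `p - 2` on the closed unit disc with rapidly
decreasing coefficients. -/
lemma exists_coeff_tendsto_momentAvg (L : ℕ) :
    ∃ h : ℕ → ℂ, (∀ M : ℕ, ∃ A : ℝ, ∀ n : ℕ, ‖h n‖ ≤ A / ((n : ℝ) + 1) ^ M) ∧
      ∀ w : ℂ, ‖w‖ ≤ 1 → Summable (fun n => h n * w ^ n) ∧
        Tendsto (fun k => momentAvg L k (2 + w)) atTop (𝓝 (∑' n, h n * w ^ n)) := by
  have hb : ∀ (k : ℕ) (w : ℂ), w ∈ Metric.ball (0 : ℂ) (1 + 1 / 60000 / ((k : ℝ) + 2) ^ 2) →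
      ‖(2 + w) - 2‖ ≤ 1 + 1 / 60000 / ((k : ℝ) + 2) ^ 2 := by
    intro k w hw
    rw [mem_ball_zero_iff] at hw
    rw [add_sub_cancel_left]
    exact hw.le
  obtain ⟨h, hh1, hh2⟩ := exists_rapidly_decreasing_coeff
    (g := fun k w => momentAvg L (k + 1) (2 + w) - momentAvg L k (2 + w))
    (C := L * 10 ^ L * 10 * 2) (c := 1 / 60000) (t := 19995 / 20000) (by positivity) (by norm_num)
    (by norm_num) (by norm_num) (by norm_num)
    (by
      intro k w hw
      obtain ⟨hp', hgood⟩ := norm_sub_two_le_of_ball (hb k w hw)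
      have hp0 : (2 + w) ≠ 0 := norm_pos_iff.1 (by linarith [(bounds_of_norm_sub_two_le hp').1])
      have h1 := differentiableAt_momentAvg L (k + 1) (p := 2 + w) hgood hp0
      have h2 := differentiableAt_momentAvg L k (p := 2 + w)
        (fun i hi hi' => hgood i hi (by omega)) hp0
      exact (((h1.sub h2).comp w (by fun_prop : DifferentiableAt ℂ (fun w => 2 + w) w))
        ).differentiableWithinAt)
    (fun k w hw => norm_momentAvg_succ_sub_le L k (hb k w hw))
  have hS : ∀ w : ℂ, ‖w‖ ≤ 1 →
      Summable fun k => momentAvg L (k + 1) (2 + w) - momentAvg L k (2 + w) := by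
    intro w hw
    refine Summable.of_norm_bounded
      ((summable_geometric_of_lt_one (r := 19995 / 20000) (by norm_num) (by norm_num)).mul_left
        (L * 10 ^ L * 10 * 2 : ℝ)) fun k => norm_momentAvg_succ_sub_le L k (hb k w ?_)
    rw [mem_ball_zero_iff]
    have : 0 < 1 / 60000 / ((k : ℝ) + 2) ^ 2 := by positivity
    linarith
  -- The telescoping series of differences starts from the constant 2^{-L}, which affects only the
  -- coefficient of index 0.
  have h0 : ∀ w : ℂ, ‖w‖ ≤ 1 → momentAvg L 0 (2 + w) = (2⁻¹) ^ L := by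
    intro w hw
    have hp0 : (2 + w) ≠ 0 := by
      intro h
      have : ‖w‖ = 2 := by
        rw [show w = -2 by linear_combination h]; norm_num
      linarith
    rw [momentAvg, iterAvg_zero, invPow]
    field_simp
  have hsing : ∀ w : ℂ, HasSum (fun n => (if n = 0 then (2⁻¹ : ℂ) ^ L else 0) * w ^ n)
      ((2⁻¹) ^ L) := by
    intro w
    have := hasSum_ite_eq 0 ((2⁻¹ : ℂ) ^ L)
    refine this.congr_fun ?_
    intro n
    split_ifs with hn
    · rw [hn]; simp
    · simp
  refine ⟨fun n => (if n = 0 then (2⁻¹) ^ L else 0) + h n, ?_, ?_⟩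
  · intro M
    obtain ⟨A, hA⟩ := hh1 M
    refine ⟨A + ‖((2 : ℂ)⁻¹) ^ L‖, fun n => ?_⟩
    refine (norm_add_le _ _).trans ?_
    rw [add_div, add_comm]
    gcongr
    · exact hA n
    · split_ifs with hn
      · rw [hn]; simp
      · rw [norm_zero]; positivity
  · intro w hw
    have h1 := (hsing w).add (hh2 w hw)
    have h2 : HasSum (fun n => ((if n = 0 then (2⁻¹) ^ L else 0) + h n) * w ^ n)
        ((2⁻¹) ^ L + ∑' k, (momentAvg L (k + 1) (2 + w) - momentAvg L k (2 + w))) := by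
      refine h1.congr_fun fun n => ?_
      ring
    refine ⟨h2.summable, ?_⟩
    rw [h2.tsum_eq]
    have h3 := (hS w hw).hasSum.tendsto_sum_nat
    simp only [Finset.sum_range_sub (fun k => momentAvg L k (2 + w))] at h3
    have h4 := h3.const_add ((2⁻¹) ^ L)
    refine h4.congr fun k => ?_
    rw [h0 w hw]
    ring

/-! ### Asymptotic expansions at w = 0 -/

/-- `F` is the asymptotic expansion of `f` at `0`. -/
def HasJets (f : ℂ → ℂ) (F : PowerSeries ℂ) : Prop :=
  ∀ n : ℕ, (fun w => f w - (F.trunc n).eval w) =O[𝓝 0] fun w => w ^ n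

lemma isBigO_pow_of_le {m n : ℕ} (h : m ≤ n) :
    (fun w : ℂ => w ^ n) =O[𝓝 0] fun w => w ^ m := by
  obtain ⟨k, rfl⟩ := Nat.exists_eq_add_of_le h
  simp_rw [pow_add]
  have : (fun w : ℂ => w ^ k) =O[𝓝 0] fun _ => (1 : ℂ) :=
    (by fun_prop : ContinuousAt (fun w : ℂ => w ^ k) 0).isBigO_one ℂ
  simpa using (Asymptotics.isBigO_refl (fun w : ℂ => w ^ m) (𝓝 0)).mul this

lemma isBigO_eval_of_dvd {P : ℂ[X]} {n : ℕ} (h : Polynomial.X ^ n ∣ P) :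
    (fun w => P.eval w) =O[𝓝 0] fun w => w ^ n := by
  obtain ⟨Q, rfl⟩ := h
  have : (fun w : ℂ => Q.eval w) =O[𝓝 0] fun _ => (1 : ℂ) :=
    (Q.continuous.continuousAt : ContinuousAt (fun w : ℂ => Q.eval w) 0).isBigO_one ℂ
  simpa using (Asymptotics.isBigO_refl (fun w : ℂ => w ^ n) (𝓝 0)).mul this

lemma dvd_of_isBigO_eval {P : ℂ[X]} {n : ℕ}
    (h : (fun w => P.eval w) =O[𝓝 0] fun w => w ^ n) : Polynomial.X ^ n ∣ P := by
  induction n with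
  | zero => simp
  | succ n ih =>
    obtain ⟨Q, rfl⟩ := ih (h.trans (isBigO_pow_of_le n.le_succ))
    have h1 : (fun w => Q.eval w) =O[𝓝[≠] 0] fun w => w := by
      obtain ⟨C, hC⟩ := h.bound
      refine Asymptotics.IsBigO.of_bound C ?_
      filter_upwards [hC.filter_mono nhdsWithin_le_nhds, self_mem_nhdsWithin] with w hw hw0
      have hw0' : 0 < ‖w‖ := norm_pos_iff.2 hw0
      simp only [Polynomial.eval_mul, Polynomial.eval_pow, Polynomial.eval_X, norm_mul, norm_pow,
        pow_succ] at hw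
      have hp : 0 < ‖w‖ ^ n := by positivity
      refine le_of_mul_le_mul_left ?_ hp
      linarith
    have h2 : Tendsto (fun w => Q.eval w) (𝓝[≠] 0) (𝓝 0) :=
      h1.trans_tendsto (tendsto_id.mono_left nhdsWithin_le_nhds)
    have h3 : Tendsto (fun w => Q.eval w) (𝓝[≠] 0) (𝓝 (Q.eval 0)) :=
      (Q.continuous.tendsto 0).mono_left nhdsWithin_le_nhds
    have h4 : Q.eval 0 = 0 := tendsto_nhds_unique h3 h2
    rw [pow_succ]
    refine mul_dvd_mul_left _ ?_
    rw [Polynomial.X_dvd_iff, Polynomial.coeff_zero_eq_eval_zero, h4]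

lemma HasJets.coeff_eq_zero {f : ℂ → ℂ} {F : PowerSeries ℂ} (h : HasJets f F) {j : ℕ}
    (hf : f =O[𝓝 0] fun w => w ^ j) {m : ℕ} (hm : m < j) : PowerSeries.coeff m F = 0 := by
  have h1 : (fun w => (F.trunc j).eval w) =O[𝓝 0] fun w => w ^ j := by
    refine (hf.sub (h j)).congr_left fun w => ?_
    ring
  have h2 := Polynomial.X_pow_dvd_iff.1 (dvd_of_isBigO_eval h1) m hm
  rwa [PowerSeries.coeff_trunc, if_pos hm] at h2

lemma HasJets.sub {f g : ℂ → ℂ} {F G : PowerSeries ℂ} (hf : HasJets f F) (hg : HasJets g G) :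
    HasJets (fun w => f w - g w) (F - G) := by
  intro n
  refine ((hf n).sub (hg n)).congr_left fun w => ?_
  rw [PowerSeries.trunc_sub, Polynomial.eval_sub]
  ring

lemma HasJets.add {f g : ℂ → ℂ} {F G : PowerSeries ℂ} (hf : HasJets f F) (hg : HasJets g G) :
    HasJets (fun w => f w + g w) (F + G) := by
  intro n
  refine ((hf n).add (hg n)).congr_left fun w => ?_
  rw [map_add, Polynomial.eval_add]
  ring

lemma HasJets.congr {f g : ℂ → ℂ} {F : PowerSeries ℂ} (hf : HasJets f F) (h : f =ᶠ[𝓝 0] g) :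
    HasJets g F := by
  intro n
  refine (hf n).congr' ?_ (EventuallyEq.refl _ _)
  filter_upwards [h] with w hw
  rw [hw]

/-- This is what converts functional equations valid for small w into identities of formal power
series. -/
lemma HasJets.unique {f : ℂ → ℂ} {F G : PowerSeries ℂ} (hf : HasJets f F) (hg : HasJets f G) :
    F = G := by
  have h := hf.sub hg
  rw [← sub_eq_zero]
  ext m
  refine h.coeff_eq_zero (j := m + 1) ?_ m.lt_succ_self
  simp only [sub_self]
  exact Asymptotics.isBigO_zero _ _

lemma HasJets.isBigO_one {f : ℂ → ℂ} {F : PowerSeries ℂ} (hf : HasJets f F) :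
    f =O[𝓝 0] fun _ => (1 : ℂ) := by
  simpa using hf 0

lemma HasJets.mul {f g : ℂ → ℂ} {F G : PowerSeries ℂ} (hf : HasJets f F) (hg : HasJets g G) :
    HasJets (fun w => f w * g w) (F * G) := by
  intro n
  have h1 := (hf n).mul hg.isBigO_one
  have hc : (fun w => (F.trunc n).eval w) =O[𝓝 0] fun _ => (1 : ℂ) :=
    ((F.trunc n).continuous.continuousAt :
      ContinuousAt (fun w : ℂ => (F.trunc n).eval w) 0).isBigO_one ℂ
  have h2 := hc.mul (hg n)
  have h3 : (fun w => (F.trunc n * G.trunc n - (F * G).trunc n).eval w) =O[𝓝 0]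
      fun w => w ^ n := by
    apply isBigO_eval_of_dvd
    rw [Polynomial.X_pow_dvd_iff]
    intro d hd
    rw [Polynomial.coeff_sub, PowerSeries.coeff_trunc, if_pos hd, Polynomial.coeff_mul,
      PowerSeries.coeff_mul, sub_eq_zero]
    refine Finset.sum_congr rfl fun x hx => ?_
    have := Finset.HasAntidiagonal.mem_antidiagonal.1 hx
    rw [PowerSeries.coeff_trunc, PowerSeries.coeff_trunc, if_pos (by omega), if_pos (by omega)]
  simp only [mul_one, one_mul] at h1 h2
  refine ((h1.add h2).add h3).congr_left fun w => ?_
  rw [Polynomial.eval_sub, Polynomial.eval_mul]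
  ring

lemma hasJets_eval (P : ℂ[X]) : HasJets (fun w => P.eval w) (P : PowerSeries ℂ) := by
  intro n
  have : (fun w => (P - (P : PowerSeries ℂ).trunc n).eval w) =O[𝓝 0] fun w => w ^ n := by
    apply isBigO_eval_of_dvd
    rw [Polynomial.X_pow_dvd_iff]
    intro d hd
    rw [Polynomial.coeff_sub, PowerSeries.coeff_trunc, if_pos hd, Polynomial.coeff_coe, sub_self]
  simpa using this

lemma hasJets_const (c : ℂ) : HasJets (fun _ => c) (PowerSeries.C c) := by
  simpa using hasJets_eval (Polynomial.C c)

lemma hasJets_id : HasJets (fun w => w) PowerSeries.X := by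
  simpa using hasJets_eval Polynomial.X

lemma HasJets.pow {f : ℂ → ℂ} {F : PowerSeries ℂ} (hf : HasJets f F) (n : ℕ) :
    HasJets (fun w => f w ^ n) (F ^ n) := by
  induction n with
  | zero => simpa using hasJets_const 1
  | succ n ih => simpa only [pow_succ] using ih.mul hf

lemma HasJets.sum {ι : Type*} (s : Finset ι) {f : ι → ℂ → ℂ} {F : ι → PowerSeries ℂ}
    (h : ∀ i ∈ s, HasJets (f i) (F i)) : HasJets (fun w => ∑ i ∈ s, f i w) (∑ i ∈ s, F i) := by
  classical
  induction s using Finset.induction_on with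
  | empty => simpa using hasJets_const 0
  | insert a s ha ih =>
    simp only [Finset.sum_insert ha]
    exact (h a (Finset.mem_insert_self a s)).add
      (ih fun i hi => h i (Finset.mem_insert_of_mem hi))

lemma HasFPowerSeriesAt.hasJets {f : ℂ → ℂ} {q : FormalMultilinearSeries ℂ ℂ ℂ}
    (h : HasFPowerSeriesAt f q 0) : HasJets f (PowerSeries.mk q.coeff) := by
  intro n
  have h1 := h.isBigO_sub_partialSum_pow n
  simp only [zero_add] at h1
  rw [← Asymptotics.isBigO_norm_right]
  simp only [norm_pow]
  refine h1.congr_left fun w => ?_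
  congr 1
  rw [FormalMultilinearSeries.partialSum, Polynomial.eval, PowerSeries.eval₂_trunc_eq_sum_range]
  refine Finset.sum_congr rfl fun i _ => ?_
  rw [FormalMultilinearSeries.apply_eq_pow_smul_coeff, PowerSeries.coeff_mk, smul_eq_mul, mul_comm,
    RingHom.id_apply]

lemma hasJets_of_hasSum {f : ℂ → ℂ} {c : ℕ → ℂ}
    (h : ∀ᶠ w in 𝓝 0, HasSum (fun n => c n * w ^ n) (f w)) : HasJets f (PowerSeries.mk c) := by
  have : HasFPowerSeriesAt f (FormalMultilinearSeries.ofScalars ℂ c) 0 := by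
    rw [hasFPowerSeriesAt_iff]
    filter_upwards [h] with w hw
    rw [zero_add]
    refine hw.congr_fun fun n => ?_
    rw [FormalMultilinearSeries.coeff_ofScalars, smul_eq_mul, mul_comm]
  have h2 := HasFPowerSeriesAt.hasJets this
  have e : (FormalMultilinearSeries.ofScalars ℂ c).coeff = c :=
    funext fun n => FormalMultilinearSeries.coeff_ofScalars
  rwa [e] at h2

/-- The power series of `u ↦ (a + u)^{-(r+1)}`. -/
noncomputable def invPowSeries (a : ℂ) (r : ℕ) : PowerSeries ℂ :=
  PowerSeries.mk fun k => (-1) ^ k * ((k + r).choose r : ℂ) / a ^ (k + r + 1)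

lemma hasJets_inv_pow {a : ℂ} (ha : a ≠ 0) (r : ℕ) :
    HasJets (fun u => 1 / (a + u) ^ (r + 1)) (invPowSeries a r) := by
  apply hasJets_of_hasSum
  have hpos : 0 < ‖a‖ := norm_pos_iff.2 ha
  filter_upwards [Metric.ball_mem_nhds (0 : ℂ) hpos] with u hu
  rw [mem_ball_zero_iff] at hu
  have h1 : ‖-u / a‖ < 1 := by
    rw [norm_div, norm_neg, div_lt_one hpos]
    exact hu
  have h2 := (hasSum_choose_mul_geometric_of_norm_lt_one r h1).mul_left (1 / a ^ (r + 1))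
  have hau : a + u ≠ 0 := by
    intro h
    rw [show u = -a by linear_combination h, norm_neg] at hu
    exact lt_irrefl _ hu
  have e : 1 / a ^ (r + 1) * (1 / (1 - -u / a) ^ (r + 1)) = 1 / (a + u) ^ (r + 1) := by
    rw [show 1 - -u / a = (a + u) / a by field_simp; ring, div_pow]
    field_simp
  rw [← e]
  refine h2.congr_fun fun k => ?_
  rw [div_pow, neg_pow]
  field_simp
  ring

/-! ### The invariant functional for p near 2 -/

/-- The disc about `1` which both branches of the averaging operator for `p = 2 + w` map into
itself. -/
def smallDisc (w : ℂ) : Set ℂ := Metric.closedBall 1 (4 * ‖w‖)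

lemma mem_smallDisc {w x : ℂ} : x ∈ smallDisc w ↔ ‖x - 1‖ ≤ 4 * ‖w‖ := mem_closedBall_iff_norm

lemma one_mem_smallDisc (w : ℂ) : (1 : ℂ) ∈ smallDisc w := by
  rw [mem_smallDisc, sub_self, norm_zero]; positivity

lemma norm_two_add_ge {w : ℂ} (hw : ‖w‖ ≤ 1 / 100) : 199 / 100 ≤ ‖2 + w‖ := by
  have := norm_sub_le (2 + w) w
  rw [add_sub_cancel_right, Complex.norm_ofNat] at this
  linarith

lemma norm_two_add_le {w : ℂ} (hw : ‖w‖ ≤ 1 / 100) : ‖2 + w‖ ≤ 201 / 100 := by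
  have := norm_add_le 2 w
  rw [Complex.norm_ofNat] at this
  linarith

lemma two_add_ne_zero {w : ℂ} (hw : ‖w‖ ≤ 1 / 100) : 2 + w ≠ 0 :=
  norm_pos_iff.1 (by linarith [norm_two_add_ge hw])

lemma norm_ge_of_mem_smallDisc {w x : ℂ} (hw : ‖w‖ ≤ 1 / 100) (hx : x ∈ smallDisc w) :
    96 / 100 ≤ ‖x‖ := by
  rw [mem_smallDisc] at hx
  have := norm_sub_le x (x - 1)
  rw [sub_sub_cancel, norm_one] at this
  linarith

lemma ne_zero_of_mem_smallDisc {w x : ℂ} (hw : ‖w‖ ≤ 1 / 100) (hx : x ∈ smallDisc w) : x ≠ 0 :=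
  norm_pos_iff.1 (by linarith [norm_ge_of_mem_smallDisc hw hx])

/-- The branch contracts by about 1/2 and moves the point 1 by about |w|/2, so it preserves a disc
of radius 4|w|. -/
lemma smallDisc_branch {w x : ℂ} (hw : ‖w‖ ≤ 1 / 100) (hx : x ∈ smallDisc w) :
    (x + 1) / (2 + w) ∈ smallDisc w := by
  rw [mem_smallDisc] at hx ⊢
  have hp := norm_two_add_ge hw
  have hp0 := two_add_ne_zero hw
  rw [show (x + 1) / (2 + w) - 1 = ((x - 1) - w) / (2 + w) by field_simp; ring, norm_div,
    div_le_iff₀ (by linarith)]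
  have := norm_sub_le (x - 1) w
  nlinarith [norm_nonneg w]

lemma smallDisc_branch_inv {w x : ℂ} (hw : ‖w‖ ≤ 1 / 100) (hx : x ∈ smallDisc w) :
    (x⁻¹ + 1) / (2 + w) ∈ smallDisc w := by
  have h0 := norm_ge_of_mem_smallDisc hw hx
  have hx0 := ne_zero_of_mem_smallDisc hw hx
  rw [mem_smallDisc] at hx ⊢
  have hp := norm_two_add_ge hw
  have hp0 := two_add_ne_zero hw
  rw [show (x⁻¹ + 1) / (2 + w) - 1 = (-(x - 1) - w * x) / (x * (2 + w)) by field_simp; ring,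
    norm_div, norm_mul, div_le_iff₀ (by positivity)]
  have h1 := norm_sub_le (-(x - 1)) (w * x)
  rw [norm_neg, norm_mul] at h1
  have h2 : 199 / 100 * ‖x‖ * (4 * ‖w‖) ≤ 4 * ‖w‖ * (‖x‖ * ‖2 + w‖) := by
    have : 0 ≤ 4 * ‖w‖ * ‖x‖ := by positivity
    nlinarith
  nlinarith [norm_nonneg w]

lemma branch_sub_le {w : ℂ} (hw : ‖w‖ ≤ 1 / 100) (x y : ℂ) :
    ‖(x + 1) / (2 + w) - (y + 1) / (2 + w)‖ ≤ 3 / 5 * ‖x - y‖ := by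
  have hp := norm_two_add_ge hw
  rw [← sub_div, add_sub_add_right_eq_sub, norm_div, div_le_iff₀ (by linarith)]
  nlinarith [norm_nonneg (x - y)]

lemma branch_inv_sub_le {w x y : ℂ} (hw : ‖w‖ ≤ 1 / 100) (hx : x ∈ smallDisc w)
    (hy : y ∈ smallDisc w) :
    ‖(x⁻¹ + 1) / (2 + w) - (y⁻¹ + 1) / (2 + w)‖ ≤ 3 / 5 * ‖x - y‖ := by
  have hp := norm_two_add_ge hw
  have hx1 := norm_ge_of_mem_smallDisc hw hx
  have hy1 := norm_ge_of_mem_smallDisc hw hy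
  rw [← sub_div, add_sub_add_right_eq_sub, inv_sub_inv (ne_zero_of_mem_smallDisc hw hx)
    (ne_zero_of_mem_smallDisc hw hy), norm_div, norm_div, norm_mul, norm_sub_rev,
    div_div, div_le_iff₀ (by positivity)]
  have h1 : 96 / 100 * (96 / 100) ≤ ‖x‖ * ‖y‖ := by gcongr
  have h2 : 96 / 100 * (96 / 100) * (199 / 100) ≤ ‖x‖ * ‖y‖ * ‖2 + w‖ := by gcongr
  nlinarith [norm_nonneg (x - y)]

lemma norm_iterAvg_sub_le_of_small {w : ℂ} (hw : ‖w‖ ≤ 1 / 100) {f : ℂ → ℂ} {ε δ : ℝ}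
    (hf : ∀ a ∈ smallDisc w, ∀ b ∈ smallDisc w, ‖a - b‖ ≤ δ → ‖f a - f b‖ ≤ ε) (k : ℕ) :
    ∀ x ∈ smallDisc w, ∀ y ∈ smallDisc w, (3 / 5) ^ k * ‖x - y‖ ≤ δ →
      ‖iterAvg (2 + w) f k x - iterAvg (2 + w) f k y‖ ≤ ε := by
  induction k with
  | zero =>
    intro x hx y hy h
    exact hf x hx y hy (by simpa using h)
  | succ k ih =>
    intro x hx y hy h
    have hk : (0 : ℝ) < (3 / 5) ^ k := by positivity
    rw [pow_succ] at h
    have h1 := ih _ (smallDisc_branch hw hx) _ (smallDisc_branch hw hy)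
      (le_trans (by rw [mul_assoc]; gcongr; exact branch_sub_le hw x y) h)
    have h2 := ih _ (smallDisc_branch_inv hw hx) _ (smallDisc_branch_inv hw hy)
      (le_trans (by rw [mul_assoc]; gcongr; exact branch_inv_sub_le hw hx hy) h)
    rw [iterAvg_succ, iterAvg_succ, ← sub_div, add_sub_add_comm, norm_div, Complex.norm_ofNat,
      div_le_iff₀ (by norm_num)]
    refine (norm_add_le _ _).trans ?_
    linarith

lemma norm_iterAvg_add_sub_le {w : ℂ} (hw : ‖w‖ ≤ 1 / 100) {f : ℂ → ℂ} {c : ℂ} {ε : ℝ} {k : ℕ}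
    (hf : ∀ x ∈ smallDisc w, ‖iterAvg (2 + w) f k x - c‖ ≤ ε) (m : ℕ) :
    ∀ x ∈ smallDisc w, ‖iterAvg (2 + w) f (k + m) x - c‖ ≤ ε := by
  induction m with
  | zero => exact hf
  | succ m ih =>
    intro x hx
    have h1 := ih _ (smallDisc_branch hw hx)
    have h2 := ih _ (smallDisc_branch_inv hw hx)
    rw [← add_assoc, iterAvg_succ]
    have e : ∀ a b : ℂ, (a + b) / 2 - c = ((a - c) + (b - c)) / 2 := fun a b => by ring
    rw [e, norm_div, Complex.norm_ofNat, div_le_iff₀ (by norm_num)]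
    refine (norm_add_le _ _).trans ?_
    linarith

/-- The limit of the iterated averages of `f` for `p = 2 + w`. -/
noncomputable def limAvg (w : ℂ) (f : ℂ → ℂ) : ℂ :=
  limUnder atTop fun k => iterAvg (2 + w) f k 1

lemma norm_sub_le_of_mem_smallDisc {w x y : ℂ} (hx : x ∈ smallDisc w) (hy : y ∈ smallDisc w) :
    ‖x - y‖ ≤ 8 * ‖w‖ := by
  rw [mem_smallDisc] at hx hy
  have := norm_sub_le (x - 1) (y - 1)
  rw [sub_sub_sub_cancel_right] at this
  linarith

/-- Compositions of k branches bring points within (3/5)^k of each other, so uniform continuity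
makes the k-th average nearly constant; further averaging keeps its values in the same small ball.
-/
lemma exists_iterAvg_sub_le {w : ℂ} (hw : ‖w‖ ≤ 1 / 100) {f : ℂ → ℂ}
    (hf : ContinuousOn f (smallDisc w)) {ε : ℝ} (hε : 0 < ε) :
    ∃ k, ∀ m ≥ k, ∀ x ∈ smallDisc w,
      ‖iterAvg (2 + w) f m x - iterAvg (2 + w) f k 1‖ ≤ ε := by
  have huc := (isCompact_closedBall (1 : ℂ) (4 * ‖w‖)).uniformContinuousOn_of_continuous hf
  obtain ⟨δ, hδ, h⟩ := Metric.uniformContinuousOn_iff.1 huc ε hε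
  obtain ⟨k, hk⟩ := exists_pow_lt_of_lt_one hδ (show (3 / 5 : ℝ) < 1 by norm_num)
  refine ⟨k, fun m hm x hx => ?_⟩
  obtain ⟨j, rfl⟩ := Nat.exists_eq_add_of_le hm
  refine norm_iterAvg_add_sub_le hw (fun y hy => ?_) j x hx
  refine norm_iterAvg_sub_le_of_small hw (δ := (3 / 5) ^ k) (fun a ha b hb hab => ?_) k y hy 1
    (one_mem_smallDisc w) ?_
  · have := h a ha b hb (by rw [dist_eq_norm]; linarith)
    rw [dist_eq_norm] at this
    exact this.le
  · have := norm_sub_le_of_mem_smallDisc hy (one_mem_smallDisc w)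
    exact mul_le_of_le_one_right (by positivity) (by linarith)

lemma tendsto_limAvg_one {w : ℂ} (hw : ‖w‖ ≤ 1 / 100) {f : ℂ → ℂ}
    (hf : ContinuousOn f (smallDisc w)) :
    Tendsto (fun k => iterAvg (2 + w) f k 1) atTop (𝓝 (limAvg w f)) := by
  apply tendsto_nhds_limUnder
  apply cauchySeq_tendsto_of_complete
  rw [Metric.cauchySeq_iff']
  intro ε hε
  obtain ⟨k, hk⟩ := exists_iterAvg_sub_le hw hf (half_pos hε)
  refine ⟨k, fun n hn => ?_⟩
  rw [dist_eq_norm]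
  have := hk n hn 1 (one_mem_smallDisc w)
  linarith

lemma tendsto_limAvg {w : ℂ} (hw : ‖w‖ ≤ 1 / 100) {f : ℂ → ℂ}
    (hf : ContinuousOn f (smallDisc w)) {x : ℂ} (hx : x ∈ smallDisc w) :
    Tendsto (fun k => iterAvg (2 + w) f k x) atTop (𝓝 (limAvg w f)) := by
  have h0 : Tendsto (fun k => iterAvg (2 + w) f k x - iterAvg (2 + w) f k 1) atTop (𝓝 0) := by
    rw [Metric.tendsto_atTop]
    intro ε hε
    obtain ⟨k, hk⟩ := exists_iterAvg_sub_le hw hf (by positivity : 0 < ε / 3)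
    refine ⟨k, fun n hn => ?_⟩
    rw [dist_zero_right]
    have h1 := hk n hn x hx
    have h2 := hk n hn 1 (one_mem_smallDisc w)
    have h3 := norm_sub_le (iterAvg (2 + w) f n x - iterAvg (2 + w) f k 1)
      (iterAvg (2 + w) f n 1 - iterAvg (2 + w) f k 1)
    rw [sub_sub_sub_cancel_right] at h3
    linarith
  simpa using h0.add (tendsto_limAvg_one hw hf)

lemma iterAvg_congr {w : ℂ} (hw : ‖w‖ ≤ 1 / 100) {f g : ℂ → ℂ}
    (h : Set.EqOn f g (smallDisc w)) (k : ℕ) :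
    ∀ x ∈ smallDisc w, iterAvg (2 + w) f k x = iterAvg (2 + w) g k x := by
  induction k with
  | zero => exact h
  | succ k ih =>
    intro x hx
    rw [iterAvg_succ, iterAvg_succ, ih _ (smallDisc_branch hw hx),
      ih _ (smallDisc_branch_inv hw hx)]

lemma limAvg_congr {w : ℂ} (hw : ‖w‖ ≤ 1 / 100) {f g : ℂ → ℂ}
    (h : Set.EqOn f g (smallDisc w)) : limAvg w f = limAvg w g := by
  rw [limAvg, limAvg]
  congr 1
  funext k
  exact iterAvg_congr hw h k 1 (one_mem_smallDisc w)

lemma iterAvg_add (p : ℂ) (f g : ℂ → ℂ) (k : ℕ) : ∀ x,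
    iterAvg p (fun x => f x + g x) k x = iterAvg p f k x + iterAvg p g k x := by
  induction k with
  | zero => exact fun x => rfl
  | succ k ih => intro x; simp only [iterAvg_succ, ih]; ring

lemma iterAvg_const_mul (p c : ℂ) (f : ℂ → ℂ) (k : ℕ) : ∀ x,
    iterAvg p (fun x => c * f x) k x = c * iterAvg p f k x := by
  induction k with
  | zero => exact fun x => rfl
  | succ k ih => intro x; simp only [iterAvg_succ, ih]; ring

lemma iterAvg_const (p c : ℂ) (k : ℕ) : ∀ x, iterAvg p (fun _ => c) k x = c := by
  induction k with
  | zero => exact fun x => rfl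
  | succ k ih => intro x; simp only [iterAvg_succ, ih]; ring

/-- The definition moves the starting point first; here the branch next to f is peeled off instead,
which passes to the limit as invariance. -/
lemma iterAvg_succ_eq (p : ℂ) (f : ℂ → ℂ) (k : ℕ) : ∀ x, iterAvg p f (k + 1) x =
    (iterAvg p (fun x => f ((x + 1) / p)) k x + iterAvg p (fun x => f ((x⁻¹ + 1) / p)) k x) / 2 := by
  induction k with
  | zero => exact fun x => rfl
  | succ k ih =>
    intro x
    rw [iterAvg_succ p f (k + 1), ih, ih]
    simp only [iterAvg_succ p _ k]
    ring

lemma limAvg_add {w : ℂ} (hw : ‖w‖ ≤ 1 / 100) {f g : ℂ → ℂ}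
    (hf : ContinuousOn f (smallDisc w)) (hg : ContinuousOn g (smallDisc w)) :
    limAvg w (fun x => f x + g x) = limAvg w f + limAvg w g := by
  refine tendsto_nhds_unique (tendsto_limAvg_one hw (hf.add hg)) ?_
  simp only [iterAvg_add]
  exact (tendsto_limAvg_one hw hf).add (tendsto_limAvg_one hw hg)

lemma limAvg_const_mul {w : ℂ} (hw : ‖w‖ ≤ 1 / 100) (c : ℂ) {f : ℂ → ℂ}
    (hf : ContinuousOn f (smallDisc w)) :
    limAvg w (fun x => c * f x) = c * limAvg w f := by
  refine tendsto_nhds_unique (tendsto_limAvg_one hw (continuousOn_const.mul hf)) ?_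
  simp only [iterAvg_const_mul]
  exact (tendsto_limAvg_one hw hf).const_mul c

lemma limAvg_const {w : ℂ} (hw : ‖w‖ ≤ 1 / 100) (c : ℂ) : limAvg w (fun _ => c) = c := by
  refine tendsto_nhds_unique (tendsto_limAvg_one hw continuousOn_const) ?_
  simp only [iterAvg_const]
  exact tendsto_const_nhds

lemma limAvg_sum {w : ℂ} (hw : ‖w‖ ≤ 1 / 100) {ι : Type*} (s : Finset ι) {f : ι → ℂ → ℂ}
    (hf : ∀ i ∈ s, ContinuousOn (f i) (smallDisc w)) :
    limAvg w (fun x => ∑ i ∈ s, f i x) = ∑ i ∈ s, limAvg w (f i) := by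
  classical
  induction s using Finset.induction_on with
  | empty => simpa using limAvg_const hw 0
  | insert a s ha ih =>
    have hs : ∀ i ∈ s, ContinuousOn (f i) (smallDisc w) :=
      fun i hi => hf i (Finset.mem_insert_of_mem hi)
    simp only [Finset.sum_insert ha]
    rw [limAvg_add hw (hf a (Finset.mem_insert_self a s)) (continuousOn_finsetSum s hs), ih hs]

lemma norm_limAvg_le {w : ℂ} (hw : ‖w‖ ≤ 1 / 100) {f : ℂ → ℂ} (hf : ContinuousOn f (smallDisc w))
    {M : ℝ} (hM : ∀ x ∈ smallDisc w, ‖f x‖ ≤ M) : ‖limAvg w f‖ ≤ M := by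
  refine le_of_tendsto' (tendsto_limAvg_one hw hf).norm fun k => ?_
  have := norm_iterAvg_add_sub_le hw (f := f) (c := 0) (ε := M) (k := 0)
    (fun x hx => by simpa [iterAvg_zero] using hM x hx) k 1 (one_mem_smallDisc w)
  simpa using this

lemma continuousOn_branch_inv {w : ℂ} (hw : ‖w‖ ≤ 1 / 100) :
    ContinuousOn (fun x : ℂ => (x⁻¹ + 1) / (2 + w)) (smallDisc w) :=
  ((continuousOn_id.inv₀ fun _ hx => ne_zero_of_mem_smallDisc hw hx).add
    continuousOn_const).div_const _

/-- Invariance of the limiting functional, the source of all functional equations below. -/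
lemma limAvg_eq_branches {w : ℂ} (hw : ‖w‖ ≤ 1 / 100) {f : ℂ → ℂ}
    (hf : ContinuousOn f (smallDisc w)) :
    limAvg w f = (limAvg w (fun x => f ((x + 1) / (2 + w))) +
      limAvg w (fun x => f ((x⁻¹ + 1) / (2 + w)))) / 2 := by
  have h1 : ContinuousOn (fun x => f ((x + 1) / (2 + w))) (smallDisc w) :=
    hf.comp (by fun_prop) fun x hx => smallDisc_branch hw hx
  have h2 : ContinuousOn (fun x => f ((x⁻¹ + 1) / (2 + w))) (smallDisc w) :=
    hf.comp (continuousOn_branch_inv hw) fun x hx => smallDisc_branch_inv hw hx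
  have h3 := (tendsto_add_atTop_iff_nat 1).2 (tendsto_limAvg_one hw hf)
  simp only [iterAvg_succ_eq] at h3
  exact tendsto_nhds_unique h3
    (((tendsto_limAvg_one hw h1).add (tendsto_limAvg_one hw h2)).div_const 2)

/-! ### Taylor series of averages of functions of Y = pX - 2 -/

/-- The limiting averages of the powers of `Y = p X - 2`. -/
noncomputable def avgPow (j : ℕ) (w : ℂ) : ℂ := limAvg w fun x => ((2 + w) * x - 2) ^ j

lemma norm_mul_sub_two_le {w x : ℂ} (hw : ‖w‖ ≤ 1 / 100) (hx : x ∈ smallDisc w) :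
    ‖(2 + w) * x - 2‖ ≤ 10 * ‖w‖ := by
  rw [mem_smallDisc] at hx
  rw [show (2 + w) * x - 2 = (2 + w) * (x - 1) + w by ring]
  refine (norm_add_le _ _).trans ?_
  rw [norm_mul]
  have := mul_le_mul (norm_two_add_le hw) hx (norm_nonneg _) (by norm_num)
  linarith [norm_nonneg w]

lemma avgPow_zero {w : ℂ} (hw : ‖w‖ ≤ 1 / 100) : avgPow 0 w = 1 := by
  simp only [avgPow, pow_zero]
  exact limAvg_const hw 1

lemma norm_avgPow_le {w : ℂ} (hw : ‖w‖ ≤ 1 / 100) (j : ℕ) :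
    ‖avgPow j w‖ ≤ (10 * ‖w‖) ^ j := by
  refine norm_limAvg_le hw (by fun_prop) fun x hx => ?_
  rw [norm_pow]
  exact pow_le_pow_left₀ (norm_nonneg _) (norm_mul_sub_two_le hw hx) j

lemma isBigO_avgPow (j : ℕ) : avgPow j =O[𝓝 0] fun w => w ^ j := by
  refine Asymptotics.IsBigO.of_bound (10 ^ j) ?_
  filter_upwards [Metric.closedBall_mem_nhds (0 : ℂ) (by norm_num : (0 : ℝ) < 1 / 100)] with w hw
  rw [norm_pow, ← mul_pow]
  exact norm_avgPow_le (by simpa using hw) j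

lemma differentiableAt_iterAvg_pow {w : ℂ} (hw : ‖w‖ ≤ 1 / 100) (j k : ℕ) :
    ∀ x : ℂ → ℂ, DifferentiableAt ℂ x w → x w ∈ smallDisc w →
      DifferentiableAt ℂ (fun s => iterAvg (2 + s) (fun y => ((2 + s) * y - 2) ^ j) k (x s)) w := by
  induction k with
  | zero => intro x hx _; simp only [iterAvg_zero]; fun_prop
  | succ k ih =>
    intro x hx hxm
    have hp := two_add_ne_zero hw
    have hp1 : DifferentiableAt ℂ (fun s : ℂ => 2 + s) w := by fun_prop
    have h1 := ih (fun s => (x s + 1) / (2 + s)) ((hx.add_const 1).div hp1 hp)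
      (smallDisc_branch hw hxm)
    have h2 := ih (fun s => ((x s)⁻¹ + 1) / (2 + s))
      (((hx.inv (ne_zero_of_mem_smallDisc hw hxm)).add_const 1).div hp1 hp)
      (smallDisc_branch_inv hw hxm)
    exact (h1.add h2).div_const 2

lemma norm_iterAvg_pow_sub_le {w : ℂ} (hw : ‖w‖ ≤ 1 / 100) (j k : ℕ) :
    ‖avgPow j w - iterAvg (2 + w) (fun y => ((2 + w) * y - 2) ^ j) k 1‖ ≤
      j * 10 ^ j * 3 * (3 / 5) ^ k := by
  have hc : ContinuousOn (fun y => ((2 + w) * y - 2) ^ j) (smallDisc w) := by fun_prop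
  have h1 : ∀ x ∈ smallDisc w, ‖iterAvg (2 + w) (fun y => ((2 + w) * y - 2) ^ j) k x -
      iterAvg (2 + w) (fun y => ((2 + w) * y - 2) ^ j) k 1‖ ≤ j * 10 ^ j * 3 * (3 / 5) ^ k := by
    intro x hx
    refine norm_iterAvg_sub_le_of_small hw (δ := (3 / 5) ^ k) (fun a ha b hb hab => ?_) k x hx 1
      (one_mem_smallDisc w) ?_
    · have hY : ∀ y ∈ smallDisc w, ‖(2 + w) * y - 2‖ ≤ 10 := fun y hy =>
        (norm_mul_sub_two_le hw hy).trans (by linarith)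
      refine (norm_pow_sub_pow_le_ten (hY a ha) (hY b hb) j).trans ?_
      rw [sub_sub_sub_cancel_right, ← mul_sub, norm_mul, mul_assoc _ (3 : ℝ)]
      gcongr
      linarith [norm_two_add_le hw]
    · have := norm_sub_le_of_mem_smallDisc hx (one_mem_smallDisc w)
      exact mul_le_of_le_one_right (by positivity) (by linarith)
  have h2 := ((tendsto_limAvg_one hw hc).sub_const
    (iterAvg (2 + w) (fun y => ((2 + w) * y - 2) ^ j) k 1)).norm
  refine le_of_tendsto h2 ?_
  filter_upwards [eventually_ge_atTop k] with m hm
  obtain ⟨i, rfl⟩ := Nat.exists_eq_add_of_le hm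
  exact norm_iterAvg_add_sub_le hw h1 i 1 (one_mem_smallDisc w)

lemma analyticAt_avgPow (j : ℕ) : AnalyticAt ℂ (avgPow j) 0 := by
  have hb : ∀ w ∈ Metric.ball (0 : ℂ) (1 / 100), ‖w‖ ≤ 1 / 100 := fun w hw =>
    (mem_ball_zero_iff.1 hw).le
  have hd : DifferentiableOn ℂ (avgPow j) (Metric.ball 0 (1 / 100)) := by
    have hu : TendstoUniformlyOn
        (fun (k : ℕ) w => iterAvg (2 + w) (fun y => ((2 + w) * y - 2) ^ j) k 1) (avgPow j) atTop
        (Metric.ball 0 (1 / 100)) := by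
      rw [Metric.tendstoUniformlyOn_iff]
      intro ε hε
      have h0 : Tendsto (fun k : ℕ => (j * 10 ^ j * 3 : ℝ) * (3 / 5) ^ k) atTop (𝓝 0) := by
        simpa using (tendsto_pow_atTop_nhds_zero_of_lt_one (r := (3 / 5 : ℝ)) (by norm_num)
          (by norm_num)).const_mul (j * 10 ^ j * 3 : ℝ)
      filter_upwards [h0.eventually_lt_const hε] with k hk w hw
      rw [dist_eq_norm]
      exact (norm_iterAvg_pow_sub_le (hb w hw) j k).trans_lt hk
    refine hu.tendstoLocallyUniformlyOn.differentiableOn ?_ Metric.isOpen_ball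
    refine Eventually.of_forall fun k w hw => ?_
    exact (differentiableAt_iterAvg_pow (hb w hw) j k (fun _ => 1) (differentiableAt_const _)
      (one_mem_smallDisc w)).differentiableWithinAt
  exact hd.analyticAt (Metric.ball_mem_nhds _ (by norm_num))

lemma exists_hasJets_avgPow (j : ℕ) : ∃ F, HasJets (avgPow j) F := by
  obtain ⟨q, hq⟩ := analyticAt_avgPow j
  exact ⟨_, HasFPowerSeriesAt.hasJets hq⟩

/-- The Taylor series at `w = 0` of the averages of `Y^j`. -/
noncomputable def powJets (j : ℕ) : PowerSeries ℂ := (exists_hasJets_avgPow j).choose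

lemma hasJets_avgPow (j : ℕ) : HasJets (avgPow j) (powJets j) := (exists_hasJets_avgPow j).choose_spec

lemma coeff_powJets_of_lt {j m : ℕ} (h : m < j) : PowerSeries.coeff m (powJets j) = 0 :=
  (hasJets_avgPow j).coeff_eq_zero (isBigO_avgPow j) h

lemma eventually_norm_le {r : ℝ} (hr : 0 < r) : ∀ᶠ w : ℂ in 𝓝 0, ‖w‖ ≤ r := by
  filter_upwards [Metric.closedBall_mem_nhds (0 : ℂ) hr] with w hw
  simpa using hw

lemma powJets_zero : powJets 0 = 1 := by
  refine (hasJets_avgPow 0).unique (HasJets.congr (f := fun _ => 1) ?_ ?_)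
  · simpa using hasJets_const 1
  · filter_upwards [eventually_norm_le (by norm_num : (0 : ℝ) < 1 / 100)] with w hw
    rw [avgPow_zero hw]

/-- The averages of `(Y - s w)^k`. -/
noncomputable def avgShiftPow (s : ℂ) (k : ℕ) (w : ℂ) : ℂ :=
  limAvg w fun x => ((2 + w) * x - 2 - s * w) ^ k

/-- The Taylor series at `w = 0` of the averages of `(Y - s w)^k`. -/
noncomputable def shiftPowJets (s : ℂ) (k : ℕ) : PowerSeries ℂ :=
  ∑ i ∈ Finset.range (k + 1),
    PowerSeries.C ((k.choose i : ℂ) * (-s) ^ i) * (PowerSeries.X ^ i * powJets (k - i))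

lemma avgShiftPow_eq {w : ℂ} (hw : ‖w‖ ≤ 1 / 100) (s : ℂ) (k : ℕ) :
    avgShiftPow s k w = ∑ i ∈ Finset.range (k + 1),
      ((k.choose i : ℂ) * (-s) ^ i) * (w ^ i * avgPow (k - i) w) := by
  have h1 : avgShiftPow s k w = limAvg w (fun x => ∑ i ∈ Finset.range (k + 1),
      ((k.choose i : ℂ) * (-s) ^ i * w ^ i) * ((2 + w) * x - 2) ^ (k - i)) := by
    rw [avgShiftPow]
    congr 1
    funext x
    rw [show (2 + w) * x - 2 - s * w = (-s) * w + ((2 + w) * x - 2) by ring, add_pow]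
    refine Finset.sum_congr rfl fun i _ => ?_
    rw [mul_pow]
    ring
  rw [h1, limAvg_sum hw _ fun i _ => by fun_prop]
  refine Finset.sum_congr rfl fun i _ => ?_
  rw [limAvg_const_mul hw _ (by fun_prop), avgPow]
  ring

lemma hasJets_avgShiftPow (s : ℂ) (k : ℕ) : HasJets (avgShiftPow s k) (shiftPowJets s k) := by
  refine HasJets.congr (HasJets.sum (Finset.range (k + 1)) fun i _ =>
    (hasJets_const ((k.choose i : ℂ) * (-s) ^ i)).mul
      ((hasJets_id.pow i).mul (hasJets_avgPow (k - i)))) ?_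
  filter_upwards [eventually_norm_le (by norm_num : (0 : ℝ) < 1 / 100)] with w hw
  rw [avgShiftPow_eq hw]

lemma norm_shift_le {w x : ℂ} (hw : ‖w‖ ≤ 1 / 100) (hx : x ∈ smallDisc w) (s : ℂ) :
    ‖(2 + w) * x - 2 - s * w‖ ≤ (10 + ‖s‖) * ‖w‖ := by
  refine (norm_sub_le _ _).trans ?_
  rw [norm_mul]
  linarith [norm_mul_sub_two_le hw hx]

lemma isBigO_avgShiftPow (s : ℂ) (k : ℕ) : avgShiftPow s k =O[𝓝 0] fun w => w ^ k := by
  refine Asymptotics.IsBigO.of_bound ((10 + ‖s‖) ^ k) ?_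
  filter_upwards [eventually_norm_le (by norm_num : (0 : ℝ) < 1 / 100)] with w hw
  rw [norm_pow, ← mul_pow]
  refine norm_limAvg_le hw (by fun_prop) fun x hx => ?_
  rw [norm_pow]
  exact pow_le_pow_left₀ (norm_nonneg _) (norm_shift_le hw hx s) k

/-- The Taylor series at `w = 0` of the averages of `g (Y - s w)`, where `G` is the Taylor series
of `g`. -/
noncomputable def avgJets (G : PowerSeries ℂ) (s : ℂ) : PowerSeries ℂ :=
  PowerSeries.mk fun n => ∑ k ∈ Finset.range (n + 1),
    PowerSeries.coeff k G * PowerSeries.coeff n (shiftPowJets s k)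

/-- The argument of g is O(w) on the small disc, so the order-n Taylor remainder of g is O(w^n)
there and stays so after averaging. The k-th power contributes nothing below w^k, so each
coefficient is a finite sum. -/
lemma hasJets_limAvg {g : ℂ → ℂ} {G : PowerSeries ℂ} (hg : HasJets g G) {r : ℝ} (hr : 0 < r)
    (hc : ContinuousOn g (Metric.ball 0 r)) (s : ℂ) :
    HasJets (fun w => limAvg w fun x => g ((2 + w) * x - 2 - s * w)) (avgJets G s) := by
  intro n
  have h1 : (fun w => (limAvg w fun x => g ((2 + w) * x - 2 - s * w)) -
      ∑ k ∈ Finset.range n, PowerSeries.coeff k G * avgShiftPow s k w) =O[𝓝 0] fun w => w ^ n := by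
    obtain ⟨C, hC0, hC⟩ := (hg n).exists_pos
    obtain ⟨r', hr', hball⟩ := Metric.eventually_nhds_iff_ball.1 hC.bound
    have hs : 0 < 10 + ‖s‖ := by positivity
    have hm : 0 < min r r' := lt_min hr hr'
    refine Asymptotics.IsBigO.of_bound (C * (10 + ‖s‖) ^ n) ?_
    filter_upwards [eventually_norm_le (by norm_num : (0 : ℝ) < 1 / 100),
      eventually_norm_le (show 0 < min r r' / (2 * (10 + ‖s‖)) by positivity)] with w hw hw2
    have hlt : (10 + ‖s‖) * ‖w‖ < min r r' := by
      rw [le_div_iff₀ (by positivity)] at hw2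
      linarith
    have hu : ∀ x ∈ smallDisc w, ‖(2 + w) * x - 2 - s * w‖ < min r r' := fun x hx =>
      (norm_shift_le hw hx s).trans_lt hlt
    have hc' : ContinuousOn (fun x => g ((2 + w) * x - 2 - s * w)) (smallDisc w) :=
      hc.comp (by fun_prop) fun x hx =>
        mem_ball_zero_iff.2 ((hu x hx).trans_le (min_le_left _ _))
    have hlin : (limAvg w fun x => g ((2 + w) * x - 2 - s * w)) -
        ∑ k ∈ Finset.range n, PowerSeries.coeff k G * avgShiftPow s k w =
        limAvg w (fun x => g ((2 + w) * x - 2 - s * w) +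
          ∑ k ∈ Finset.range n, (-PowerSeries.coeff k G) * ((2 + w) * x - 2 - s * w) ^ k) := by
      rw [limAvg_add hw hc' (by fun_prop), limAvg_sum hw _ fun i _ => by fun_prop,
        sub_eq_add_neg, ← Finset.sum_neg_distrib]
      congr 1
      refine Finset.sum_congr rfl fun k _ => ?_
      rw [limAvg_const_mul hw _ (by fun_prop), avgShiftPow, neg_mul]
    rw [hlin]
    refine norm_limAvg_le hw (hc'.add (by fun_prop)) fun x hx => ?_
    have h3 := hball _ (mem_ball_zero_iff.2 ((hu x hx).trans_le (min_le_right _ _)))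
    rw [Polynomial.eval, PowerSeries.eval₂_trunc_eq_sum_range, norm_pow] at h3
    simp only [RingHom.id_apply] at h3
    simp only [neg_mul, Finset.sum_neg_distrib]
    refine h3.trans ?_
    rw [norm_pow, mul_assoc, ← mul_pow]
    have := norm_shift_le hw hx s
    gcongr
  have h2 := HasJets.sum (Finset.range n) fun k _ =>
    (hasJets_const (PowerSeries.coeff k G)).mul (hasJets_avgShiftPow s k)
  have h3 : (∑ k ∈ Finset.range n, PowerSeries.C (PowerSeries.coeff k G) *
      shiftPowJets s k).trunc n = (avgJets G s).trunc n := by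
    ext m
    rw [PowerSeries.coeff_trunc, PowerSeries.coeff_trunc]
    split_ifs with hm
    · rw [map_sum, avgJets, PowerSeries.coeff_mk]
      simp only [PowerSeries.coeff_C_mul]
      symm
      refine Finset.sum_subset (Finset.range_mono hm) fun k _ hk => ?_
      rw [(hasJets_avgShiftPow s k).coeff_eq_zero (isBigO_avgShiftPow s k), mul_zero]
      simpa using hk
    · rfl
  have h4 := h2 n
  rw [h3] at h4
  refine (h1.add h4).congr_left fun w => ?_
  ring

lemma coeff_shiftPowJets {s : ℂ} {k n : ℕ} (h : k ≤ n) :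
    PowerSeries.coeff n (shiftPowJets s k) = ∑ i ∈ Finset.range (k + 1),
      ((k.choose i : ℂ) * (-s) ^ i) * PowerSeries.coeff (n - i) (powJets (k - i)) := by
  rw [shiftPowJets, map_sum]
  refine Finset.sum_congr rfl fun i hi => ?_
  rw [Finset.mem_range] at hi
  rw [PowerSeries.coeff_C_mul, PowerSeries.coeff_X_pow_mul', if_pos (by omega)]

lemma coeff_shiftPowJets_zero (k n : ℕ) :
    PowerSeries.coeff n (shiftPowJets 0 k) = PowerSeries.coeff n (powJets k) := by
  rw [shiftPowJets, Finset.sum_eq_single 0]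
  · simp
  · intro i _ hi
    simp [hi]
  · simp

lemma continuousOn_inv_pow {a : ℂ} (r : ℕ) :
    ContinuousOn (fun u : ℂ => 1 / (a + u) ^ (r + 1)) (Metric.ball 0 ‖a‖) := by
  refine ContinuousOn.div continuousOn_const (by fun_prop) fun u hu => pow_ne_zero _ ?_
  rw [mem_ball_zero_iff] at hu
  intro h
  rw [show u = -a by linear_combination h, norm_neg] at hu
  exact lt_irrefl _ hu

/-- The averages of `1 / (a + Y - s w)^{r+1}`. -/
noncomputable def avgInv (a s : ℂ) (r : ℕ) (w : ℂ) : ℂ :=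
  limAvg w fun x => 1 / (a + ((2 + w) * x - 2 - s * w)) ^ (r + 1)

lemma hasJets_avgInv {a : ℂ} (ha : a ≠ 0) (s : ℂ) (r : ℕ) :
    HasJets (avgInv a s r) (avgJets (invPowSeries a r) s) :=
  hasJets_limAvg (hasJets_inv_pow ha r) (norm_pos_iff.2 ha) (continuousOn_inv_pow r) s

/-! ### Functional equations from invariance -/

/-- Apply invariance to 1/(pX - (1+z)). The first branch gives 1/(X-z) = p/(pX - pz), and pz = 2z +
zw explains the shift s = z. The second gives X/(1-zX) = -1/z - (p/z²)/(pX - p/z). -/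
lemma avgInv_functional {z : ℂ} (hz0 : z ≠ 0) (hz1 : z ≠ 1) :
    ∀ᶠ w in 𝓝 0, 2 * avgInv (1 - z) 0 0 w = (2 + w) * avgInv (2 - 2 * z) z 0 w - 1 / z -
      (2 + w) * (1 / z ^ 2 * avgInv (2 - 2 / z) (1 / z) 0 w) := by
  have h1 : 0 < ‖1 - z‖ := norm_pos_iff.2 (sub_ne_zero.2 hz1.symm)
  have h2 : 0 < ‖1 - 1 / z‖ := norm_pos_iff.2 (by
    rw [sub_ne_zero]
    intro h
    apply hz1
    field_simp at h
    exact h)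
  filter_upwards [eventually_norm_le (by norm_num : (0 : ℝ) < 1 / 100),
    eventually_norm_le (show 0 < ‖1 - z‖ / 20 by positivity),
    eventually_norm_le (show 0 < ‖1 - 1 / z‖ / 20 by positivity)] with w hw hw1 hw2
  have hp := two_add_ne_zero hw
  have hx0 : ∀ x ∈ smallDisc w, x ≠ 0 := fun x hx => ne_zero_of_mem_smallDisc hw hx
  have hxz : ∀ x ∈ smallDisc w, x - z ≠ 0 := by
    intro x hx h
    rw [mem_smallDisc, show x - 1 = -(1 - z) by linear_combination h, norm_neg] at hx
    linarith
  have hxz2 : ∀ x ∈ smallDisc w, x - 1 / z ≠ 0 := by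
    intro x hx h
    rw [mem_smallDisc, show x - 1 = -(1 - 1 / z) by linear_combination h, norm_neg] at hx
    linarith
  have hf0 : ∀ x ∈ smallDisc w, (1 - z + ((2 + w) * x - 2 - 0 * w)) ^ (0 + 1) ≠ 0 := by
    intro x hx h
    have h3 := norm_mul_sub_two_le hw hx
    rw [show (2 + w) * x - 2 = -(1 - z) by linear_combination h, norm_neg] at h3
    linarith
  have hc : ContinuousOn (fun x => 1 / (1 - z + ((2 + w) * x - 2 - 0 * w)) ^ (0 + 1))
      (smallDisc w) := continuousOn_const.div (by fun_prop) hf0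
  have e1 : limAvg w (fun x => 1 / (1 - z + ((2 + w) * ((x + 1) / (2 + w)) - 2 - 0 * w)) ^ (0 + 1)) =
      (2 + w) * avgInv (2 - 2 * z) z 0 w := by
    rw [avgInv, ← limAvg_const_mul hw]
    · refine limAvg_congr hw fun x hx => ?_
      have := hxz x hx
      rw [mul_div_cancel₀ _ hp, show 1 - z + (x + 1 - 2 - 0 * w) = x - z by ring,
        show 2 - 2 * z + ((2 + w) * x - 2 - z * w) = (2 + w) * (x - z) by ring]
      field_simp
      ring
    · refine continuousOn_const.div (by fun_prop) fun x hx => pow_ne_zero _ ?_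
      rw [show 2 - 2 * z + ((2 + w) * x - 2 - z * w) = (2 + w) * (x - z) by ring]
      exact mul_ne_zero hp (hxz x hx)
  have hc2 : ContinuousOn (fun x => 1 / (2 - 2 / z + ((2 + w) * x - 2 - 1 / z * w)) ^ (0 + 1))
      (smallDisc w) := by
    refine continuousOn_const.div (by fun_prop) fun x hx => pow_ne_zero _ ?_
    rw [show 2 - 2 / z + ((2 + w) * x - 2 - 1 / z * w) = (2 + w) * (x - 1 / z) by ring]
    exact mul_ne_zero hp (hxz2 x hx)
  have e2 : limAvg w (fun x => 1 / (1 - z + ((2 + w) * ((x⁻¹ + 1) / (2 + w)) - 2 - 0 * w)) ^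
      (0 + 1)) = -1 / z + (-(2 + w) / z ^ 2) * avgInv (2 - 2 / z) (1 / z) 0 w := by
    have hc3 : ContinuousOn (fun x => -(2 + w) / z ^ 2 *
        (1 / (2 - 2 / z + ((2 + w) * x - 2 - 1 / z * w)) ^ (0 + 1))) (smallDisc w) :=
      continuousOn_const.mul hc2
    have hadd := limAvg_add hw (continuousOn_const (c := -1 / z)) hc3
    rw [limAvg_const hw, limAvg_const_mul hw _ hc2] at hadd
    rw [avgInv, ← hadd]
    refine limAvg_congr hw fun x hx => ?_
    have h3 := hxz2 x hx
    have h4 := hx0 x hx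
    have h5 : x * z - 1 ≠ 0 := by
      intro h
      apply h3
      field_simp
      linear_combination h
    have h6 : 1 - x * z ≠ 0 := by
      intro h
      apply h5
      linear_combination -h
    rw [mul_div_cancel₀ _ hp,
      show 1 - z + (x⁻¹ + 1 - 2 - 0 * w) = (1 - x * z) / x by field_simp; ring,
      show 2 - 2 / z + ((2 + w) * x - 2 - 1 / z * w) = (2 + w) * ((x * z - 1) / z) by
        field_simp; ring]
    simp only [zero_add, pow_one]
    rw [show x * z - 1 = -(1 - x * z) by ring]
    field_simp
    ring
  have h := limAvg_eq_branches hw hc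
  rw [e1, e2] at h
  rw [avgInv, h]
  ring

/-- The functional equation of the generating function, as an identity of Taylor series. -/
lemma avgJets_functional {z : ℂ} (hz0 : z ≠ 0) (hz1 : z ≠ 1) :
    2 * avgJets (invPowSeries (1 - z) 0) 0 =
      (2 + PowerSeries.X) * avgJets (invPowSeries (2 - 2 * z) 0) z - PowerSeries.C (1 / z) -
      (2 + PowerSeries.X) *
        (PowerSeries.C (1 / z ^ 2) * avgJets (invPowSeries (2 - 2 / z) 0) (1 / z)) := by
  have ha1 : 1 - z ≠ 0 := sub_ne_zero.2 hz1.symm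
  have ha2 : 2 - 2 * z ≠ 0 := by
    rw [show 2 - 2 * z = 2 * (1 - z) by ring]
    exact mul_ne_zero two_ne_zero ha1
  have ha3 : 2 - 2 / z ≠ 0 := by
    rw [show 2 - 2 / z = -(2 * (1 - z) / z) by field_simp; ring]
    exact neg_ne_zero.2 (div_ne_zero (mul_ne_zero two_ne_zero ha1) hz0)
  have h2 : HasJets (fun _ => (2 : ℂ)) 2 := hasJets_const 2
  have hp : HasJets (fun w => 2 + w) (2 + PowerSeries.X) := h2.add hasJets_id
  have hl := h2.mul (hasJets_avgInv ha1 0 0)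
  have hr := ((hp.mul (hasJets_avgInv ha2 z 0)).sub (hasJets_const (1 / z))).sub
    (hp.mul ((hasJets_const (1 / z ^ 2)).mul (hasJets_avgInv ha3 (1 / z) 0)))
  exact (hl.congr (avgInv_functional hz0 hz1)).unique hr

/-- The branches act on Y = pX - 2 by Y ↦ (Y-w)/p and Y ↦ -(Y-w)/(Y+2). Invariance is applied to
Y^{j+1}, and (Y-w)^{j+1} is expanded in the second term. -/
lemma avgPow_functional (j : ℕ) : ∀ᶠ w in 𝓝 0,
    2 * ((2 + w) ^ (j + 1) * avgPow (j + 1) w) = avgShiftPow 1 (j + 1) w +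
      (-1) ^ (j + 1) * ((2 + w) ^ (j + 1) * ∑ i ∈ Finset.range (j + 2),
        (((j + 1).choose i : ℂ) * (-1) ^ (j + 1 - i)) * (w ^ (j + 1 - i) *
          limAvg w fun x => ((2 + w) * x - 2 - 0 * w) ^ i *
            (1 / (2 + ((2 + w) * x - 2 - 0 * w)) ^ (j + 1)))) := by
  filter_upwards [eventually_norm_le (by norm_num : (0 : ℝ) < 1 / 100)] with w hw
  have hp := two_add_ne_zero hw
  have hx0 : ∀ x ∈ smallDisc w, x ≠ 0 := fun x hx => ne_zero_of_mem_smallDisc hw hx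
  have h := limAvg_eq_branches (f := fun x => ((2 + w) * x - 2) ^ (j + 1)) hw (by fun_prop)
  have e1 : limAvg w (fun x => ((2 + w) * ((x + 1) / (2 + w)) - 2) ^ (j + 1)) =
      (1 / (2 + w) ^ (j + 1)) * avgShiftPow 1 (j + 1) w := by
    rw [avgShiftPow, ← limAvg_const_mul hw _ (by fun_prop)]
    refine limAvg_congr hw fun x _ => ?_
    rw [mul_div_cancel₀ _ hp, show (2 + w) * x - 2 - 1 * w = (2 + w) * (x + 1 - 2) by ring, mul_pow]
    field_simp
  have hc : ∀ i, ContinuousOn (fun x => ((2 + w) * x - 2 - 0 * w) ^ i *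
      (1 / (2 + ((2 + w) * x - 2 - 0 * w)) ^ (j + 1))) (smallDisc w) := by
    intro i
    refine ContinuousOn.mul (by fun_prop) (continuousOn_const.div (by fun_prop) fun x hx =>
      pow_ne_zero _ ?_)
    rw [show 2 + ((2 + w) * x - 2 - 0 * w) = (2 + w) * x by ring]
    exact mul_ne_zero hp (hx0 x hx)
  have hc' : ∀ (c : ℂ) (i : ℕ), ContinuousOn (fun x => c * (((2 + w) * x - 2 - 0 * w) ^ i *
      (1 / (2 + ((2 + w) * x - 2 - 0 * w)) ^ (j + 1)))) (smallDisc w) := fun c i =>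
    continuousOn_const.mul (hc i)
  have e2 : limAvg w (fun x => ((2 + w) * ((x⁻¹ + 1) / (2 + w)) - 2) ^ (j + 1)) =
      (-1) ^ (j + 1) * ∑ i ∈ Finset.range (j + 2),
        (((j + 1).choose i : ℂ) * (-1) ^ (j + 1 - i)) * (w ^ (j + 1 - i) *
          limAvg w fun x => ((2 + w) * x - 2 - 0 * w) ^ i *
            (1 / (2 + ((2 + w) * x - 2 - 0 * w)) ^ (j + 1))) := by
    have e3 : ∑ i ∈ Finset.range (j + 2),
        (((j + 1).choose i : ℂ) * (-1) ^ (j + 1 - i)) * (w ^ (j + 1 - i) *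
          limAvg w fun x => ((2 + w) * x - 2 - 0 * w) ^ i *
            (1 / (2 + ((2 + w) * x - 2 - 0 * w)) ^ (j + 1))) =
        limAvg w fun x => ∑ i ∈ Finset.range (j + 2),
          (((j + 1).choose i : ℂ) * (-1) ^ (j + 1 - i) * w ^ (j + 1 - i)) *
          (((2 + w) * x - 2 - 0 * w) ^ i * (1 / (2 + ((2 + w) * x - 2 - 0 * w)) ^ (j + 1))) := by
      rw [limAvg_sum hw _ fun i _ => hc' _ i]
      refine Finset.sum_congr rfl fun i _ => ?_
      rw [limAvg_const_mul hw _ (hc i)]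
      ring
    rw [e3, ← limAvg_const_mul hw _ (continuousOn_finsetSum _ fun i _ => hc' _ i)]
    refine limAvg_congr hw fun x hx => ?_
    have h4 := hx0 x hx
    have e5 : ∑ i ∈ Finset.range (j + 2),
          (((j + 1).choose i : ℂ) * (-1) ^ (j + 1 - i) * w ^ (j + 1 - i)) *
          (((2 + w) * x - 2 - 0 * w) ^ i * (1 / (2 + ((2 + w) * x - 2 - 0 * w)) ^ (j + 1))) =
        (((2 + w) * x - 2) + -w) ^ (j + 1) * (1 / ((2 + w) * x) ^ (j + 1)) := by
      rw [add_pow ((2 + w) * x - 2) (-w), Finset.sum_mul]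
      refine Finset.sum_congr rfl fun i _ => ?_
      rw [neg_pow w, show 2 + ((2 + w) * x - 2 - 0 * w) = (2 + w) * x by ring, zero_mul, sub_zero]
      ring
    rw [e5, mul_div_cancel₀ _ hp, show (2 + w) * x - 2 + -w = (2 + w) * (-(1 - x)) by ring, mul_pow,
      mul_pow, neg_pow (1 - x), show x⁻¹ + 1 - 2 = (1 - x) / x by field_simp; ring, div_pow]
    have : ((-1 : ℂ) ^ (j + 1)) * (-1) ^ (j + 1) = 1 := by
      rw [← mul_pow]; norm_num
    field_simp
    linear_combination (-(1 - x) ^ (j + 1)) * this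
  rw [e1, e2] at h
  rw [avgPow, h]
  field_simp

/-- The Taylor series of `u ^ i / (2 + u) ^ (j + 1)`. -/
noncomputable def mobiusSeries (i j : ℕ) : PowerSeries ℂ := PowerSeries.X ^ i * invPowSeries 2 j

lemma powJets_functional (j : ℕ) :
    2 * ((2 + PowerSeries.X) ^ (j + 1) * powJets (j + 1)) = shiftPowJets 1 (j + 1) +
      PowerSeries.C ((-1) ^ (j + 1)) * ((2 + PowerSeries.X) ^ (j + 1) *
        ∑ i ∈ Finset.range (j + 2), PowerSeries.C (((j + 1).choose i : ℂ) * (-1) ^ (j + 1 - i)) *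
          (PowerSeries.X ^ (j + 1 - i) * avgJets (mobiusSeries i j) 0)) := by
  have h2 : HasJets (fun _ => (2 : ℂ)) 2 := hasJets_const 2
  have hp : HasJets (fun w => 2 + w) (2 + PowerSeries.X) := h2.add hasJets_id
  have hg : ∀ i, HasJets (fun w => limAvg w fun x => ((2 + w) * x - 2 - 0 * w) ^ i *
      (1 / (2 + ((2 + w) * x - 2 - 0 * w)) ^ (j + 1))) (avgJets (mobiusSeries i j) 0) := fun i =>
    hasJets_limAvg (g := fun u => u ^ i * (1 / (2 + u) ^ (j + 1)))
      ((hasJets_id.pow i).mul (hasJets_inv_pow two_ne_zero j)) (r := ‖(2 : ℂ)‖) (by norm_num)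
      (ContinuousOn.mul (by fun_prop) (continuousOn_inv_pow j)) 0
  have hl := h2.mul ((hp.pow (j + 1)).mul (hasJets_avgPow (j + 1)))
  have hr := (hasJets_avgShiftPow 1 (j + 1)).add ((hasJets_const ((-1) ^ (j + 1))).mul
    ((hp.pow (j + 1)).mul (HasJets.sum (Finset.range (j + 2)) fun i _ =>
      (hasJets_const (((j + 1).choose i : ℂ) * (-1) ^ (j + 1 - i))).mul
        ((hasJets_id.pow (j + 1 - i)).mul (hg i)))))
  exact (hl.congr (avgPow_functional j)).unique hr

/-! ### Rationality of the Taylor coefficients -/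

/-- The subfield of rational numbers in `ℂ`. -/
noncomputable abbrev ratSubfield : Subfield ℂ := (algebraMap ℚ ℂ).fieldRange

lemma coeff_mul_sub_mem {P F : PowerSeries ℂ} {n : ℕ}
    (hP : ∀ m, PowerSeries.coeff m P ∈ ratSubfield)
    (hF : ∀ m < n, PowerSeries.coeff m F ∈ ratSubfield) :
    PowerSeries.coeff n (P * F) - PowerSeries.coeff 0 P * PowerSeries.coeff n F ∈ ratSubfield := by
  rw [PowerSeries.coeff_mul, ← Finset.add_sum_erase _ _
    (Finset.HasAntidiagonal.mem_antidiagonal.2 (zero_add n) : (0, n) ∈ _), add_sub_cancel_left]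
  refine sum_mem fun x hx => ?_
  obtain ⟨hx1, hx2⟩ := Finset.mem_erase.1 hx
  have hx3 := Finset.HasAntidiagonal.mem_antidiagonal.1 hx2
  refine mul_mem (hP _) (hF _ ?_)
  by_contra hlt
  apply hx1
  ext <;> simp <;> omega

lemma coeff_two_add_X_pow_mem (j m : ℕ) :
    PowerSeries.coeff m ((2 + PowerSeries.X : PowerSeries ℂ) ^ j) ∈ ratSubfield := by
  have : (2 + PowerSeries.X : PowerSeries ℂ) ^ j =
      PowerSeries.map (algebraMap ℚ ℂ) ((2 + PowerSeries.X) ^ j) := by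
    rw [map_pow, map_add, map_ofNat, PowerSeries.map_X]
  rw [this, PowerSeries.coeff_map]
  exact ⟨_, rfl⟩

lemma coeff_zero_two_add_X_pow (j : ℕ) :
    PowerSeries.coeff 0 ((2 + PowerSeries.X : PowerSeries ℂ) ^ j) = 2 ^ j := by
  simp [map_ofNat]

lemma coeff_mobiusSeries (i j k : ℕ) : PowerSeries.coeff k (mobiusSeries i j) =
    if i ≤ k then (-1) ^ (k - i) * ((k - i + j).choose j : ℂ) / 2 ^ (k - i + j + 1) else 0 := by
  rw [mobiusSeries, PowerSeries.coeff_X_pow_mul']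
  simp only [invPowSeries, PowerSeries.coeff_mk]

lemma coeff_mobiusSeries_mem (i j k : ℕ) :
    PowerSeries.coeff k (mobiusSeries i j) ∈ ratSubfield := by
  rw [coeff_mobiusSeries]
  split_ifs
  · exact div_mem (mul_mem (pow_mem (neg_mem (one_mem _)) _) (natCast_mem _ _))
      (pow_mem (ofNat_mem _ 2) _)
  · exact zero_mem _

lemma coeff_avgJets (G : PowerSeries ℂ) (n : ℕ) : PowerSeries.coeff n (avgJets G 0) =
    ∑ k ∈ Finset.range (n + 1), PowerSeries.coeff k G * PowerSeries.coeff n (powJets k) := by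
  rw [avgJets, PowerSeries.coeff_mk]
  simp only [coeff_shiftPowJets_zero]

/-- Compare w^n-coefficients in `powJets_functional` modulo ℚ. All is rational by hypothesis except
multiples of the unknown coefficient x. -/
lemma coeff_powJets_mem_of_lower {n j : ℕ}
    (hn : ∀ m < n, ∀ k, PowerSeries.coeff m (powJets k) ∈ ratSubfield)
    (hj : ∀ k, j + 1 < k → PowerSeries.coeff n (powJets k) ∈ ratSubfield) :
    PowerSeries.coeff n (powJets (j + 1)) ∈ ratSubfield := by
  rcases Nat.lt_or_ge n (j + 1) with hnj | hnj
  · rw [coeff_powJets_of_lt hnj]; exact zero_mem _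
  have hav : ∀ i m, m < n → PowerSeries.coeff m (avgJets (mobiusSeries i j) 0) ∈ ratSubfield := by
    intro i m hm
    rw [coeff_avgJets]
    exact sum_mem fun k _ => mul_mem (coeff_mobiusSeries_mem i j k) (hn m hm k)
  have hneg : (-1 : ℂ) ∈ ratSubfield := neg_mem (one_mem _)
  obtain ⟨x, hx⟩ : ∃ x, x = PowerSeries.coeff n (powJets (j + 1)) := ⟨_, rfl⟩
  have t1 : PowerSeries.coeff n ((2 + PowerSeries.X) ^ (j + 1) * powJets (j + 1)) -
      2 ^ (j + 1) * x ∈ ratSubfield := by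
    have := coeff_mul_sub_mem (coeff_two_add_X_pow_mem (j + 1)) fun m hm => hn m hm (j + 1)
    rwa [coeff_zero_two_add_X_pow, ← hx] at this
  have t2 : PowerSeries.coeff n (shiftPowJets 1 (j + 1)) - x ∈ ratSubfield := by
    rw [coeff_shiftPowJets hnj, Finset.sum_range_succ']
    simp only [Nat.choose_zero_right, Nat.cast_one, pow_zero, mul_one, one_mul, Nat.sub_zero]
    rw [← hx, add_sub_cancel_right]
    exact sum_mem fun i _ => mul_mem (mul_mem (natCast_mem _ _) (pow_mem hneg _))
      (hn _ (by omega) _)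
  have t3 : PowerSeries.coeff n (avgJets (mobiusSeries (j + 1) j) 0) - 1 / 2 ^ (j + 1) * x ∈
      ratSubfield := by
    rw [coeff_avgJets, ← Finset.add_sum_erase _ _ (Finset.mem_range.2 (by omega) :
      j + 1 ∈ Finset.range (n + 1)), ← hx]
    have e : PowerSeries.coeff (j + 1) (mobiusSeries (j + 1) j) = 1 / 2 ^ (j + 1) := by
      rw [coeff_mobiusSeries, if_pos le_rfl]; simp
    rw [e, add_sub_cancel_left]
    refine sum_mem fun k hk => ?_
    have hk1 := Finset.ne_of_mem_erase hk
    rcases Nat.lt_or_ge k (j + 1) with hkj | hkj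
    · rw [coeff_mobiusSeries, if_neg (by omega), zero_mul]; exact zero_mem _
    · exact mul_mem (coeff_mobiusSeries_mem _ _ _) (hj k (by omega))
  have hA : ∀ m ≤ n, ∀ i < j + 1, PowerSeries.coeff m
      (PowerSeries.C (((j + 1).choose i : ℂ) * (-1) ^ (j + 1 - i)) *
          (PowerSeries.X ^ (j + 1 - i) * avgJets (mobiusSeries i j) 0)) ∈ ratSubfield := by
    intro m hm i hi
    rw [PowerSeries.coeff_C_mul, PowerSeries.coeff_X_pow_mul']
    refine mul_mem (mul_mem (natCast_mem _ _) (pow_mem hneg _)) ?_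
    split_ifs with h
    · exact hav i _ (by omega)
    · exact zero_mem _
  have t4 : PowerSeries.coeff n ((2 + PowerSeries.X) ^ (j + 1) *
        ∑ i ∈ Finset.range (j + 2), PowerSeries.C (((j + 1).choose i : ℂ) * (-1) ^ (j + 1 - i)) *
          (PowerSeries.X ^ (j + 1 - i) * avgJets (mobiusSeries i j) 0)) - x ∈ ratSubfield := by
    have hlow : ∀ m < n, PowerSeries.coeff m (∑ i ∈ Finset.range (j + 2),
        PowerSeries.C (((j + 1).choose i : ℂ) * (-1) ^ (j + 1 - i)) *
          (PowerSeries.X ^ (j + 1 - i) * avgJets (mobiusSeries i j) 0)) ∈ ratSubfield := by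
      intro m hm
      rw [map_sum, Finset.sum_range_succ]
      refine add_mem (sum_mem fun i hi => hA m hm.le i (Finset.mem_range.1 hi)) ?_
      simp only [Nat.choose_self, Nat.cast_one, Nat.sub_self, pow_zero, mul_one, one_mul, map_one]
      exact hav _ m hm
    have h1 := coeff_mul_sub_mem (coeff_two_add_X_pow_mem (j + 1)) hlow
    rw [coeff_zero_two_add_X_pow] at h1
    have h2 : PowerSeries.coeff n (∑ i ∈ Finset.range (j + 2),
        PowerSeries.C (((j + 1).choose i : ℂ) * (-1) ^ (j + 1 - i)) *
          (PowerSeries.X ^ (j + 1 - i) * avgJets (mobiusSeries i j) 0)) - 1 / 2 ^ (j + 1) * x ∈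
          ratSubfield := by
      rw [map_sum, Finset.sum_range_succ, add_sub_assoc]
      refine add_mem (sum_mem fun i hi => hA n le_rfl i (Finset.mem_range.1 hi)) ?_
      simp only [Nat.choose_self, Nat.cast_one, Nat.sub_self, pow_zero, mul_one, one_mul, map_one]
      exact t3
    have h3 := add_mem h1 (mul_mem (pow_mem (ofNat_mem ratSubfield 2) (j + 1)) h2)
    convert h3 using 1
    have : (2 : ℂ) ^ (j + 1) * (1 / 2 ^ (j + 1)) = 1 := by field_simp
    linear_combination x * this
  have h := congrArg (PowerSeries.coeff n) (powJets_functional j)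
  rw [two_mul, map_add, map_add, PowerSeries.coeff_C_mul] at h
  -- The left side contributes 2 · 2^{j+1} x, the two branch terms x and (-1)^{j+1} x.
  have hfin : (2 ^ (j + 2) - 1 - (-1) ^ (j + 1)) * x ∈ ratSubfield := by
    have h5 := sub_mem (add_mem t2 (mul_mem (pow_mem hneg (j + 1)) t4))
      (mul_mem (ofNat_mem ratSubfield 2) t1)
    convert h5 using 1
    linear_combination h
  obtain ⟨c, hc0, hc⟩ : ∃ c : ℤ, c ≠ 0 ∧ ((2 : ℂ) ^ (j + 2) - 1 - (-1) ^ (j + 1)) = c := by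
    refine ⟨2 ^ (j + 2) - 1 - (-1) ^ (j + 1), ?_, by push_cast; ring⟩
    have : (4 : ℤ) ≤ 2 ^ (j + 2) := by
      rw [pow_add]
      have : (1 : ℤ) ≤ 2 ^ j := one_le_pow₀ (by norm_num)
      linarith
    rcases neg_one_pow_eq_or ℤ (j + 1) with h | h <;> rw [h] <;> omega
  rw [hc] at hfin
  have hc0' : (c : ℂ) ≠ 0 := by exact_mod_cast hc0
  have := mul_mem (inv_mem (intCast_mem ratSubfield c)) hfin
  rwa [inv_mul_cancel_left₀ hc0', hx] at this

/-- Induction on n and, for fixed n, downward in j from j > n, where the coefficient vanishes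
because the average of Y^j is O(w^j). -/
lemma coeff_powJets_mem (n : ℕ) : ∀ j, PowerSeries.coeff n (powJets j) ∈ ratSubfield := by
  induction n using Nat.strong_induction_on with
  | _ n ih =>
    have key : ∀ d j, n < j + d → PowerSeries.coeff n (powJets j) ∈ ratSubfield := by
      intro d
      induction d with
      | zero =>
        intro j hj
        rw [coeff_powJets_of_lt (by simpa using hj)]
        exact zero_mem _
      | succ d ihd =>
        intro j hj
        rcases j with _ | j
        · rw [powJets_zero, PowerSeries.coeff_one]
          split_ifs
          · exact one_mem _
          · exact zero_mem _
        · exact coeff_powJets_mem_of_lower ih fun k hk => ihd k (by omega)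
    exact fun j => key (n + 1) j (by omega)

/-- The Taylor coefficients of the averages of `Y^j`, as rational numbers. -/
noncomputable def powCoeff (j n : ℕ) : ℚ := (coeff_powJets_mem n j).choose

lemma coeff_powJets (j n : ℕ) : PowerSeries.coeff n (powJets j) = (powCoeff j n : ℂ) :=
  (coeff_powJets_mem n j).choose_spec.symm

/-! ### The rational functions H_n and their recurrence -/

lemma hasDerivAt_inv_sub_pow {z : ℂ} (hz : z ≠ 2) (k : ℕ) :
    HasDerivAt (fun z : ℂ => 1 / (z - 2) ^ (k + 1)) (-(k + 1) / (z - 2) ^ (k + 2)) z := by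
  have h0 : z - 2 ≠ 0 := sub_ne_zero.2 hz
  have h1 : HasDerivAt (fun z : ℂ => (z - 2) ^ (k + 1)) ((k + 1 : ℕ) * (z - 2) ^ k) z := by
    simpa using ((hasDerivAt_id z).sub_const 2).fun_pow (k + 1)
  have h2 := h1.fun_inv (pow_ne_zero _ h0)
  simp only [one_div]
  refine h2.congr_deriv ?_
  push_cast
  field_simp
  ring

lemma iteratedDeriv_of_eq_sum {f : ℂ → ℂ} {N : ℕ} {c : ℕ → ℂ}
    (hf : ∀ z, z ≠ 2 → f z = ∑ j ∈ Finset.range N, c j * (1 / (z - 2) ^ (j + 1))) (i : ℕ) :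
    ∀ z, z ≠ 2 → iteratedDeriv i f z = ∑ j ∈ Finset.range N,
      c j * ((-1) ^ i * (i ! * (j + i).choose i : ℕ)) * (1 / (z - 2) ^ (j + i + 1)) := by
  induction i with
  | zero =>
    intro z hz
    simpa using hf z hz
  | succ i ih =>
    intro z hz
    rw [iteratedDeriv_succ]
    have he : iteratedDeriv i f =ᶠ[𝓝 z] fun z => ∑ j ∈ Finset.range N,
        c j * ((-1) ^ i * (i ! * (j + i).choose i : ℕ)) * (1 / (z - 2) ^ (j + i + 1)) := by
      filter_upwards [isOpen_ne.mem_nhds hz] with y hy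
      exact ih y hy
    rw [he.deriv_eq]
    have hd := HasDerivAt.fun_sum (u := Finset.range N) fun j _ =>
      (hasDerivAt_inv_sub_pow hz (j + i)).const_mul
        (c j * ((-1) ^ i * (i ! * (j + i).choose i : ℕ)))
    rw [hd.deriv]
    refine Finset.sum_congr rfl fun j _ => ?_
    have e : (i + 1)! * (j + (i + 1)).choose (i + 1) = (j + i + 1) * (i ! * (j + i).choose i) := by
      have := Nat.add_one_mul_choose_eq (j + i) i
      rw [Nat.factorial_succ, ← add_assoc]
      linear_combination i ! * (-this)
    rw [e]
    push_cast
    rw [show j + (i + 1) + 1 = j + i + 2 by ring]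
    ring

/-- The numerators `B_n`. -/
noncomputable def numerator (n : ℕ) : ℚ[X] :=
  -∑ j ∈ Finset.range (n + 1),
    Polynomial.C (powCoeff j n) * (Polynomial.X - Polynomial.C 2) ^ (n - j)

lemma powCoeff_zero (n : ℕ) : powCoeff 0 n = if n = 0 then 1 else 0 := by
  have h := coeff_powJets 0 n
  rw [powJets_zero, PowerSeries.coeff_one] at h
  split_ifs at h ⊢ <;> exact_mod_cast h.symm

lemma numerator_zero : numerator 0 = -1 := by
  simp [numerator, powCoeff_zero]

lemma degree_numerator_lt {n : ℕ} (hn : 1 ≤ n) : (numerator n).degree < n := by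
  -- The term j = 0 is the only one of degree n; it drops out because the average of Y^0 is the
  -- constant 1.
  rw [numerator, Polynomial.degree_neg, Finset.sum_range_succ', powCoeff_zero,
    if_neg (by omega), map_zero, zero_mul, add_zero]
  refine (Polynomial.degree_sum_le _ _).trans_lt ?_
  rw [Finset.sup_lt_iff (by exact_mod_cast WithBot.bot_lt_coe n)]
  intro j hj
  rw [Finset.mem_range] at hj
  rw [← Polynomial.smul_eq_C_mul]
  refine (Polynomial.degree_smul_le _ _).trans_lt ?_
  refine (Polynomial.degree_pow_le _ _).trans_lt ?_
  rw [Polynomial.degree_X_sub_C, nsmul_one]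
  exact_mod_cast (by omega : n - (j + 1) < n)

lemma ratFun_numerator (n : ℕ) {z : ℂ} (hz : z ≠ 2) : ratFun numerator n z =
    ∑ j ∈ Finset.range (n + 1), -(powCoeff j n : ℂ) * (1 / (z - 2) ^ (j + 1)) := by
  have h0 : z - 2 ≠ 0 := sub_ne_zero.2 hz
  rw [ratFun, numerator, map_neg, map_sum, ← Finset.sum_neg_distrib, Finset.sum_div]
  refine Finset.sum_congr rfl fun j hj => ?_
  rw [Finset.mem_range] at hj
  rw [map_mul, map_pow, map_sub, Polynomial.aeval_X, Polynomial.aeval_C, Polynomial.aeval_C,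
    map_ofNat]
  have e : n + 1 = (n - j) + (j + 1) := by omega
  rw [e, pow_add]
  have e2 : (algebraMap ℚ ℂ) (powCoeff j n) = (powCoeff j n : ℂ) := rfl
  rw [e2]
  field_simp

lemma iteratedDeriv_ratFun_numerator (n i : ℕ) {z : ℂ} (hz : z ≠ 2) :
    iteratedDeriv i (ratFun numerator n) z = ∑ j ∈ Finset.range (n + 1),
      -(powCoeff j n : ℂ) * ((-1) ^ i * (i ! * (j + i).choose i : ℕ)) *
        (1 / (z - 2) ^ (j + i + 1)) :=
  iteratedDeriv_of_eq_sum (fun _ h => ratFun_numerator n h) i z hz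

/-- Formally E_w[1/(pX - ζ - sw)] = Σ H_n(ζ + sw) w^n, and expanding in sw produces the derivatives
in the recurrence. -/
lemma coeff_avgJets_inv {ζ : ℂ} (hζ : ζ ≠ 2) (s : ℂ) (n : ℕ) :
    PowerSeries.coeff n (avgJets (invPowSeries (2 - ζ) 0) s) = ∑ i ∈ Finset.range (n + 1),
      1 / (i ! : ℂ) * iteratedDeriv i (ratFun numerator (n - i)) ζ * s ^ i := by
  have h0 : 2 - ζ ≠ 0 := sub_ne_zero.2 hζ.symm
  have h1 : PowerSeries.coeff n (avgJets (invPowSeries (2 - ζ) 0) s) =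
      ∑ k ∈ Finset.range (n + 1), ∑ i ∈ Finset.range (k + 1),
        (-1) ^ k / (2 - ζ) ^ (k + 1) * (((k.choose i : ℂ) * (-s) ^ i) *
          (powCoeff (k - i) (n - i) : ℂ)) := by
    rw [avgJets, PowerSeries.coeff_mk]
    refine Finset.sum_congr rfl fun k hk => ?_
    rw [Finset.mem_range] at hk
    rw [coeff_shiftPowJets (by omega), Finset.mul_sum]
    refine Finset.sum_congr rfl fun i _ => ?_
    rw [coeff_powJets, invPowSeries, PowerSeries.coeff_mk]
    simp
  rw [h1, Finset.sum_comm' (t' := Finset.range (n + 1)) (s' := fun i => Finset.Ico i (n + 1))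
    (by intro x y; simp only [Finset.mem_range, Finset.mem_Ico]; omega)]
  refine Finset.sum_congr rfl fun i hi => ?_
  rw [Finset.mem_range] at hi
  rw [Finset.sum_Ico_eq_sum_range, iteratedDeriv_ratFun_numerator _ _ hζ, Finset.mul_sum,
    Finset.sum_mul, show n + 1 - i = n - i + 1 by omega]
  refine Finset.sum_congr rfl fun j hj => ?_
  have hf : (i ! : ℂ) ≠ 0 := by exact_mod_cast Nat.factorial_ne_zero i
  have hz : (ζ - 2) ^ (j + i + 1) = (-1) ^ (j + i + 1) * (2 - ζ) ^ (j + i + 1) := by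
    rw [← mul_pow]; congr 1; ring
  rw [hz, add_tsub_cancel_left, add_comm i j, neg_pow s]
  have hm : ((-1 : ℂ) ^ (j + i + 1)) ≠ 0 := pow_ne_zero _ (by norm_num)
  push_cast
  field_simp
  have hm2 : (-1 : ℂ) ^ (j + i + 1) * (-1) ^ (j + i) = -1 := by
    rw [← pow_add, show j + i + 1 + (j + i) = 2 * (j + i) + 1 by ring]
    simp [pow_succ, pow_mul]
  linear_combination (s ^ i * (powCoeff j (n - i) : ℂ) * ((j + i).choose i : ℂ)) * hm2

/-- At ζ = 0, differentiating 1/(pX - ζ) r times gives r! (pX)^{-(r+1)}. -/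
lemma coeff_avgJets_inv_two (r n : ℕ) :
    PowerSeries.coeff n (avgJets (invPowSeries 2 r) 0) =
      1 / (r ! : ℂ) * iteratedDeriv r (ratFun numerator n) 0 := by
  rw [coeff_avgJets, iteratedDeriv_ratFun_numerator _ _ two_ne_zero.symm, Finset.mul_sum]
  refine Finset.sum_congr rfl fun j _ => ?_
  have hf : (r ! : ℂ) ≠ 0 := by exact_mod_cast Nat.factorial_ne_zero r
  rw [coeff_powJets, invPowSeries, PowerSeries.coeff_mk, zero_sub, neg_pow (2 : ℂ)]
  have hm : ((-1 : ℂ) ^ (j + r + 1)) ≠ 0 := pow_ne_zero _ (by norm_num)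
  push_cast
  field_simp
  rw [pow_succ, pow_add]
  have : (-1 : ℂ) ^ j * (-1) ^ j = 1 := by rw [← mul_pow]; norm_num
  linear_combination (-((-1) ^ r * (powCoeff j n : ℂ) * ((j + r).choose r : ℂ))) * this

/-- In the w^n-coefficient of `avgJets_functional`, the factor p = 2 + w splits: 2 yields the sums
over H_{n-j}, w those over H_{n-j-1}. The constant 1/z matters only for n = 0. -/
lemma isNumeratorSeq_numerator : IsNumeratorSeq numerator where
  zero := numerator_zero
  degree_lt _ hn := degree_numerator_lt hn
  recurrence n hn z hz0 hz1 := by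
    have hz1' : 1 + z ≠ 2 := by
      intro h; apply hz1; linear_combination h
    have hz2 : 2 * z ≠ 2 := by
      intro h; apply hz1; linear_combination h / 2
    have hz3 : 2 / z ≠ 2 := by
      intro h
      rw [div_eq_iff hz0] at h
      apply hz1; linear_combination -h / 2
    have hfun := avgJets_functional hz0 hz1
    rw [show 1 - z = 2 - (1 + z) by ring] at hfun
    obtain ⟨m, rfl⟩ := Nat.exists_eq_add_of_le' hn
    have h := congrArg (PowerSeries.coeff (m + 1)) hfun
    have k1 : ∀ F : PowerSeries ℂ, 2 * F = F + F := two_mul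
    have k2 : ∀ F : PowerSeries ℂ, (2 + PowerSeries.X) * F = F + F + PowerSeries.X * F :=
      fun F => by ring
    simp only [k1, k2, map_sub, map_add, PowerSeries.coeff_succ_X_mul, PowerSeries.coeff_C_mul,
      PowerSeries.coeff_succ_C, sub_zero] at h
    rw [coeff_avgJets_inv hz1', coeff_avgJets_inv hz2, coeff_avgJets_inv hz2,
      coeff_avgJets_inv hz3, coeff_avgJets_inv hz3] at h
    have e0 : ∑ i ∈ Finset.range (m + 1 + 1), 1 / (i ! : ℂ) *
        iteratedDeriv i (ratFun numerator (m + 1 - i)) (1 + z) * 0 ^ i =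
        ratFun numerator (m + 1) (1 + z) := by
      rw [Finset.sum_eq_single 0]
      · simp
      · intro i _ hi
        rw [zero_pow hi, mul_zero]
      · simp
    have e1 : ∀ ζ s : ℂ, ∑ i ∈ Finset.range (m + 1 + 1), 1 / (i ! : ℂ) *
        iteratedDeriv i (ratFun numerator (m + 1 - i)) ζ * s ^ i =
        ratFun numerator (m + 1) ζ + ∑ i ∈ Finset.Icc 1 (m + 1), 1 / (i ! : ℂ) *
        iteratedDeriv i (ratFun numerator (m + 1 - i)) ζ * s ^ i := by
      intro ζ s
      rw [Finset.sum_range_eq_add_Ico _ (by omega)]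
      congr 1
      simp
    rw [e0, e1, e1] at h
    have f1 : ∀ ζ : ℂ, ∑ j ∈ Finset.Icc 1 (m + 1),
        2 / (j ! : ℂ) * iteratedDeriv j (ratFun numerator (m + 1 - j)) ζ * z ^ j =
        2 * ∑ i ∈ Finset.Icc 1 (m + 1), 1 / (i ! : ℂ) *
        iteratedDeriv i (ratFun numerator (m + 1 - i)) ζ * z ^ i := by
      intro ζ
      rw [Finset.mul_sum]
      exact Finset.sum_congr rfl fun i _ => by ring
    have f2 : ∀ ζ : ℂ, ∑ j ∈ Finset.Icc 1 (m + 1),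
        2 / (j ! : ℂ) * iteratedDeriv j (ratFun numerator (m + 1 - j)) ζ * (1 / z ^ (j + 2)) =
        2 * (1 / z ^ 2 * ∑ i ∈ Finset.Icc 1 (m + 1), 1 / (i ! : ℂ) *
        iteratedDeriv i (ratFun numerator (m + 1 - i)) ζ * (1 / z) ^ i) := by
      intro ζ
      rw [Finset.mul_sum, Finset.mul_sum]
      exact Finset.sum_congr rfl fun i _ => by
        rw [pow_add, one_div_pow]; field_simp
    have f3 : ∀ ζ : ℂ, ∑ j ∈ Finset.range (m + 1),
        1 / (j ! : ℂ) * iteratedDeriv j (ratFun numerator (m + 1 - j - 1)) ζ * z ^ j =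
        ∑ i ∈ Finset.range (m + 1), 1 / (i ! : ℂ) *
        iteratedDeriv i (ratFun numerator (m - i)) ζ * z ^ i := by
      intro ζ
      exact Finset.sum_congr rfl fun i _ => by rw [show m + 1 - i - 1 = m - i by omega]
    have f4 : ∀ ζ : ℂ, ∑ j ∈ Finset.range (m + 1),
        1 / (j ! : ℂ) * iteratedDeriv j (ratFun numerator (m + 1 - j - 1)) ζ *
          (1 / z ^ (j + 2)) =
        1 / z ^ 2 * ∑ i ∈ Finset.range (m + 1), 1 / (i ! : ℂ) *
        iteratedDeriv i (ratFun numerator (m - i)) ζ * (1 / z) ^ i := by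
      intro ζ
      rw [Finset.mul_sum]
      exact Finset.sum_congr rfl fun i _ => by
        rw [show m + 1 - i - 1 = m - i by omega, pow_add, one_div_pow]; field_simp
    rw [f1, f2, f3, f4, add_comm z 1]
    linear_combination -h

/-! ### Uniqueness of the numerators -/

lemma ratFun_congr {B B' : ℕ → ℚ[X]} {n : ℕ} (h : B n = B' n) : ratFun B n = ratFun B' n := by
  funext z
  rw [ratFun, ratFun, h]

/-- For k = 1 the expression is 1 - 1/2 - 1/2 = 0: a simple pole would solve the homogeneous
equation to leading order, and the degree bound excludes it. -/
lemma sum_pole_ne_zero {k : ℕ} (hk : 2 ≤ k) : (1 : ℂ) - 1 / 2 ^ k + (-1) ^ k / 2 ^ k ≠ 0 := by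
  have h2 : (2 : ℂ) ^ k ≠ 0 := pow_ne_zero _ two_ne_zero
  have hne : (2 ^ k - 1 + (-1) ^ k : ℤ) ≠ 0 := by
    have : (4 : ℤ) ≤ 2 ^ k := by
      calc (4 : ℤ) = 2 ^ 2 := by norm_num
        _ ≤ 2 ^ k := pow_le_pow_right₀ (by norm_num) hk
    rcases neg_one_pow_eq_or ℤ k with h | h <;> rw [h] <;> omega
  have hne' : (2 ^ k - 1 + (-1) ^ k : ℂ) ≠ 0 := by exact_mod_cast hne
  intro h
  apply hne'
  field_simp at h
  linear_combination h

/-- A rational function with its only pole at `2`, of order at least `2` unless it vanishes, is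
not a solution of the homogeneous equation. -/
lemma eq_zero_of_homogeneous {D : ℚ[X]} {n : ℕ} (hdeg : D.degree < n)
    (h : ∀ z : ℂ, z ≠ 0 → z ≠ 1 →
      Polynomial.aeval (z + 1) D / (z + 1 - 2) ^ (n + 1) -
        Polynomial.aeval (2 * z) D / (2 * z - 2) ^ (n + 1) +
        Polynomial.aeval (2 / z) D / (2 / z - 2) ^ (n + 1) * (1 / z ^ 2) = 0) : D = 0 := by
  by_contra hD
  obtain ⟨q, hq, hq2⟩ := Polynomial.exists_eq_pow_rootMultiplicity_mul_and_not_dvd D hD 2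
  obtain ⟨a, ha⟩ : ∃ a, a = Polynomial.rootMultiplicity 2 D := ⟨_, rfl⟩
  rw [← ha] at hq
  have hq0 : q ≠ 0 := by
    rintro rfl
    exact hq2 (dvd_zero _)
  have han : a < n := by
    have h1 : (a : WithBot ℕ) ≤ D.degree := by
      rw [hq, Polynomial.degree_mul, Polynomial.degree_pow, Polynomial.degree_X_sub_C, nsmul_one,
        Polynomial.degree_eq_natDegree hq0]
      exact_mod_cast Nat.le_add_right a q.natDegree
    exact_mod_cast h1.trans_lt hdeg
  -- k is the order of the pole at 2 after cancellation; the degree bound makes it at least 2.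
  obtain ⟨k, hk⟩ : ∃ k, n + 1 = a + k := ⟨n + 1 - a, by omega⟩
  have hk2 : 2 ≤ k := by omega
  have hquot : ∀ y : ℂ, y ≠ 2 → Polynomial.aeval y D / (y - 2) ^ (n + 1) =
      Polynomial.aeval y q / (y - 2) ^ k := by
    intro y hy
    have h0 : y - 2 ≠ 0 := sub_ne_zero.2 hy
    rw [hq, map_mul, map_pow, map_sub, Polynomial.aeval_X, Polynomial.aeval_C, map_ofNat, hk,
      pow_add]
    field_simp
  have hcont : ∀ g : ℂ → ℂ, ContinuousAt g 1 →
      ContinuousAt (fun z => Polynomial.aeval (g z) q) 1 := fun g hg =>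
    (Polynomial.continuous_aeval q).continuousAt.comp hg
  have hinv : ContinuousAt (fun z : ℂ => 2 / z) 1 :=
    continuousAt_const.div continuousAt_id one_ne_zero
  have hF : ContinuousAt (fun z : ℂ => Polynomial.aeval (z + 1) q -
      Polynomial.aeval (2 * z) q * (1 / 2 ^ k) +
      Polynomial.aeval (2 / z) q * ((-1) ^ k / 2 ^ k * z ^ k) * (1 / z ^ 2)) 1 := by
    refine ((hcont _ (by fun_prop)).sub ((hcont _ (by fun_prop)).mul continuousAt_const)).add
      (((hcont _ hinv).mul (by fun_prop)).mul ?_)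
    exact continuousAt_const.div (by fun_prop) (by norm_num)
  have hz : ∀ᶠ z : ℂ in 𝓝[≠] 1, Polynomial.aeval (z + 1) q -
      Polynomial.aeval (2 * z) q * (1 / 2 ^ k) +
      Polynomial.aeval (2 / z) q * ((-1) ^ k / 2 ^ k * z ^ k) * (1 / z ^ 2) = 0 := by
    filter_upwards [self_mem_nhdsWithin,
      (isOpen_ne.mem_nhds (one_ne_zero : (1 : ℂ) ≠ 0) : _ ∈ 𝓝 (1 : ℂ)) |> mem_nhdsWithin_of_mem_nhds]
      with z hz1 hz0
    have hz1' : z - 1 ≠ 0 := sub_ne_zero.2 hz1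
    have hz0' : z ≠ 0 := hz0
    have h1 := h z hz0 hz1
    rw [hquot _ (by intro h; apply hz1'; linear_combination h),
      hquot _ (by intro h; apply hz1'; linear_combination h / 2),
      hquot _ (by
        intro h
        rw [div_eq_iff hz0'] at h
        apply hz1'; linear_combination -h / 2),
      show z + 1 - 2 = z - 1 by ring, show 2 * z - 2 = 2 * (z - 1) by ring,
      show 2 / z - 2 = -1 * (2 * (z - 1)) / z by field_simp; ring, div_pow, mul_pow, mul_pow,
      mul_pow] at h1
    have hm : ((-1 : ℂ)) ^ k * (-1) ^ k = 1 := by rw [← mul_pow]; norm_num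
    have hm0 : ((-1 : ℂ)) ^ k ≠ 0 := pow_ne_zero _ (by norm_num)
    have hmi : (-1 : ℂ) ^ k = 1 / (-1) ^ k := by field_simp; rw [sq]; exact hm
    have hzk : (z - 1) ^ k ≠ 0 := pow_ne_zero _ hz1'
    have e : Polynomial.aeval (z + 1) q - Polynomial.aeval (2 * z) q * (1 / 2 ^ k) +
        Polynomial.aeval (2 / z) q * ((-1) ^ k / 2 ^ k * z ^ k) * (1 / z ^ 2) =
        (z - 1) ^ k * (Polynomial.aeval (z + 1) q / (z - 1) ^ k -
        Polynomial.aeval (2 * z) q / (2 ^ k * (z - 1) ^ k) +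
        Polynomial.aeval (2 / z) q / ((-1) ^ k * (2 ^ k * (z - 1) ^ k) / z ^ k) *
          (1 / z ^ 2)) := by
      have e2 : ∀ x : ℂ, x / ((-1) ^ k * (2 ^ k * (z - 1) ^ k) / z ^ k) =
          1 / (-1) ^ k * (x * z ^ k / (2 ^ k * (z - 1) ^ k)) := fun x => by field_simp
      rw [e2, ← hmi]
      field_simp
    rw [e, h1, mul_zero]
  -- The homogeneous equation multiplied by (z-1)^k is continuous at z = 1, where all three
  -- arguments z+1, 2z, 2/z equal 2.
  have hlim := tendsto_nhds_unique ((tendsto_congr' hz).1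
    (hF.tendsto.mono_left nhdsWithin_le_nhds)) tendsto_const_nhds
  rw [show (1 : ℂ) + 1 = 2 by norm_num, mul_one, div_one, one_pow, one_pow, mul_one, div_one,
    mul_one] at hlim
  have hq2' : Polynomial.aeval (2 : ℂ) q ≠ 0 := by
    intro h0
    apply hq2
    rw [Polynomial.dvd_iff_isRoot, Polynomial.IsRoot]
    have h1 : Polynomial.aeval ((algebraMap ℚ ℂ) 2) q = 0 := by rwa [map_ofNat]
    rw [Polynomial.aeval_algebraMap_apply] at h1
    simpa using h1
  apply mul_ne_zero hq2' (sum_pole_ne_zero hk2)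
  linear_combination hlim

lemma IsNumeratorSeq.unique {B B' : ℕ → ℚ[X]} (hB : IsNumeratorSeq B) (hB' : IsNumeratorSeq B') :
    B = B' := by
  funext n
  induction n using Nat.strong_induction_on with
  | _ n ih =>
    rcases Nat.eq_zero_or_pos n with rfl | hn
    · rw [hB.zero, hB'.zero]
    rw [← sub_eq_zero]
    refine eq_zero_of_homogeneous ((Polynomial.degree_sub_le _ _).trans_lt
      (max_lt (hB.degree_lt n hn) (hB'.degree_lt n hn))) fun z hz0 hz1 => ?_
    have h1 := hB.recurrence n hn z hz0 hz1
    have h2 := hB'.recurrence n hn z hz0 hz1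
    have e1 : ∀ j ∈ Finset.Icc 1 n, ratFun B (n - j) = ratFun B' (n - j) := fun j hj => by
      rw [Finset.mem_Icc] at hj
      exact ratFun_congr (ih _ (by omega))
    have e2 : ∀ j ∈ Finset.range n, ratFun B (n - j - 1) = ratFun B' (n - j - 1) := fun j hj => by
      rw [Finset.mem_range] at hj
      exact ratFun_congr (ih _ (by omega))
    rw [Finset.sum_congr rfl fun j hj => by rw [e1 j hj],
      Finset.sum_congr (s₁ := Finset.range n) rfl fun j hj => by rw [e2 j hj],
      Finset.sum_congr (s₁ := Finset.Icc 1 n)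
        (f := fun j => 2 / (j ! : ℂ) * iteratedDeriv j (ratFun B (n - j)) (2 / z) *
          (1 / z ^ (j + 2))) rfl fun j hj => by rw [e1 j hj],
      Finset.sum_congr (s₁ := Finset.range n)
        (f := fun j => 1 / (j ! : ℂ) * iteratedDeriv j (ratFun B (n - j - 1)) (2 / z) *
          (1 / z ^ (j + 2))) rfl fun j hj => by rw [e2 j hj], h2] at h1
    simp only [ratFun] at h1
    simp only [map_sub, sub_div]
    linear_combination -h1 / 2

/-! ### The series evaluated at p = 1 -/

lemma tendsto_momentAvg_avgInv (r : ℕ) {w : ℂ} (hw : ‖w‖ ≤ 1 / 100) :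
    Tendsto (fun k => momentAvg (r + 1) k (2 + w)) atTop (𝓝 (avgInv 2 0 r w)) := by
  have hp := two_add_ne_zero hw
  have e : avgInv 2 0 r w = limAvg w (invPow (2 + w) (r + 1)) := by
    refine limAvg_congr hw fun x _ => ?_
    rw [invPow, inv_pow, one_div]
    ring
  have hc : ContinuousOn (invPow (2 + w) (r + 1)) (smallDisc w) := by
    unfold invPow
    refine (ContinuousOn.inv₀ (by fun_prop) fun x hx => ?_).pow _
    exact mul_ne_zero hp (ne_zero_of_mem_smallDisc hw hx)
  have hmem : 2 / (2 + w) ∈ smallDisc w := by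
    have h := smallDisc_branch hw (one_mem_smallDisc w)
    rwa [one_add_one_eq_two] at h
  rw [e]
  exact tendsto_limAvg hw hc hmem

/-- The values of the `H_n` at `0` are the Taylor coefficients of the limits of the averages, and
these are rapidly decreasing. -/
lemma derivs_at_zero (r : ℕ) :
    (∀ M : ℕ, ∃ A : ℝ, ∀ n : ℕ,
      ‖iteratedDeriv r (ratFun numerator n) 0‖ ≤ A / ((n : ℝ) + 1) ^ M) ∧
    (Summable fun n : ℕ => (-1 : ℂ) ^ n * iteratedDeriv r (ratFun numerator n) 0) ∧
    Tendsto (fun k => momentAvg (r + 1) k 1) atTop (𝓝 (1 / (r ! : ℂ) *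
      ∑' n : ℕ, (-1 : ℂ) ^ n * iteratedDeriv r (ratFun numerator n) 0)) := by
  obtain ⟨h, h1, h2⟩ := exists_coeff_tendsto_momentAvg (r + 1)
  have hf : (r ! : ℂ) ≠ 0 := by exact_mod_cast Nat.factorial_ne_zero r
  -- The rapidly decreasing series and the formal expansion describe the same limit for small w, so
  -- their coefficients agree.
  have hj : HasJets (avgInv 2 0 r) (PowerSeries.mk h) := by
    apply hasJets_of_hasSum
    filter_upwards [eventually_norm_le (by norm_num : (0 : ℝ) < 1 / 100)] with w hw
    obtain ⟨h3, h4⟩ := h2 w (by linarith)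
    rw [tendsto_nhds_unique (tendsto_momentAvg_avgInv r hw) h4]
    exact h3.hasSum
  have hcoeff : ∀ n, iteratedDeriv r (ratFun numerator n) 0 = r ! * h n := by
    intro n
    have h3 := coeff_avgJets_inv_two r n
    rw [← hj.unique (hasJets_avgInv two_ne_zero 0 r), PowerSeries.coeff_mk] at h3
    rw [h3]
    field_simp
  -- w = -1 means p = 1; it is a boundary point of the closed unit disc on which the series still
  -- represents the limit.
  obtain ⟨h5, h6⟩ := h2 (-1) (by simp)
  have hfun : (fun n : ℕ => (-1 : ℂ) ^ n * iteratedDeriv r (ratFun numerator n) 0) =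
      fun n => (r ! : ℂ) * (h n * (-1) ^ n) := by
    funext n
    rw [hcoeff]
    ring
  refine ⟨fun M => ?_, ?_, ?_⟩
  · obtain ⟨A, hA⟩ := h1 M
    refine ⟨r ! * A, fun n => ?_⟩
    rw [hcoeff, norm_mul, Complex.norm_natCast, mul_div_assoc]
    exact mul_le_mul_of_nonneg_left (hA n) (by positivity)
  · rw [hfun]
    exact h5.mul_left _
  · rw [hfun, tsum_mul_left, ← mul_assoc, one_div_mul_cancel hf, one_mul]
    rwa [show (2 : ℂ) + -1 = 1 by norm_num] at h6

lemma iteratedDeriv_ratFun_numerator_zero_rat (r n : ℕ) :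
    ∃ q : ℚ, iteratedDeriv r (ratFun numerator n) 0 = (q : ℂ) := by
  rw [iteratedDeriv_ratFun_numerator n r two_ne_zero.symm]
  refine ⟨∑ j ∈ Finset.range (n + 1), -(powCoeff j n) * ((-1) ^ r * (r ! * (j + r).choose r : ℕ)) *
        (1 / (0 - 2) ^ (j + r + 1)), ?_⟩
  push_cast
  rfl

/-! ### Continued fractions with a given sum of quotients -/

/-- Increase the first entry of a list by one. -/
def incHead : List ℕ → List ℕ
  | [] => []
  | a :: l => (a + 1) :: l

/-- The compositions of `k + 2` with last part at least `2`, generated by increasing the first part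
and by prepending `1`. -/
def generationLists : ℕ → Finset (List ℕ)
  | 0 => {[2]}
  | k + 1 => (generationLists k).image incHead ∪ (generationLists k).image (List.cons 1)

lemma mem_generationLists (k : ℕ) : ∀ l : List ℕ, l ∈ generationLists k ↔
    (∀ a ∈ l, 0 < a) ∧ l.sum = k + 2 ∧ 2 ≤ l.getLastD 0 := by
  induction k with
  | zero =>
    intro l
    rw [generationLists, Finset.mem_singleton]
    constructor
    · rintro rfl; simp
    · rintro ⟨hpos, hsum, hlast⟩
      match l, hpos, hsum, hlast with
      | [], _, hsum, _ => simp at hsum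
      | [a], _, hsum, _ => simp at hsum; rw [hsum]
      | a :: b :: t, hpos, hsum, hlast =>
        exfalso
        have ha := hpos a (by simp)
        have hb := hpos b (by simp)
        match t, hpos, hsum, hlast with
        | [], hpos, hsum, hlast => simp at hsum hlast; omega
        | c :: t, hpos, hsum, hlast =>
          have hc := hpos c (by simp)
          simp at hsum
          omega
  | succ k ih =>
    intro l
    rw [generationLists, Finset.mem_union, Finset.mem_image, Finset.mem_image]
    constructor
    · rintro (⟨m, hm, rfl⟩ | ⟨m, hm, rfl⟩)
      · obtain ⟨hpos, hsum, hlast⟩ := (ih m).1 hm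
        match m, hpos, hsum, hlast with
        | [], _, hsum, _ => simp at hsum
        | a :: t, hpos, hsum, hlast =>
          refine ⟨fun b hb => ?_, ?_, ?_⟩
          · rw [incHead, List.mem_cons] at hb
            rcases hb with rfl | hb
            · omega
            · exact hpos b (by simp [hb])
          · simp [incHead] at hsum ⊢; omega
          · match t, hlast with
            | [], hlast => simp [incHead] at hlast ⊢; omega
            | c :: t, hlast => simpa [incHead] using hlast
      · obtain ⟨hpos, hsum, hlast⟩ := (ih m).1 hm
        refine ⟨fun b hb => ?_, ?_, ?_⟩
        · rw [List.mem_cons] at hb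
          rcases hb with rfl | hb
          · omega
          · exact hpos b hb
        · simp at hsum ⊢; omega
        · match m, hsum, hlast with
          | [], hsum, _ => simp at hsum
          | c :: t, _, hlast => simpa using hlast
    · rintro ⟨hpos, hsum, hlast⟩
      match l, hpos, hsum, hlast with
      | [], _, hsum, _ => simp at hsum
      | 0 :: t, hpos, _, _ => simpa using hpos 0 (by simp)
      | 1 :: t, hpos, hsum, hlast =>
        refine Or.inr ⟨t, (ih t).2 ⟨fun b hb => hpos b (by simp [hb]), ?_, ?_⟩, rfl⟩
        · simp at hsum; omega
        · match t, hsum, hlast with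
          | [], hsum, _ => simp at hsum
          | c :: t, _, hlast => simpa using hlast
      | (a + 2) :: t, hpos, hsum, hlast =>
        refine Or.inl ⟨(a + 1) :: t, (ih _).2 ⟨fun b hb => ?_, ?_, ?_⟩, rfl⟩
        · rw [List.mem_cons] at hb
          rcases hb with rfl | hb
          · omega
          · exact hpos b (by simp [hb])
        · simp at hsum ⊢; omega
        · match t, hsum, hlast with
          | [], hsum, _ => simp at hsum ⊢; omega
          | c :: t, _, hlast => simpa using hlast

lemma exists_cons_of_mem_generationLists {k : ℕ} {l : List ℕ} (h : l ∈ generationLists k) :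
    ∃ a t, l = (a + 1) :: t := by
  obtain ⟨hpos, hsum, -⟩ := (mem_generationLists k l).1 h
  match l, hpos, hsum with
  | [], _, hsum => simp at hsum
  | 0 :: t, hpos, _ => exact absurd (hpos 0 (by simp)) (lt_irrefl 0)
  | (a + 1) :: t, _, _ => exact ⟨a, t, rfl⟩

lemma sum_generationLists_succ (k : ℕ) (g : List ℕ → ℂ) :
    ∑ l ∈ generationLists (k + 1), g l =
      ∑ l ∈ generationLists k, g (incHead l) + ∑ l ∈ generationLists k, g (1 :: l) := by
  rw [generationLists, Finset.sum_union, Finset.sum_image, Finset.sum_image]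
  · intro l _ m _ h
    exact (List.cons.inj h).2
  · intro l hl m hm h
    obtain ⟨a, t, rfl⟩ := exists_cons_of_mem_generationLists hl
    obtain ⟨b, s, rfl⟩ := exists_cons_of_mem_generationLists hm
    simpa [incHead] using h
  -- The entries are positive, so a raised first entry is at least 2 and cannot equal a prepended 1.
  · rw [Finset.disjoint_left]
    intro l h1 h2
    obtain ⟨m, hm, rfl⟩ := Finset.mem_image.1 h1
    obtain ⟨m', hm', h⟩ := Finset.mem_image.1 h2
    obtain ⟨a, t, rfl⟩ := exists_cons_of_mem_generationLists hm
    have := (List.cons.inj h).1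
    omega

lemma sum_generationLists (k : ℕ) : ∀ g : ℂ → ℂ,
    ∑ l ∈ generationLists k, g ((cfValue l : ℂ)⁻¹) = 2 ^ k * iterAvg 1 g k 2 := by
  induction k with
  | zero =>
    intro g
    simp [generationLists, iterAvg_zero, cfValue]
  | succ k ih =>
    intro g
    have h1 : ∑ l ∈ generationLists k, g ((cfValue (incHead l) : ℂ)⁻¹) =
        ∑ l ∈ generationLists k, g (((cfValue l : ℂ)⁻¹ + 1) / 1) := by
      refine Finset.sum_congr rfl fun l hl => ?_
      obtain ⟨a, t, rfl⟩ := exists_cons_of_mem_generationLists hl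
      congr 1
      simp only [incHead, cfValue]
      push_cast
      simp only [one_div, inv_inv, div_one]
      ring
    have h2 : ∑ l ∈ generationLists k, g ((cfValue (1 :: l) : ℂ)⁻¹) =
        ∑ l ∈ generationLists k, g ((((cfValue l : ℂ)⁻¹)⁻¹ + 1) / 1) := by
      refine Finset.sum_congr rfl fun l _ => ?_
      congr 1
      simp only [cfValue]
      push_cast
      simp only [one_div, inv_inv, div_one]
      ring
    rw [sum_generationLists_succ k fun l => g ((cfValue l : ℂ)⁻¹), h1, h2,
      ih fun x => g ((x + 1) / 1), ih fun x => g ((x⁻¹ + 1) / 1), iterAvg_succ_eq, pow_succ]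
    ring

lemma generationSum_eq (L k : ℕ) :
    (generationSum L (k + 2) : ℂ) = 2 ^ k * momentAvg L k 1 := by
  have h := sum_generationLists k (invPow 1 L)
  rw [momentAvg, div_one, ← h, generationSum]
  push_cast
  refine Finset.sum_nbij (fun c => c.blocks) ?_ ?_ ?_ ?_
  · intro c hc
    rw [Finset.mem_filter] at hc
    exact (mem_generationLists k _).2 ⟨fun a ha => c.blocks_pos ha, c.blocks_sum, hc.2⟩
  · intro c _ c' _ h
    exact Composition.ext h
  · intro l hl
    obtain ⟨h1, h2, h3⟩ := (mem_generationLists k l).1 hl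
    exact ⟨⟨l, fun {i} hi => h1 i hi, h2⟩, by simpa using h3, rfl⟩
  · intro c _
    simp [invPow]

lemma zpow_mul_generationSum (L k : ℕ) :
    (((2 : ℝ) ^ (2 - ((k + 2 : ℕ) : ℤ)) * generationSum L (k + 2) : ℝ) : ℂ) =
      momentAvg L k 1 := by
  have h2 : (2 : ℂ) ^ k ≠ 0 := pow_ne_zero _ two_ne_zero
  push_cast
  rw [generationSum_eq, show (2 : ℤ) - (k + 2) = -(k : ℤ) by ring, zpow_neg, zpow_natCast,
    inv_mul_cancel_left₀ h2]

/-! ### Functional equations and continuity of F -/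

lemma questionMark_of_nonneg {x : ℝ} (hx : 0 ≤ x) :
    questionMark x = 1 - (2 : ℝ) ^ (-⌊x⌋) * (1 - questionMarkTail x) := by
  rw [questionMark, if_neg (not_lt.2 hx), tsum_questionMarkTerm]

lemma questionMark_of_neg {x : ℝ} (hx : x < 0) : questionMark x = 0 := by
  rw [questionMark, if_pos hx]

lemma questionMark_le_one (x : ℝ) : questionMark x ≤ 1 := by
  rw [questionMark]
  split_ifs
  · norm_num
  · linarith [tsum_questionMarkTerm_nonneg x]

lemma questionMark_add_one {x : ℝ} (hx : 0 ≤ x) :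
    questionMark (x + 1) = (1 + questionMark x) / 2 := by
  have ht : questionMarkTail (x + 1) = questionMarkTail x := by
    simp only [questionMarkTail, Int.fract_add_one]
  rw [questionMark_of_nonneg hx, questionMark_of_nonneg (by linarith), ht, Int.floor_add_one,
    neg_add, zpow_add₀ (by norm_num)]
  norm_num
  ring

lemma questionMark_zero : questionMark 0 = 0 := by
  rw [questionMark_of_nonneg le_rfl, questionMarkTail]
  simp

lemma questionMark_one : questionMark 1 = 1 / 2 := by
  have := questionMark_add_one le_rfl
  rw [questionMark_zero] at this
  simpa using this

lemma questionMark_inv_of_one_lt {x : ℝ} (hx : 1 < x) :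
    questionMark x⁻¹ = 1 - questionMark x := by
  have hx0 : 0 < x := by linarith
  have hi0 : 0 < x⁻¹ := inv_pos.2 hx0
  have hi1 : x⁻¹ < 1 := inv_lt_one_of_one_lt₀ hx
  have hfl : ⌊x⁻¹⌋ = 0 := Int.floor_eq_zero_iff.2 ⟨hi0.le, hi1⟩
  have hfr : Int.fract x⁻¹ = x⁻¹ := Int.fract_eq_self.2 ⟨hi0.le, hi1⟩
  rw [questionMark_of_nonneg hi0.le, questionMarkTail, hfr, if_neg hi0.ne', inv_inv, hfl,
    questionMark, if_neg (not_lt.2 hx0.le)]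
  simp

lemma questionMark_inv {x : ℝ} (hx : 0 < x) : questionMark x⁻¹ = 1 - questionMark x := by
  rcases lt_trichotomy x 1 with h | rfl | h
  · have := questionMark_inv_of_one_lt ((one_lt_inv₀ hx).2 h)
    rw [inv_inv] at this
    linarith
  · rw [inv_one, questionMark_one]; norm_num
  · exact questionMark_inv_of_one_lt h

lemma questionMark_one_div_one_add {x : ℝ} (hx : 0 ≤ x) :
    questionMark (1 / (1 + x)) = (1 - questionMark x) / 2 := by
  rw [one_div, questionMark_inv (by linarith), add_comm, questionMark_add_one hx]
  ring

lemma questionMark_div_one_add {x : ℝ} (hx : 0 ≤ x) :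
    questionMark (x / (1 + x)) = questionMark x / 2 := by
  rcases hx.eq_or_lt with rfl | hx
  · rw [zero_div, questionMark_zero, zero_div]
  · have h1 : x / (1 + x) = 1 / (1 + x⁻¹) := by field_simp; ring
    rw [h1, questionMark_one_div_one_add (by positivity), questionMark_inv hx]
    ring

lemma questionMark_natCast (n : ℕ) : questionMark n = 1 - (1 / 2) ^ n := by
  induction n with
  | zero => simp [questionMark_zero]
  | succ n ih =>
    push_cast
    rw [questionMark_add_one (by positivity), ih, pow_succ]
    ring

lemma questionMark_one_div_succ (n : ℕ) : questionMark (1 / ((n : ℝ) + 1)) = (1 / 2) ^ (n + 1) := by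
  rw [one_div, questionMark_inv (by positivity)]
  have := questionMark_natCast (n + 1)
  push_cast at this
  rw [this]
  ring

/-- The maps x + 1 and x/(1+x) halve increments of F, and their images of (0,∞) cover everything
except x = 1. There F is squeezed using its explicit values at 1/(N+1). -/
lemma exists_questionMark_sub_le (N : ℕ) : ∀ x : ℝ, 0 < x →
    ∃ u v, 0 < u ∧ u < x ∧ x < v ∧ questionMark v - questionMark u ≤ (1 / 2) ^ N := by
  induction N with
  | zero =>
    intro x hx
    refine ⟨x / 2, 2 * x, by positivity, by linarith, by linarith, ?_⟩
    linarith [questionMark_le_one (2 * x), questionMark_nonneg (x / 2)]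
  | succ N ih =>
    intro x hx
    rcases lt_trichotomy x 1 with h | rfl | h
    · have h1x : 0 < 1 - x := by linarith
      obtain ⟨u, v, hu0, hu, hv, huv⟩ := ih (x / (1 - x)) (by positivity)
      rw [lt_div_iff₀ h1x] at hu
      rw [div_lt_iff₀ h1x] at hv
      have hv0 : 0 < v := by
        by_contra hneg
        nlinarith
      refine ⟨u / (1 + u), v / (1 + v), by positivity, ?_, ?_, ?_⟩
      · rw [div_lt_iff₀ (by positivity)]; linarith
      · rw [lt_div_iff₀ (by positivity)]; linarith
      · rw [questionMark_div_one_add hu0.le, questionMark_div_one_add hv0.le, pow_succ]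
        linarith
    · have h0 : (0 : ℝ) < 1 / ((N : ℝ) + 1) := by positivity
      refine ⟨1 / (1 + 1 / ((N : ℝ) + 1)), 1 / ((N : ℝ) + 1) + 1, by positivity, ?_, by linarith, ?_⟩
      · rw [div_lt_one (by positivity)]; linarith
      · rw [questionMark_one_div_one_add h0.le, questionMark_add_one h0.le,
          questionMark_one_div_succ]
        linarith
    · obtain ⟨u, v, hu0, hu, hv, huv⟩ := ih (x - 1) (by linarith)
      refine ⟨u + 1, v + 1, by linarith, by linarith, by linarith, ?_⟩
      rw [questionMark_add_one hu0.le, questionMark_add_one (by linarith), pow_succ]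
      linarith

lemma questionMark_continuous : Continuous questionMark := by
  rw [continuous_iff_continuousAt]
  intro x
  rcases lt_trichotomy x 0 with h | rfl | h
  · refine (continuousAt_const (y := (0 : ℝ))).congr ?_
    filter_upwards [gt_mem_nhds h] with y hy
    exact (questionMark_of_neg hy).symm
  · rw [Metric.continuousAt_iff']
    intro ε hε
    obtain ⟨N, hN⟩ := exists_pow_lt_of_lt_one hε (show (1 / 2 : ℝ) < 1 by norm_num)
    filter_upwards [gt_mem_nhds (show (0 : ℝ) < 1 / ((N : ℝ) + 1) by positivity)] with y hy
    rw [questionMark_zero, Real.dist_eq, sub_zero, abs_of_nonneg (questionMark_nonneg y)]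
    have h1 := questionMark_monotone hy.le
    rw [questionMark_one_div_succ, pow_succ] at h1
    have : (0 : ℝ) < (1 / 2) ^ N := by positivity
    linarith
  · rw [Metric.continuousAt_iff']
    intro ε hε
    obtain ⟨N, hN⟩ := exists_pow_lt_of_lt_one hε (show (1 / 2 : ℝ) < 1 by norm_num)
    obtain ⟨u, v, hu0, hu, hv, huv⟩ := exists_questionMark_sub_le N x h
    filter_upwards [lt_mem_nhds hu, gt_mem_nhds hv] with y hy1 hy2
    rw [Real.dist_eq, abs_lt]
    have h1 := questionMark_monotone hy1.le
    have h2 := questionMark_monotone hy2.le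
    have h3 := questionMark_monotone hu.le
    have h4 := questionMark_monotone hv.le
    constructor <;> linarith

lemma stieltjesFunction_questionMark (x : ℝ) :
    questionMark_monotone.stieltjesFunction x = questionMark x := by
  rw [Monotone.stieltjesFunction_eq]
  exact questionMark_continuous.continuousAt.continuousWithinAt.rightLim_eq

lemma questionMarkMeasure_Icc (a b : ℝ) :
    questionMarkMeasure (Set.Icc a b) = ENNReal.ofReal (questionMark b - questionMark a) := by
  have h : (questionMark_monotone.stieltjesFunction : ℝ → ℝ) = questionMark :=
    funext stieltjesFunction_questionMark
  rw [questionMarkMeasure, StieltjesFunction.measure_Icc, h,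
    questionMark_continuous.continuousAt.continuousWithinAt.leftLim_eq]

/-! ### The invariant measure and the moments -/

/-- The normalized measure `2 dF` on `[0, 1]`. -/
noncomputable def unitMeasure : Measure ℝ :=
  (2 : ENNReal) • questionMarkMeasure.restrict (Set.Icc 0 1)

lemma unitMeasure_apply {s : Set ℝ} (hs : MeasurableSet s) {a b : ℝ}
    (h : s ∩ Set.Icc 0 1 = Set.Icc a b) :
    unitMeasure s = ENNReal.ofReal (2 * (questionMark b - questionMark a)) := by
  rw [unitMeasure, Measure.smul_apply, Measure.restrict_apply hs, h, questionMarkMeasure_Icc,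
    smul_eq_mul, ENNReal.ofReal_mul (by norm_num)]
  norm_num

lemma unitMeasure_apply_empty {s : Set ℝ} (hs : MeasurableSet s) (h : s ∩ Set.Icc 0 1 = ∅) :
    unitMeasure s = 0 := by
  rw [unitMeasure, Measure.smul_apply, Measure.restrict_apply hs, h, measure_empty, smul_zero]

instance : IsProbabilityMeasure unitMeasure := by
  refine ⟨?_⟩
  rw [unitMeasure_apply MeasurableSet.univ (a := 0) (b := 1) (Set.univ_inter _), questionMark_zero,
    questionMark_one]
  norm_num

lemma measurable_branch_zero : Measurable fun v : ℝ => v / (1 + v) := by fun_prop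

lemma measurable_branch_one : Measurable fun v : ℝ => 1 / (1 + v) := by fun_prop

/-- The measure `2 dF` on `[0, 1]` is invariant under the average of the two Farey branches. -/
lemma unitMeasure_eq : unitMeasure = (2⁻¹ : ENNReal) •
    (unitMeasure.map (fun v : ℝ => v / (1 + v)) + unitMeasure.map fun v : ℝ => 1 / (1 + v)) := by
  have h0 := measurable_branch_zero
  have h1 := measurable_branch_one
  have hone : unitMeasure Set.univ = 1 := measure_univ
  refine Measure.ext_of_Iic _ _ fun a => ?_
  rw [Measure.smul_apply, Measure.add_apply, Measure.map_apply h0 measurableSet_Iic,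
    Measure.map_apply h1 measurableSet_Iic, smul_eq_mul]
  have m0 : MeasurableSet ((fun v : ℝ => v / (1 + v)) ⁻¹' Set.Iic a) := h0 measurableSet_Iic
  have m1 : MeasurableSet ((fun v : ℝ => 1 / (1 + v)) ⁻¹' Set.Iic a) := h1 measurableSet_Iic
  have hof : ∀ x y z : ℝ, 0 ≤ y → 0 ≤ z → x = (y + z) / 2 →
      ENNReal.ofReal x = 2⁻¹ * (ENNReal.ofReal y + ENNReal.ofReal z) := by
    intro x y z hy hz hx
    have h2 : (2⁻¹ : ENNReal) = ENNReal.ofReal (2⁻¹) := by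
      rw [ENNReal.ofReal_inv_of_pos (by norm_num)]; norm_num
    rw [← ENNReal.ofReal_add hy hz, h2, ← ENNReal.ofReal_mul (by norm_num), hx]
    congr 1
    ring
  rcases lt_or_ge a 0 with ha0 | ha0
  · rw [unitMeasure_apply_empty measurableSet_Iic, unitMeasure_apply_empty m0,
      unitMeasure_apply_empty m1]
    · simp
    · ext v
      simp only [Set.mem_inter_iff, Set.mem_preimage, Set.mem_Iic, Set.mem_Icc,
        Set.mem_empty_iff_false, iff_false]
      rintro ⟨h, hv0, hv1⟩
      have : 0 < 1 / (1 + v) := by positivity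
      linarith
    · ext v
      simp only [Set.mem_inter_iff, Set.mem_preimage, Set.mem_Iic, Set.mem_Icc,
        Set.mem_empty_iff_false, iff_false]
      rintro ⟨h, hv0, hv1⟩
      have : 0 ≤ v / (1 + v) := by positivity
      linarith
    · ext v
      simp only [Set.mem_inter_iff, Set.mem_Iic, Set.mem_Icc, Set.mem_empty_iff_false, iff_false]
      rintro ⟨h, hv0, hv1⟩
      linarith
  rcases lt_or_ge a 1 with ha1 | ha1
  · have e : Set.Iic a ∩ Set.Icc (0 : ℝ) 1 = Set.Icc 0 a := by
      ext v
      simp only [Set.mem_inter_iff, Set.mem_Iic, Set.mem_Icc]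
      constructor
      · rintro ⟨h1, h2, h3⟩; exact ⟨h2, h1⟩
      · rintro ⟨h1, h2⟩; exact ⟨h2, h1, by linarith⟩
    rw [unitMeasure_apply measurableSet_Iic e, questionMark_zero, sub_zero]
    -- The branch v/(1+v) maps [0,1] onto [0,1/2] and 1/(1+v) maps it onto [1/2,1], so only one of
    -- the two preimages is nontrivial for a given a.
    rcases lt_or_ge a (1 / 2) with ha2 | ha2
    · have hpos : 0 < 1 - a := by linarith
      have e0 : (fun v : ℝ => v / (1 + v)) ⁻¹' Set.Iic a ∩ Set.Icc (0 : ℝ) 1 =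
          Set.Icc 0 (a / (1 - a)) := by
        ext v
        simp only [Set.mem_inter_iff, Set.mem_preimage, Set.mem_Iic, Set.mem_Icc,
          le_div_iff₀ hpos]
        constructor
        · rintro ⟨h1, h2, h3⟩
          rw [div_le_iff₀ (by linarith)] at h1
          exact ⟨h2, by linarith⟩
        · rintro ⟨h1, h2⟩
          rw [div_le_iff₀ (by linarith)]
          exact ⟨by linarith, h1, by nlinarith⟩
      have e1 : (fun v : ℝ => 1 / (1 + v)) ⁻¹' Set.Iic a ∩ Set.Icc (0 : ℝ) 1 = ∅ := by
        ext v
        simp only [Set.mem_inter_iff, Set.mem_preimage, Set.mem_Iic, Set.mem_Icc,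
          Set.mem_empty_iff_false, iff_false]
        rintro ⟨h1, h2, h3⟩
        rw [div_le_iff₀ (by linarith)] at h1
        nlinarith
      rw [unitMeasure_apply m0 e0, unitMeasure_apply_empty m1 e1, questionMark_zero, sub_zero,
        ← ENNReal.ofReal_zero]
      have hF := questionMark_div_one_add (x := a / (1 - a)) (by positivity)
      have e2 : a / (1 - a) / (1 + a / (1 - a)) = a := by
        have : 1 + a / (1 - a) = 1 / (1 - a) := by field_simp; ring
        rw [this]
        field_simp
      rw [e2] at hF
      refine hof _ _ _ (mul_nonneg (by norm_num) (questionMark_nonneg _)) le_rfl ?_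
      rw [hF]
      ring
    · have hapos : 0 < a := by linarith
      have e0 : (fun v : ℝ => v / (1 + v)) ⁻¹' Set.Iic a ∩ Set.Icc (0 : ℝ) 1 =
          Set.Icc 0 1 := by
        ext v
        simp only [Set.mem_inter_iff, Set.mem_preimage, Set.mem_Iic, Set.mem_Icc]
        constructor
        · rintro ⟨h1, h2, h3⟩; exact ⟨h2, h3⟩
        · rintro ⟨h1, h2⟩
          rw [div_le_iff₀ (by linarith)]
          exact ⟨by nlinarith, h1, h2⟩
      have e1 : (fun v : ℝ => 1 / (1 + v)) ⁻¹' Set.Iic a ∩ Set.Icc (0 : ℝ) 1 =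
          Set.Icc (1 / a - 1) 1 := by
        ext v
        simp only [Set.mem_inter_iff, Set.mem_preimage, Set.mem_Iic, Set.mem_Icc]
        have h1a : 1 ≤ 1 / a := by rw [le_div_iff₀ hapos]; linarith
        constructor
        · rintro ⟨h1, h2, h3⟩
          rw [div_le_iff₀ (by linarith)] at h1
          refine ⟨?_, h3⟩
          rw [sub_le_iff_le_add, div_le_iff₀ hapos]
          linarith
        · rintro ⟨h1, h2⟩
          have h3 := h1
          rw [sub_le_iff_le_add, div_le_iff₀ hapos] at h1
          rw [div_le_iff₀ (by linarith)]
          exact ⟨by linarith, by linarith, h2⟩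
      have h1a : 0 ≤ 1 / a - 1 := by
        rw [sub_nonneg, le_div_iff₀ hapos]; linarith
      have h1b : 1 / a - 1 ≤ 1 := by
        rw [sub_le_iff_le_add, div_le_iff₀ hapos]; linarith
      rw [unitMeasure_apply m0 e0, unitMeasure_apply m1 e1, questionMark_zero, questionMark_one]
      have hF := questionMark_one_div_one_add h1a
      rw [show 1 / (1 + (1 / a - 1)) = a by rw [add_sub_cancel, one_div_one_div]] at hF
      have hmono := questionMark_monotone h1b
      rw [questionMark_one] at hmono
      refine hof _ _ _ (by norm_num) (by linarith) ?_
      rw [hF]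
      ring
  · have full : ∀ s : Set ℝ, MeasurableSet s → Set.Icc (0 : ℝ) 1 ⊆ s → unitMeasure s = 1 := by
      intro s hs hsub
      rw [unitMeasure_apply hs (Set.inter_eq_right.2 hsub), questionMark_zero, questionMark_one]
      norm_num
    rw [full _ measurableSet_Iic fun v hv => hv.2.trans ha1, full _ m0, full _ m1, one_add_one_eq_two,
      ENNReal.inv_mul_cancel (by norm_num) (by norm_num)]
    · intro v hv
      rw [Set.mem_preimage, Set.mem_Iic, div_le_iff₀ (by linarith [hv.1])]
      nlinarith [hv.1]
    · intro v hv
      rw [Set.mem_preimage, Set.mem_Iic, div_le_iff₀ (by linarith [hv.1])]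
      nlinarith [hv.1]

lemma ae_unitMeasure : ∀ᵐ v ∂unitMeasure, v ∈ Set.Icc (0 : ℝ) 1 := by
  rw [unitMeasure]
  exact Measure.ae_smul_measure (ae_restrict_mem measurableSet_Icc) _

lemma moment_eq_integral (L : ℕ) : moment L = ∫ v, v ^ L ∂unitMeasure := by
  rw [moment, unitMeasure, integral_smul_measure]
  simp

/-- The iterated averages of `v ^ L` over the two Farey branches. -/
noncomputable def fareyAvg (L : ℕ) : ℕ → ℝ → ℝ
  | 0, v => v ^ L
  | k + 1, v => (fareyAvg L k (v / (1 + v)) + fareyAvg L k (1 / (1 + v))) / 2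

lemma branch_zero_mem {v : ℝ} (hv : v ∈ Set.Icc (0 : ℝ) 1) : v / (1 + v) ∈ Set.Icc (0 : ℝ) 1 := by
  have h : 0 < 1 + v := by linarith [hv.1]
  exact ⟨div_nonneg hv.1 h.le, by rw [div_le_one h]; linarith⟩

lemma branch_one_mem {v : ℝ} (hv : v ∈ Set.Icc (0 : ℝ) 1) : 1 / (1 + v) ∈ Set.Icc (0 : ℝ) 1 := by
  have h : 0 < 1 + v := by linarith [hv.1]
  exact ⟨by positivity, by rw [div_le_one h]; linarith [hv.1]⟩

lemma measurable_fareyAvg (L k : ℕ) : Measurable (fareyAvg L k) := by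
  induction k with
  | zero => exact measurable_id.pow_const L
  | succ k ih =>
    exact ((ih.comp measurable_branch_zero).add (ih.comp measurable_branch_one)).div_const 2

lemma fareyAvg_mem (L k : ℕ) : ∀ v ∈ Set.Icc (0 : ℝ) 1, |fareyAvg L k v| ≤ 1 := by
  induction k with
  | zero =>
    intro v hv
    rw [fareyAvg, abs_pow, abs_of_nonneg hv.1]
    exact pow_le_one₀ hv.1 hv.2
  | succ k ih =>
    intro v hv
    have h1 := abs_le.1 (ih _ (branch_zero_mem hv))
    have h2 := abs_le.1 (ih _ (branch_one_mem hv))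
    rw [fareyAvg, abs_le]
    constructor <;> linarith [h1.1, h1.2, h2.1, h2.2]

lemma integrable_fareyAvg (L k : ℕ) : Integrable (fareyAvg L k) unitMeasure := by
  refine Integrable.of_bound (measurable_fareyAvg L k).aestronglyMeasurable 1 ?_
  filter_upwards [ae_unitMeasure] with v hv
  exact fareyAvg_mem L k v hv

lemma integral_fareyAvg (L k : ℕ) : ∫ v, fareyAvg L k v ∂unitMeasure = moment L := by
  induction k with
  | zero => exact (moment_eq_integral L).symm
  | succ k ih =>
    have hb0 : Integrable (fun v => fareyAvg L k (v / (1 + v))) unitMeasure := by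
      refine Integrable.of_bound
        ((measurable_fareyAvg L k).comp measurable_branch_zero).aestronglyMeasurable 1 ?_
      filter_upwards [ae_unitMeasure] with v hv
      exact fareyAvg_mem L k _ (branch_zero_mem hv)
    have hb1 : Integrable (fun v => fareyAvg L k (1 / (1 + v))) unitMeasure := by
      refine Integrable.of_bound
        ((measurable_fareyAvg L k).comp measurable_branch_one).aestronglyMeasurable 1 ?_
      filter_upwards [ae_unitMeasure] with v hv
      exact fareyAvg_mem L k _ (branch_one_mem hv)
    have hm := (measurable_fareyAvg L k).stronglyMeasurable
    have hi0 : Integrable (fareyAvg L k) (unitMeasure.map fun v : ℝ => v / (1 + v)) :=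
      (integrable_map_measure hm.aestronglyMeasurable measurable_branch_zero.aemeasurable).2 hb0
    have hi1 : Integrable (fareyAvg L k) (unitMeasure.map fun v : ℝ => 1 / (1 + v)) :=
      (integrable_map_measure hm.aestronglyMeasurable measurable_branch_one.aemeasurable).2 hb1
    rw [unitMeasure_eq, integral_smul_measure, integral_add_measure hi0 hi1,
      integral_map measurable_branch_zero.aemeasurable hm.aestronglyMeasurable,
      integral_map measurable_branch_one.aemeasurable hm.aestronglyMeasurable,
      ← integral_add hb0 hb1] at ih
    rw [← ih, ← integral_smul]
    refine integral_congr_ae (Eventually.of_forall fun v => ?_)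
    simp only [fareyAvg, ENNReal.toReal_inv, ENNReal.toReal_ofNat, smul_eq_mul]
    ring

/-- The substitution v = 1/X turns v/(1+v) and 1/(1+v) into X + 1 and 1/X + 1, the two maps for p =
1. -/
lemma fareyAvg_eq_iterAvg (L k : ℕ) : ∀ v : ℝ, 0 < v →
    (fareyAvg L k v : ℂ) = iterAvg 1 (invPow 1 L) k ((v : ℂ)⁻¹) := by
  induction k with
  | zero =>
    intro v hv
    simp [fareyAvg, iterAvg_zero, invPow]
  | succ k ih =>
    intro v hv
    have hv' : (v : ℂ) ≠ 0 := by exact_mod_cast hv.ne'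
    have h1 : 1 + (v : ℂ) ≠ 0 := by exact_mod_cast (by positivity : 1 + v ≠ 0)
    rw [fareyAvg, iterAvg_succ]
    push_cast
    rw [ih _ (by positivity), ih _ (by positivity)]
    push_cast
    congr 3
    · field_simp
    · field_simp
      ring

/-- [0,1] lies in the disc |v-2| < √5 with gap at least 1, and `DiscGood` holds at p = 1 for every
n. In the variable X the point 1/(1+u) is one shift of u, so the contraction applies. -/
lemma norm_fareyAvg_branch_sub_le (L k : ℕ) {u v : ℝ} (hu : u ∈ Set.Icc (0 : ℝ) 1)
    (hv : v ∈ Set.Icc (0 : ℝ) 1) :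
    |fareyAvg L k (1 / (1 + u)) - fareyAvg L k (1 / (1 + v))| ≤
      L * 10 ^ L * 10 * (19995 / 20000) ^ k * 10 := by
  have hgap : ∀ x ∈ Set.Icc (0 : ℝ) 1, 1 ≤ discGap (x : ℂ) := by
    intro x hx
    rw [discGap, show (x : ℂ) - 2 = ((x - 2 : ℝ) : ℂ) by push_cast; ring, Complex.norm_real,
      Real.norm_eq_abs, sq_abs]
    nlinarith [hx.1, hx.2]
  have he : ∀ x ∈ Set.Icc (0 : ℝ) 1, (fareyAvg L k (1 / (1 + x)) : ℂ) =
      iterAvg 1 (invPow 1 L) k (shiftIter 1 1 x) := by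
    intro x hx
    have : 0 < 1 + x := by linarith [hx.1]
    rw [fareyAvg_eq_iterAvg L k _ (by positivity), shiftIter_one]
    congr 1
    push_cast
    simp [add_comm]
  have h := norm_iterAvg_sub_le (p := 1) one_ne_zero (f := invPow 1 L) (C := L * 10 ^ L * 10)
    (by positivity) (fun a b => norm_invPow_sub_le (by norm_num) L) k 1 u v le_rfl
    (fun i hi _ => discGood_one hi) (by linarith [hgap u hu]) (by linarith [hgap v hv])
  rw [← he u hu, ← he v hv, ← Complex.ofReal_sub, Complex.norm_real, Real.norm_eq_abs] at h
  refine h.trans ?_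
  gcongr
  have h1 : 1 ≤ √(discGap u * discGap v) := by
    rw [Real.one_le_sqrt]
    nlinarith [hgap u hu, hgap v hv]
  rw [discDist, ← Complex.ofReal_sub, Complex.norm_real, Real.norm_eq_abs]
  refine (div_le_self (abs_nonneg _) h1).trans ?_
  rw [abs_le]
  constructor <;> linarith [hu.1, hu.2, hv.1, hv.2]

/-- The branch v/(1+v) is only bounded by the previous oscillation, the other by B t^k with B = L ·
10^L · 10 · 10. The constant 2 + 3B is preserved because ((2+3B) + B)/2 ≤ (2+3B)t for t =
19995/20000. -/
lemma abs_fareyAvg_sub_le (L k : ℕ) : ∀ u ∈ Set.Icc (0 : ℝ) 1, ∀ v ∈ Set.Icc (0 : ℝ) 1,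
    |fareyAvg L k u - fareyAvg L k v| ≤ (2 + 3 * (L * 10 ^ L * 10 * 10)) * (19995 / 20000) ^ k := by
  induction k with
  | zero =>
    intro u hu v hv
    have h1 := abs_le.1 (fareyAvg_mem L 0 u hu)
    have h2 := abs_le.1 (fareyAvg_mem L 0 v hv)
    have h3 : 0 ≤ (L : ℝ) * 10 ^ L * 10 * 10 := by positivity
    rw [pow_zero, mul_one, abs_le]
    constructor <;> linarith [h1.1, h1.2, h2.1, h2.2]
  | succ k ih =>
    intro u hu v hv
    have h1 := ih _ (branch_zero_mem hu) _ (branch_zero_mem hv)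
    have h2 := norm_fareyAvg_branch_sub_le L k hu hv
    have h3 : 0 ≤ (L : ℝ) * 10 ^ L * 10 * 10 := by positivity
    have h4 : (0 : ℝ) < (19995 / 20000) ^ k := by positivity
    rw [fareyAvg, fareyAvg, ← sub_div, add_sub_add_comm, abs_div, abs_two, pow_succ,
      div_le_iff₀ (by norm_num)]
    refine (abs_add_le _ _).trans ?_
    nlinarith

lemma tendsto_momentAvg_moment (L : ℕ) :
    Tendsto (fun k => momentAvg L k 1) atTop (𝓝 (moment L : ℂ)) := by
  have hhalf : ∀ k, momentAvg L k 1 = (fareyAvg L k (1 / 2) : ℂ) := by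
    intro k
    rw [fareyAvg_eq_iterAvg L k _ (by norm_num), momentAvg]
    norm_num
  have hmem : (1 / 2 : ℝ) ∈ Set.Icc (0 : ℝ) 1 := by norm_num
  have hb : ∀ k, |fareyAvg L k (1 / 2) - moment L| ≤
      (2 + 3 * (L * 10 ^ L * 10 * 10)) * (19995 / 20000) ^ k := by
    intro k
    -- Every iterate has the same integral m_L against a probability measure, so its value at 1/2
    -- differs from m_L by at most its oscillation.
    have h1 : fareyAvg L k (1 / 2) - moment L =
        ∫ v, (fareyAvg L k (1 / 2) - fareyAvg L k v) ∂unitMeasure := by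
      rw [integral_sub (integrable_const _) (integrable_fareyAvg L k), integral_fareyAvg]
      simp
    rw [h1, ← Real.norm_eq_abs]
    have h2 := norm_integral_le_of_norm_le_const (μ := unitMeasure)
      (f := fun v => fareyAvg L k (1 / 2) - fareyAvg L k v)
      (C := (2 + 3 * (L * 10 ^ L * 10 * 10)) * (19995 / 20000) ^ k) (by
        filter_upwards [ae_unitMeasure] with v hv
        exact abs_fareyAvg_sub_le L k _ hmem v hv)
    simpa using h2
  simp only [hhalf]
  refine (Complex.continuous_ofReal.tendsto _).comp ?_
  rw [tendsto_iff_dist_tendsto_zero]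
  refine squeeze_zero (fun k => dist_nonneg) (fun k => (Real.dist_eq _ _).trans_le (hb k)) ?_
  simpa using (tendsto_pow_atTop_nhds_zero_of_lt_one (r := (19995 / 20000 : ℝ)) (by norm_num)
    (by norm_num)).const_mul (2 + 3 * (L * 10 ^ L * 10 * 10) : ℝ)

lemma tendsto_generationSum (L : ℕ) :
    Tendsto (fun n : ℕ => (2 : ℝ) ^ (2 - (n : ℤ)) * generationSum L n) atTop (𝓝 (moment L)) := by
  rw [← tendsto_add_atTop_iff_nat 2]
  have h := Complex.continuous_re.continuousAt.tendsto.comp (tendsto_momentAvg_moment L)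
  refine h.congr fun k => ?_
  rw [Function.comp_apply, ← zpow_mul_generationSum, Complex.ofReal_re]

end MinkowskiMoments

theorem corollary1p3 :
    ∃ B : ℕ → ℚ[X], IsNumeratorSeq B ∧ (∀ B' : ℕ → ℚ[X], IsNumeratorSeq B' → B' = B) ∧
      ∀ L : ℕ, 1 ≤ L →
        Tendsto (fun n : ℕ => (2 : ℝ) ^ (2 - (n : ℤ)) * generationSum L n) atTop (𝓝 (moment L)) ∧
        (∀ n : ℕ, ∃ q : ℚ, iteratedDeriv (L - 1) (ratFun B n) 0 = (q : ℂ)) ∧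
        (Summable fun n : ℕ => (-1 : ℂ) ^ n * iteratedDeriv (L - 1) (ratFun B n) 0) ∧
        (moment L : ℂ) = 1 / ((L - 1)! : ℂ) *
          ∑' n : ℕ, (-1 : ℂ) ^ n * iteratedDeriv (L - 1) (ratFun B n) 0 ∧
        ∀ M : ℕ, ∃ C : ℝ, ∀ n : ℕ, 1 ≤ n →
          ‖iteratedDeriv (L - 1) (ratFun B n) 0‖ ≤ C / (n : ℝ) ^ M := by
  refine ⟨numerator, isNumeratorSeq_numerator, fun B' hB' => hB'.unique isNumeratorSeq_numerator,
    fun L hL => ?_⟩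
  obtain ⟨h1, h2, h3⟩ := derivs_at_zero (L - 1)
  rw [Nat.sub_add_cancel hL] at h3
  refine ⟨tendsto_generationSum L, fun n => iteratedDeriv_ratFun_numerator_zero_rat (L - 1) n, h2,
    tendsto_nhds_unique (tendsto_momentAvg_moment L) h3, fun M => ?_⟩
  obtain ⟨A, hA⟩ := h1 M
  -- The bound at n = 0 forces A ≥ 0, which permits replacing n + 1 by n in the denominator.
  have hA0 : 0 ≤ A := by
    have := (norm_nonneg _).trans (hA 0)
    simpa using this
  refine ⟨A, fun n hn => (hA n).trans ?_⟩
  have hn' : (0 : ℝ) < n := by exact_mod_cast hn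
  gcongr
  linarith
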